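/- Let $\mathcal K$ be a differential field of characteristic zero with derivation $\partial$, whose field of constants $\mathcal C$ is algebraically closed. A variety over $\mathcal C$ is a reduced separated $\mathcal C$-scheme of finite type. Let $G$ be an algebraic group over $\mathcal C$ and $M$ a $\mathcal C$-variety on which $G$ acts on the left. Assume that the action is homogeneous, i.e. $G\times_{\mathcal C}M\to M\times_{\mathcal C}M$, $(\sigma,x)\mapsto(\sigma x,x)$, is surjective, and faithful, i.e. the identity is the only element of $G(\mathcal C)$ that fixes every point of $M(\mathcal C)$. *Vector fields.* $\mathfrak X(Z)$ is the space of $\mathcal C$-derivations of the structure sheaf of a $\mathcal C$-scheme $Z$, and $\mathcal R(G)\subset\mathfrak X(G)$ is the subspace of right invariant vector fields. For $A\in\mathcal R(G)$, the fundamental field $A^M\in\mathfrak X(M)$ is the projection of the field $A\otimes 1$ of $G\times_{\mathcal C} M$ along the action $G\times_{\mathcal C} M\to M$. The space of fundamental fields is $\mathcal R(G,M)=\{A^M : A\in\mathcal R(G)\}$. For a $\mathcal C$-scheme $Z$ put $Z_{\mathcal K}=Z\times_{\mathcal C}\operatorname{Spec}\mathcal K$, a $\mathcal K$-scheme with canonical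 derivation, also denoted $\partial$, given by $a\otimes f\mapsto \partial a\otimes f$. For $\vec X=\sum_i f_i\vec X_i\in\mathfrak X(Z)\otimes_{\mathcal C}\mathcal K$, the derivation $\partial_{\vec X}$ of $Z_{\mathcal K}$ is $a\otimes f\mapsto\partial a\otimes f+\sum_i af_i\otimes\vec X_if$. *Lie–Vessiot systems.* Let $\vec X\in\mathcal R(G,M)\otimes_{\mathcal C}\mathcal K$ (a Lie–Vessiot vector field), and let $\vec A\in\mathcal R(G)\otimes_{\mathcal C}\mathcal K$ be the associated automorphic vector field, i.e. the one mapped to $\vec X$ by the $\mathcal K$-linear extension of $A\mapsto A^M$. *Automorphic equation.* The logarithmic derivative $l\partial(\sigma)$ of $\sigma\in G(\mathcal K)$ is the image, under the right translation by $\sigma^{-1}$, of the tangent vector $[\partial,\sigma^\sharp]=\partial\circ\sigma^\sharp-\sigma^\sharp\circ\partial$ to $G_{\mathcal K}$ at $\sigma$. It lies in $T_e(G_{\mathcal K})$, which is identified with $\mathcal R(G)\otimes_{\mathcal C}\mathcal K$ by evaluation of fields at $e$. The gauge transformation of $G_{\mathcal K}$ induced by $\sigma\in G(\mathcal K)$ is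 the left translation $g\mapsto\sigma g$. It sends $\vec A$ to $0$ if it transforms the derivation $\partial_{\vec A}$ into $\partial$. *Splitting and constants.* A $\mathcal K$-scheme with derivation splits if it is isomorphic, as a $\mathcal K$-scheme with derivation, to $(Y_{\mathcal K},\partial)$ for some $\mathcal C$-scheme $Y$. The space of constants $\operatorname{Const}(Z,D)$ of a scheme with derivation is the subspace of its differential points (those that correspond to $D$-stable prime ideals in their affine neighbourhoods), endowed with the restriction of the sheaf of functions annihilated by $D$. The scheme with derivation is almost-constant if this ringed space is a scheme. **Theorem.** The following statements are equivalent: 1. the automorphic equation $l\partial(x)=\vec A$ has a solution in $G(\mathcal K)$; 2. $(G_{\mathcal K},\partial_{\vec A})$ splits; 3. there is a gauge transformation of $G_{\mathcal K}$ that sends $\vec A$ to $0$; 4. $(M_{\mathcal K},\partial_{\vec X})$ splits; 5. $(G_{\mathcal K},\partial_{\vec A})$ splits, it is almost-constant, and $\operatorname{Const}(G_{\mathcal K},\partial_{\vec A})$ is isomorphic to $G$ over $\mathcal C$; 6. $(M_{\mathcal K},\partial_{\vec X})$ splits, it is almost-constant, and $\operatorname{Const}(M_{\mathcal K},\partial_{\vec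 X})$ is isomorphic to $M$ over $\mathcal C$. -/

import Mathlib

open CategoryTheory AlgebraicGeometry

universe u

namespace LieVessiot

open Limits Opposite TopologicalSpace MonoidalCategory CartesianMonoidalCategory
open scoped TensorProduct MonObj


/-! ### Ring-level preliminaries -/

lemma exists_lift_away {R S T : Type u} [CommRing R] [CommRing S] [CommRing T] [Algebra R S]
    (b : R) [IsLocalization.Away b S] (ρ : S →+* T) (φ : R →+* DualNumber T)
    (hφ : ∀ a, (φ a).fst = ρ (algebraMap R S a)) :
    ∃ ψ : S →+* DualNumber T, (∀ a, ψ (algebraMap R S a) = φ a) ∧ ∀ s, (ψ s).fst = ρ s := by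
  have hu : IsUnit (φ b) := by
    rw [TrivSqZeroExt.isUnit_iff_isUnit_fst, hφ]
    exact (IsLocalization.Away.algebraMap_isUnit b).map ρ
  refine ⟨IsLocalization.Away.lift b hu, fun a => IsLocalization.Away.lift_eq b hu a, ?_⟩
  intro s
  have : (TrivSqZeroExt.fstHom T T T).toRingHom.comp (IsLocalization.Away.lift b hu) = ρ := by
    refine IsLocalization.ringHom_ext (Submonoid.powers b) ?_
    ext a
    simp only [RingHom.comp_apply, IsLocalization.Away.lift_eq]
    exact hφ a
  exact congrArg (fun f : S →+* T => f s) this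

/-- The ring homomorphism `a ↦ ρ a + ε ρ (D a)` attached to a derivation `D`. -/
def dualHom {R T : Type u} [CommRing R] [CommRing T] (D : Derivation ℤ R R) (ρ : R →+* T) :
    R →+* DualNumber T where
  toFun a := (ρ a, ρ (D a))
  map_one' := by ext <;> simp [TrivSqZeroExt.fst, TrivSqZeroExt.snd] <;> rfl
  map_mul' a b := by
    refine Prod.ext ?_ ?_
    · change ρ (a * b) = ρ a * ρ b
      simp
    · change ρ (D (a * b)) = ρ a • ρ (D b) + MulOpposite.op (ρ b) • ρ (D a)
      simp [mul_comm]
  map_zero' := by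
    refine Prod.ext ?_ ?_
    · change ρ 0 = 0
      simp
    · change ρ (D 0) = 0
      simp
  map_add' a b := by
    refine Prod.ext ?_ ?_
    · change ρ (a + b) = ρ a + ρ b
      simp
    · change ρ (D (a + b)) = ρ (D a) + ρ (D b)
      simp

@[simp] lemma dualHom_fst {R T : Type u} [CommRing R] [CommRing T] (D : Derivation ℤ R R)
    (ρ : R →+* T) (a : R) : (dualHom D ρ a).fst = ρ a := rfl

@[simp] lemma dualHom_snd {R T : Type u} [CommRing R] [CommRing T] (D : Derivation ℤ R R)
    (ρ : R →+* T) (a : R) : (dualHom D ρ a).snd = ρ (D a) := rfl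

/-! ### Schemes with derivation -/

/-- A derivation of the structure sheaf of a scheme: a derivation of the ring of sections over
every open subset, compatible with restrictions. -/
structure SchemeDerivation (X : Scheme.{u}) where
  app (U : X.Opens) : Derivation ℤ Γ(X, U) Γ(X, U)
  map_res {U V : X.Opens} (h : V ≤ U) (s : Γ(X, U)) :
    app V (X.presheaf.map (homOfLE h).op s) = X.presheaf.map (homOfLE h).op (app U s)

@[ext] lemma SchemeDerivation.ext {X : Scheme.{u}} {D E : SchemeDerivation X}
    (h : ∀ U s, D.app U s = E.app U s) : D = E := by
  cases D; cases E
  congr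
  funext U
  exact Derivation.ext (h U)

/-- Restriction of sections. -/
abbrev res {X : Scheme.{u}} {U V : X.Opens} (h : V ≤ U) : Γ(X, U) →+* Γ(X, V) :=
  (X.presheaf.map (homOfLE h).op).hom

lemma res_res {X : Scheme.{u}} {U V W : X.Opens} (h : V ≤ U) (h' : W ≤ V) (s : Γ(X, U)) :
    res h' (res h s) = res (h'.trans h) s := by
  simp only [res, ← CommRingCat.comp_apply, ← X.presheaf.map_comp]
  rfl

lemma res_self {X : Scheme.{u}} {U : X.Opens} (h : U ≤ U) (s : Γ(X, U)) : res h s = s := by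
  simp [res]

lemma section_ext {X : Scheme.{u}} {U : X.Opens} {s t : Γ(X, U)}
    (h : ∀ x ∈ U, ∃ (V : X.Opens) (hV : V ≤ U), x ∈ V ∧ res hV s = res hV t) : s = t :=
  X.IsSheaf.section_ext h

/-- A prescription of the values of a derivation on some sections. -/
abbrev Prescription (P : Scheme.{u}) := ∀ U : P.Opens, Γ(P, U) → Γ(P, U) → Prop

/-- First-order deformations `id + ε d` of a restriction map along the prescribed values. -/
structure Respects {P : Scheme.{u}} (Gen : Prescription P) {W W' : P.Opens} (hW : W' ≤ W)
    (φ : Γ(P, W) →+* DualNumber Γ(P, W')) : Prop where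
  fst : ∀ s, (φ s).fst = res hW s
  snd : ∀ U s t, Gen U s t → ∀ h : W ≤ U, (φ (res h s)).snd = res (hW.trans h) t

lemma SchemeDerivation.respects {P : Scheme.{u}} {Gen : Prescription P} {D : SchemeDerivation P}
    (hD : ∀ U s t, Gen U s t → D.app U s = t) {W W' : P.Opens} (hW : W' ≤ W) :
    Respects Gen hW (dualHom (D.app W) (res hW)) where
  fst s := rfl
  snd U s t hg h := by
    rw [dualHom_snd, show D.app W (res h s) = res h (D.app U s) from D.map_res h s, hD U s t hg,
      res_res]

lemma Respects.restrict {P : Scheme.{u}} {Gen : Prescription P} {W W' : P.Opens} {hW : W' ≤ W}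
    {φ : Γ(P, W) →+* DualNumber Γ(P, W')} (h : Respects Gen hW φ) {V : P.Opens} (hV : V ≤ W') :
    ∃ ψ : Γ(P, W) →+* DualNumber Γ(P, V), Respects Gen (hV.trans hW) ψ ∧
      ∀ s, (ψ s).snd = res hV (φ s).snd := by
  let m : DualNumber Γ(P, W') →+* DualNumber Γ(P, V) :=
    { toFun x := (res hV x.fst, res hV x.snd)
      map_one' := Prod.ext (map_one (res hV)) (map_zero (res hV))
      map_zero' := Prod.ext (map_zero (res hV)) (map_zero (res hV))
      map_add' x y := Prod.ext (map_add (res hV) x.fst y.fst) (map_add (res hV) x.snd y.snd)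
      map_mul' x y := by
        refine Prod.ext (map_mul (res hV) x.fst y.fst) ?_
        change res hV (x.fst • y.snd + MulOpposite.op y.fst • x.snd) =
          res hV x.fst • res hV y.snd + MulOpposite.op (res hV y.fst) • res hV x.snd
        simp }
  refine ⟨m.comp φ, ⟨fun s => ?_, fun U s t hg hU => ?_⟩, fun s => rfl⟩
  · change res hV (φ s).fst = _
    rw [h.fst, res_res]
  · change res hV (φ (res hU s)).snd = _
    rw [h.snd U s t hg hU, res_res]

lemma Respects.corestrict {P : Scheme.{u}} {Gen : Prescription P} {V V' : P.Opens} {hV : V' ≤ V}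
    {φ : Γ(P, V) →+* DualNumber Γ(P, V')} (h : Respects Gen hV φ) {W : P.Opens} (hW : V ≤ W) :
    Respects Gen (hV.trans hW) (φ.comp (res hW)) where
  fst s := by rw [RingHom.comp_apply, h.fst, res_res]
  snd U s t hg hU := by rw [RingHom.comp_apply, res_res, h.snd U s t hg (hW.trans hU)]

/-- Derivations of a scheme are glued from derivations over a basis of open subsets, provided that
they are determined by their prescribed values. -/
theorem existsUnique_derivation {P : Scheme.{u}} (Gen : Prescription P) (B : Set P.Opens)
    (hB : Opens.IsBasis B)
    (hex : ∀ W ∈ B, ∃ φ : Γ(P, W) →+* DualNumber Γ(P, W), Respects Gen le_rfl φ)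
    (huniq : ∀ W ∈ B, ∀ (W' : P.Opens) (h : W' ≤ W) (φ ψ : Γ(P, W) →+* DualNumber Γ(P, W')),
      Respects Gen h φ → Respects Gen h ψ → φ = ψ) :
    ∃! D : SchemeDerivation P, ∀ U s t, Gen U s t → D.app U s = t := by
  choose θ hθ using hex
  have hloc : ∀ {U : P.Opens} {x : P}, x ∈ U → ∃ W ∈ B, x ∈ W ∧ W ≤ U := fun {U x} hx =>
    Opens.isBasis_iff_nbhd.mp hB hx
  -- compatibility on the basis
  have hcompat : ∀ (W : P.Opens) (hW : W ∈ B) (V : P.Opens) (hV : V ∈ B) (h : V ≤ W) (s : Γ(P, W)),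
      res h (θ W hW s).snd = (θ V hV (res h s)).snd := by
    intro W hW V hV h s
    obtain ⟨ψ, hψ, hψs⟩ := (hθ W hW).restrict h
    rw [← hψs, huniq W hW V h ψ _ hψ ((hθ V hV).corestrict h)]
    rfl
  -- gluing
  have key : ∀ (V : P.Opens) (s : Γ(P, V)), ∃ t : Γ(P, V),
      ∀ (W : P.Opens) (hW : W ∈ B) (h : W ≤ V), res h t = (θ W hW (res h s)).snd := by
    intro V s
    let J := {W : P.Opens // W ∈ B ∧ W ≤ V}
    obtain ⟨t, ht, -⟩ := TopCat.Sheaf.existsUnique_gluing' P.sheaf (fun i : J => i.1) V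
      (fun i => homOfLE i.2.2)
      (by
        intro x hx
        obtain ⟨W, hW, hxW, hWV⟩ := hloc hx
        exact Opens.mem_iSup.mpr ⟨⟨W, hW, hWV⟩, hxW⟩)
      (fun i => (θ i.1 i.2.1 (res i.2.2 s)).snd)
      (by
        intro i j
        refine section_ext fun x hx => ?_
        obtain ⟨W, hW, hxW, hWV⟩ := hloc hx
        refine ⟨W, hWV, hxW, ?_⟩
        change res hWV (res inf_le_left _) = res hWV (res inf_le_right _)
        rw [res_res, res_res, hcompat _ _ _ hW, hcompat _ _ _ hW, res_res, res_res])
    exact ⟨t, fun W hW h => ht ⟨W, hW, h⟩⟩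
  choose d hd using key
  have hd_ext : ∀ (V : P.Opens) (t t' : Γ(P, V)),
      (∀ (W : P.Opens) (_ : W ∈ B) (h : W ≤ V), res h t = res h t') → t = t' := by
    intro V t t' h
    refine section_ext fun x hx => ?_
    obtain ⟨W, hW, hxW, hWV⟩ := hloc hx
    exact ⟨W, hWV, hxW, h W hW hWV⟩
  refine ⟨⟨fun V => Derivation.mk' (AddMonoidHom.toIntLinearMap
    (AddMonoidHom.mk' (d V) fun a b => hd_ext V _ _ fun W hW h => ?_)) fun a b =>
      hd_ext V _ _ fun W hW h => ?_, fun {U V} h s => hd_ext V _ _ fun W hW h' => ?_⟩,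
      fun U s t hg => hd_ext U _ _ fun W hW h => ?_, fun D hD => ?_⟩
  · rw [hd V (a + b) W hW h, map_add, map_add, map_add, hd V a W hW h, hd V b W hW h]
    rfl
  · change res h (d V (a * b)) = res h (a • d V b + b • d V a)
    rw [hd V (a * b) W hW h, map_mul, map_mul, smul_eq_mul, smul_eq_mul, map_add, map_mul, map_mul,
      hd V a W hW h, hd V b W hW h, DualNumber.snd_mul, (hθ W hW).fst, (hθ W hW).fst, res_self,
      res_self]
    ring
  · change res h' (d V (res h s)) = res h' (res h (d U s))
    rw [hd V _ W hW h', res_res, res_res, hd U s W hW]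
  · change res h (d U s) = res h t
    rw [hd U s W hW h, (hθ W hW).snd U s t hg h]
  · ext U s
    refine hd_ext U _ _ fun W hW h => ?_
    change res h (D.app U s) = res h (d U s)
    rw [hd U s W hW h, ← huniq W hW W le_rfl _ _ (SchemeDerivation.respects hD le_rfl) (hθ W hW),
      dualHom_snd, res_self]
    exact (D.map_res h s).symm


/-! ### Construction on affine schemes and on fibre products -/

lemma exists_lift_basicOpen {P : Scheme.{u}} {Z : P.Opens} (hZ : IsAffineOpen Z) (b : Γ(P, Z))
    {T : Type u} [CommRing T] (ρ : Γ(P, P.basicOpen b) →+* T) (φ : Γ(P, Z) →+* DualNumber T)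
    (hφ : ∀ a, (φ a).fst = ρ (res (P.basicOpen_le b) a)) :
    ∃ ψ : Γ(P, P.basicOpen b) →+* DualNumber T,
      (∀ a, ψ (res (P.basicOpen_le b) a) = φ a) ∧ ∀ s, (ψ s).fst = ρ s := by
  have := hZ.isLocalization_basicOpen b
  exact exists_lift_away b ρ φ hφ

lemma ringHom_ext_basicOpen {P : Scheme.{u}} {Z : P.Opens} (hZ : IsAffineOpen Z) (b : Γ(P, Z))
    {T : Type u} [CommRing T] {φ ψ : Γ(P, P.basicOpen b) →+* T}
    (h : ∀ a, φ (res (P.basicOpen_le b) a) = ψ (res (P.basicOpen_le b) a)) : φ = ψ := by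
  have := hZ.isLocalization_basicOpen b
  exact IsLocalization.ringHom_ext (Submonoid.powers b) (RingHom.ext h)

/-- The prescription on `Spec R` given by a derivation of `R`. -/
inductive SpecGen (R : CommRingCat.{u}) (d : Derivation ℤ R R) : Prescription (Spec R)
  | mk (a : R) : SpecGen R d ⊤ ((Scheme.ΓSpecIso R).inv a) ((Scheme.ΓSpecIso R).inv (d a))

theorem existsUnique_specDerivation (R : CommRingCat.{u}) (d : Derivation ℤ R R) :
    ∃! D : SchemeDerivation (Spec R), ∀ a : R,
      D.app ⊤ ((Scheme.ΓSpecIso R).inv a) = (Scheme.ΓSpecIso R).inv (d a) := by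
  have hinv : ∀ x : Γ(Spec R, ⊤), ∃ a : R, (Scheme.ΓSpecIso R).inv a = x := fun x =>
    ⟨(Scheme.ΓSpecIso R).hom x, by simp⟩
  have htop : IsAffineOpen (⊤ : (Spec R).Opens) := isAffineOpen_top _
  have main := existsUnique_derivation (SpecGen R d)
    (Set.range ((Spec R).basicOpen : Γ(Spec R, ⊤) → (Spec R).Opens))
    (isBasis_basicOpen (Spec R)) ?_ ?_
  · refine (existsUnique_congr fun D => ?_).mp main
    refine ⟨fun h a => h _ _ _ (.mk a), fun h U s t hg => ?_⟩
    cases hg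
    exact h _
  · rintro _ ⟨b, rfl⟩
    obtain ⟨ψ, hψ, hψ'⟩ := exists_lift_basicOpen htop b (RingHom.id _)
      ((dualHom d ((res ((Spec R).basicOpen_le b)).comp (Scheme.ΓSpecIso R).inv.hom)).comp
        (Scheme.ΓSpecIso R).hom.hom) (fun a => by simp)
    refine ⟨ψ, fun s => by rw [hψ', res_self]; rfl, fun U s t hg h => ?_⟩
    cases hg with
    | mk a =>
      rw [hψ]
      simp
  · rintro _ ⟨b, rfl⟩ W' h φ ψ hφ hψ
    refine ringHom_ext_basicOpen htop b fun x => ?_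
    obtain ⟨a, rfl⟩ := hinv x
    refine TrivSqZeroExt.ext ?_ ?_
    · rw [hφ.fst, hψ.fst]
    · rw [hφ.snd _ _ _ (.mk a), hψ.snd _ _ _ (.mk a)]

/-- The derivation of `Spec R` induced by a derivation of the ring `R`. -/
noncomputable def specDerivation (R : CommRingCat.{u}) (d : Derivation ℤ R R) :
    SchemeDerivation (Spec R) :=
  (existsUnique_specDerivation R d).choose

lemma specDerivation_app (R : CommRingCat.{u}) (d : Derivation ℤ R R) (a : R) :
    (specDerivation R d).app ⊤ ((Scheme.ΓSpecIso R).inv a) = (Scheme.ΓSpecIso R).inv (d a) :=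
  (existsUnique_specDerivation R d).choose_spec.1 a

/-- A morphism of schemes with derivation: the induced maps on sections commute with the
derivations. -/
def IsDifferential {X Y : Scheme.{u}} (D : SchemeDerivation X) (E : SchemeDerivation Y)
    (f : X ⟶ Y) : Prop :=
  ∀ (U : Y.Opens) (s : Γ(Y, U)), D.app (f ⁻¹ᵁ U) (f.app U s) = f.app U (E.app U s)

/-- The prescription on `X ×_S Y` given by derivations of `X` and of `Y`. -/
inductive ProdGen {X Y S : Scheme.{u}} (f : X ⟶ S) (g : Y ⟶ S) (D : SchemeDerivation X)
    (E : SchemeDerivation Y) : Prescription (pullback f g)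
  | fst (U : X.Opens) (a : Γ(X, U)) : ProdGen f g D E (pullback.fst f g ⁻¹ᵁ U)
      ((pullback.fst f g).app U a) ((pullback.fst f g).app U (D.app U a))
  | snd (V : Y.Opens) (b : Γ(Y, V)) : ProdGen f g D E (pullback.snd f g ⁻¹ᵁ V)
      ((pullback.snd f g).app V b) ((pullback.snd f g).app V (E.app V b))

lemma preimage_le {X Y : Scheme.{u}} (f : X ⟶ Y) {U V : Y.Opens} (h : V ≤ U) :
    f ⁻¹ᵁ V ≤ f ⁻¹ᵁ U := fun _ hx => h hx

lemma res_app {X Y : Scheme.{u}} (f : X ⟶ Y) {U V : Y.Opens} (h : V ≤ U) (s : Γ(Y, U)) :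
    f.app V (res h s) = res (preimage_le f h) (f.app U s) := by
  have := f.naturality (homOfLE h).op
  exact congrArg (fun k => k.hom s) this

/-- If `φ` deforms the identity of `Γ(P, W)` and follows the derivation `D` on the functions pulled
back from the affine open subset `U`, then it follows `D` on all functions pulled back from `X`. -/
lemma snd_eq_of_affine {P X : Scheme.{u}} (p : P ⟶ X) (D : SchemeDerivation X) {W : P.Opens}
    (hWaff : IsAffineOpen W) {U : X.Opens} (hU : IsAffineOpen U) (hWU : W ≤ p ⁻¹ᵁ U)
    (φ : Γ(P, W) →+* DualNumber Γ(P, W)) (hfst : ∀ s, (φ s).fst = s)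
    (hφ : ∀ a : Γ(X, U), (φ (res hWU (p.app U a))).snd = res hWU (p.app U (D.app U a)))
    (U' : X.Opens) (hWU' : W ≤ p ⁻¹ᵁ U') (a : Γ(X, U')) :
    (φ (res hWU' (p.app U' a))).snd = res hWU' (p.app U' (D.app U' a)) := by
  refine section_ext fun w hw => ?_
  obtain ⟨c, hcU', hxc⟩ := hU.exists_basicOpen_le (V := U') ⟨p w, hWU' hw⟩ (hWU hw)
  let c' : Γ(P, W) := res hWU (p.app U c)
  have hbasic : P.basicOpen c' = W ⊓ p ⁻¹ᵁ X.basicOpen c := by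
    rw [Scheme.basicOpen_res, Scheme.preimage_basicOpen]
  have hle : P.basicOpen c' ≤ p ⁻¹ᵁ X.basicOpen c := hbasic.le.trans inf_le_right
  refine ⟨P.basicOpen c', P.basicOpen_le _, ?_, ?_⟩
  · rw [hbasic]
    exact ⟨hw, hxc⟩
  -- extend `φ` to the smaller open subset
  let hV : P.basicOpen c' ≤ W := P.basicOpen_le _
  let m : DualNumber Γ(P, W) →+* DualNumber Γ(P, P.basicOpen c') :=
    { toFun x := (res hV x.fst, res hV x.snd)
      map_one' := Prod.ext (map_one (res hV)) (map_zero (res hV))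
      map_zero' := Prod.ext (map_zero (res hV)) (map_zero (res hV))
      map_add' x y := Prod.ext (map_add (res hV) x.fst y.fst) (map_add (res hV) x.snd y.snd)
      map_mul' x y := by
        refine Prod.ext (map_mul (res hV) x.fst y.fst) ?_
        change res hV (x.fst • y.snd + MulOpposite.op y.fst • x.snd) =
          res hV x.fst • res hV y.snd + MulOpposite.op (res hV y.fst) • res hV x.snd
        simp }
  obtain ⟨ψ, hψ, hψ'⟩ := exists_lift_basicOpen hWaff c' (RingHom.id _) (m.comp φ) (fun s => by
    change res hV (φ s).fst = _
    rw [hfst]; rfl)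
  have heq : ψ.comp ((res hle).comp (p.app (X.basicOpen c)).hom) =
      dualHom (D.app (X.basicOpen c)) ((res hle).comp (p.app (X.basicOpen c)).hom) := by
    refine ringHom_ext_basicOpen hU c fun y => ?_
    refine TrivSqZeroExt.ext ?_ ?_
    · simp only [RingHom.comp_apply, hψ', dualHom_fst, RingHom.id_apply]
    · have e1 : res hle (p.app (X.basicOpen c) (res (X.basicOpen_le c) y)) =
          res hV (res hWU (p.app U y)) := by
        rw [res_app, res_res, res_res]
      have e2 : D.app (X.basicOpen c) (res (X.basicOpen_le c) y) =
          res (X.basicOpen_le c) (D.app U y) := D.map_res _ _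
      rw [dualHom_snd, e2]
      change (ψ (res hle (p.app (X.basicOpen c) (res (X.basicOpen_le c) y)))).snd =
        res hle (p.app (X.basicOpen c) (res (X.basicOpen_le c) (D.app U y)))
      rw [e1, hψ, res_app, res_res]
      change res hV (φ (res hWU (p.app U y))).snd = _
      rw [hφ, res_res]
  have h1 := congrArg (fun k => (k (res hcU' a)).snd) heq
  rw [dualHom_snd, show D.app _ (res hcU' a) = res hcU' (D.app U' a) from D.map_res _ _] at h1
  change (ψ (res hle (p.app (X.basicOpen c) (res hcU' a)))).snd =
    res hle (p.app (X.basicOpen c) (res hcU' (D.app U' a))) at h1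
  have e3 : ∀ z : Γ(X, U'), res hle (p.app (X.basicOpen c) (res hcU' z)) =
      res hV (res hWU' (p.app U' z)) := fun z => by
    rw [res_app, res_res, res_res]
  rw [e3, e3, hψ] at h1
  exact h1

section Prod

variable {X Y S : Scheme.{u}} [IsAffine S] (f : X ⟶ S) (g : Y ⟶ S)

lemma isPushout_prod {U : X.Opens} (hU : IsAffineOpen U) {V : Y.Opens} (hV : IsAffineOpen V) :
    IsPushout (f.appLE ⊤ U le_top) (g.appLE ⊤ V le_top)
      ((pullback.fst f g).appLE U (pullback.fst f g ⁻¹ᵁ U ⊓ pullback.snd f g ⁻¹ᵁ V) inf_le_left)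
      ((pullback.snd f g).appLE V (pullback.fst f g ⁻¹ᵁ U ⊓ pullback.snd f g ⁻¹ᵁ V)
        inf_le_right) :=
  (isIso_pushoutSection_iff (IsPullback.of_hasPullback f g) (US := ⊤) le_top le_top rfl).mp
    (isIso_pushoutSection_of_isAffineOpen _ _ _ _ (isAffineOpen_top S) hV hU)

lemma isAffineOpen_prod {U : X.Opens} (hU : IsAffineOpen U) {V : Y.Opens} (hV : IsAffineOpen V) :
    IsAffineOpen (pullback.fst f g ⁻¹ᵁ U ⊓ pullback.snd f g ⁻¹ᵁ V) := by
  have : IsAffine _ := hU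
  have : IsAffine _ := hV
  have : IsAffine _ := isAffineOpen_top S
  exact .of_isIso (Scheme.Hom.isPullback_resLE (IsPullback.of_hasPullback f g)
    (US := ⊤) le_top le_top rfl).isoPullback.hom

/-- The derivation `D ⊗ 1 + 1 ⊗ E` of `X ×_S Y`, for derivations `D` of `X` and `E` of `Y` which
vanish on the functions of the affine scheme `S`, exists and is unique. -/
theorem existsUnique_prodDerivation (D : SchemeDerivation X) (E : SchemeDerivation Y)
    (hD : ∀ c : Γ(S, ⊤), D.app ⊤ (f.app ⊤ c) = 0) (hE : ∀ c : Γ(S, ⊤), E.app ⊤ (g.app ⊤ c) = 0) :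
    ∃! F : SchemeDerivation (pullback f g),
      IsDifferential F D (pullback.fst f g) ∧ IsDifferential F E (pullback.snd f g) := by
  let P := pullback f g
  let p : P ⟶ X := pullback.fst f g
  let q : P ⟶ Y := pullback.snd f g
  let B : Set P.Opens := {W | ∃ (U : X.Opens) (V : Y.Opens), IsAffineOpen U ∧ IsAffineOpen V ∧
    ∃ b : Γ(P, p ⁻¹ᵁ U ⊓ q ⁻¹ᵁ V), W = P.basicOpen b}
  have hB : Opens.IsBasis B := by
    refine Opens.isBasis_iff_nbhd.mpr fun {O x} hx => ?_
    obtain ⟨U, hU, hxU, -⟩ := Opens.isBasis_iff_nbhd.mp X.isBasis_affineOpens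
      (show p x ∈ (⊤ : X.Opens) from trivial)
    obtain ⟨V, hV, hxV, -⟩ := Opens.isBasis_iff_nbhd.mp Y.isBasis_affineOpens
      (show q x ∈ (⊤ : Y.Opens) from trivial)
    obtain ⟨b, hb, hxb⟩ := (isAffineOpen_prod f g hU hV).exists_basicOpen_le (V := O) ⟨x, hx⟩
      ⟨hxU, hxV⟩
    exact ⟨_, ⟨U, V, hU, hV, b, rfl⟩, hxb, hb⟩
  have main := existsUnique_derivation (ProdGen f g D E) B hB ?_ ?_
  · refine (existsUnique_congr fun F => ?_).mp main
    refine ⟨fun h => ⟨fun U a => h _ _ _ (.fst U a), fun V b => h _ _ _ (.snd V b)⟩,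
      fun h U s t hg => ?_⟩
    cases hg with
    | fst U a => exact h.1 U a
    | snd V b => exact h.2 V b
  · rintro _ ⟨U, V, hU, hV, b, rfl⟩
    have hpo := isPushout_prod f g hU hV
    let hZ := isAffineOpen_prod f g hU hV
    let r := res (P.basicOpen_le b)
    let α : Γ(X, U) →+* Γ(P, P.basicOpen b) :=
      r.comp (p.appLE U (p ⁻¹ᵁ U ⊓ q ⁻¹ᵁ V) inf_le_left).hom
    let β : Γ(Y, V) →+* Γ(P, P.basicOpen b) :=
      r.comp (q.appLE V (p ⁻¹ᵁ U ⊓ q ⁻¹ᵁ V) inf_le_right).hom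
    have hDU : ∀ c : Γ(S, ⊤), D.app U (f.appLE ⊤ U le_top c) = 0 := fun c => by
      have : f.appLE ⊤ U le_top c = res (U := f ⁻¹ᵁ ⊤) le_top (f.app ⊤ c) := rfl
      rw [this]
      refine (D.map_res (U := f ⁻¹ᵁ ⊤) (le_top : U ≤ f ⁻¹ᵁ ⊤) (f.app ⊤ c)).trans ?_
      rw [show D.app (f ⁻¹ᵁ ⊤) (f.app ⊤ c) = 0 from hD c, map_zero]
    have hEV : ∀ c : Γ(S, ⊤), E.app V (g.appLE ⊤ V le_top c) = 0 := fun c => by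
      have : g.appLE ⊤ V le_top c = res (U := g ⁻¹ᵁ ⊤) le_top (g.app ⊤ c) := rfl
      rw [this]
      refine (E.map_res (U := g ⁻¹ᵁ ⊤) (le_top : V ≤ g ⁻¹ᵁ ⊤) (g.app ⊤ c)).trans ?_
      rw [show E.app (g ⁻¹ᵁ ⊤) (g.app ⊤ c) = 0 from hE c, map_zero]
    have hw : f.appLE ⊤ U le_top ≫ CommRingCat.ofHom (dualHom (D.app U) α) =
        g.appLE ⊤ V le_top ≫ CommRingCat.ofHom (dualHom (E.app V) β) := by
      refine CommRingCat.hom_ext (RingHom.ext fun c => TrivSqZeroExt.ext ?_ ?_)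
      · change α (f.appLE ⊤ U le_top c) = β (g.appLE ⊤ V le_top c)
        exact congrArg r (congrArg (fun k => k.hom c) hpo.w)
      · change α (D.app U (f.appLE ⊤ U le_top c)) = β (E.app V (g.appLE ⊤ V le_top c))
        rw [hDU, hEV, map_zero, map_zero]
    let φ₀ : Γ(P, p ⁻¹ᵁ U ⊓ q ⁻¹ᵁ V) →+* DualNumber Γ(P, P.basicOpen b) := (hpo.desc _ _ hw).hom
    have hφp : ∀ a : Γ(X, U), φ₀ (p.appLE U (p ⁻¹ᵁ U ⊓ q ⁻¹ᵁ V) inf_le_left a) =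
        dualHom (D.app U) α a := fun a =>
      congrArg (fun k => k.hom a) (hpo.inl_desc _ _ hw)
    have hφq : ∀ a : Γ(Y, V), φ₀ (q.appLE V (p ⁻¹ᵁ U ⊓ q ⁻¹ᵁ V) inf_le_right a) =
        dualHom (E.app V) β a := fun a =>
      congrArg (fun k => k.hom a) (hpo.inr_desc _ _ hw)
    have hφfst : ∀ s, (φ₀ s).fst = r s := by
      have : CommRingCat.ofHom ((TrivSqZeroExt.fstHom Γ(P, P.basicOpen b) Γ(P, P.basicOpen b)
          Γ(P, P.basicOpen b)).toRingHom.comp φ₀) = CommRingCat.ofHom r := by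
        refine hpo.hom_ext ?_ ?_
        · ext a
          change (φ₀ (p.appLE U (p ⁻¹ᵁ U ⊓ q ⁻¹ᵁ V) inf_le_left a)).fst = _
          rw [hφp]; rfl
        · ext a
          change (φ₀ (q.appLE V (p ⁻¹ᵁ U ⊓ q ⁻¹ᵁ V) inf_le_right a)).fst = _
          rw [hφq]; rfl
      exact fun s => congrArg (fun k => k.hom s) this
    obtain ⟨ψ, hψ, hψ'⟩ := exists_lift_basicOpen hZ b (RingHom.id _) φ₀ hφfst
    have hWaff : IsAffineOpen (P.basicOpen b) := hZ.basicOpen b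
    refine ⟨ψ, fun s => by rw [hψ', res_self]; rfl, fun O s t hg h => ?_⟩
    cases hg with
    | fst U' a =>
      refine snd_eq_of_affine p D hWaff hU ((P.basicOpen_le b).trans inf_le_left) ψ hψ' ?_ U' h a
      intro a
      have e : ∀ a : Γ(X, U), res ((P.basicOpen_le b).trans inf_le_left) (p.app U a) =
          r (p.appLE U (p ⁻¹ᵁ U ⊓ q ⁻¹ᵁ V) inf_le_left a) := fun a => by
        rw [← res_res (inf_le_left : p ⁻¹ᵁ U ⊓ q ⁻¹ᵁ V ≤ p ⁻¹ᵁ U) (P.basicOpen_le b)]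
        rfl
      rw [e, e, hψ, hφp]
      rfl
    | snd V' a =>
      refine snd_eq_of_affine q E hWaff hV ((P.basicOpen_le b).trans inf_le_right) ψ hψ' ?_ V' h a
      intro a
      have e : ∀ a : Γ(Y, V), res ((P.basicOpen_le b).trans inf_le_right) (q.app V a) =
          r (q.appLE V (p ⁻¹ᵁ U ⊓ q ⁻¹ᵁ V) inf_le_right a) := fun a => by
        rw [← res_res (inf_le_right : p ⁻¹ᵁ U ⊓ q ⁻¹ᵁ V ≤ q ⁻¹ᵁ V) (P.basicOpen_le b)]
        rfl
      rw [e, e, hψ, hφq]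
      rfl
  · rintro _ ⟨U, V, hU, hV, b, rfl⟩ W' h φ ψ hφ hψ
    have hpo := isPushout_prod f g hU hV
    refine ringHom_ext_basicOpen (isAffineOpen_prod f g hU hV) b fun x => ?_
    have : CommRingCat.ofHom (φ.comp (res (P.basicOpen_le b))) =
        CommRingCat.ofHom (ψ.comp (res (P.basicOpen_le b))) := by
      refine hpo.hom_ext ?_ ?_
      · refine CommRingCat.hom_ext (RingHom.ext fun a => ?_)
        change φ (res (P.basicOpen_le b) (res inf_le_left (p.app U a))) =
          ψ (res (P.basicOpen_le b) (res inf_le_left (p.app U a)))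
        refine TrivSqZeroExt.ext ?_ ?_
        · rw [hφ.fst, hψ.fst]
        · rw [res_res, hφ.snd _ _ _ (.fst U a), hψ.snd _ _ _ (.fst U a)]
      · refine CommRingCat.hom_ext (RingHom.ext fun a => ?_)
        change φ (res (P.basicOpen_le b) (res inf_le_right (q.app V a))) =
          ψ (res (P.basicOpen_le b) (res inf_le_right (q.app V a)))
        refine TrivSqZeroExt.ext ?_ ?_
        · rw [hφ.fst, hψ.fst]
        · rw [res_res, hφ.snd _ _ _ (.snd V a), hψ.snd _ _ _ (.snd V a)]
    exact congrArg (fun k => k.hom x) this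

end Prod

/-! ### Vector fields -/

instance (X : Scheme.{u}) : Zero (SchemeDerivation X) :=
  ⟨⟨fun _ => 0, fun h s => by simp⟩⟩

instance (X : Scheme.{u}) : Add (SchemeDerivation X) :=
  ⟨fun D E => ⟨fun U => D.app U + E.app U, fun h s => by
    rw [Derivation.add_apply, Derivation.add_apply, D.map_res, E.map_res, map_add]⟩⟩

instance (X : Scheme.{u}) : Neg (SchemeDerivation X) :=
  ⟨fun D => ⟨fun U => -D.app U, fun h s => by
    rw [Derivation.neg_apply, Derivation.neg_apply, D.map_res, map_neg]⟩⟩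

@[simp] lemma SchemeDerivation.zero_app {X : Scheme.{u}} (U : X.Opens) :
    (0 : SchemeDerivation X).app U = 0 := rfl

@[simp] lemma SchemeDerivation.add_app {X : Scheme.{u}} (D E : SchemeDerivation X) (U : X.Opens) :
    (D + E).app U = D.app U + E.app U := rfl

@[simp] lemma SchemeDerivation.neg_app {X : Scheme.{u}} (D : SchemeDerivation X) (U : X.Opens) :
    (-D).app U = -D.app U := rfl

instance (X : Scheme.{u}) : AddCommGroup (SchemeDerivation X) where
  add_assoc D E F := by ext; simp [add_assoc]
  zero_add D := by ext; simp
  add_zero D := by ext; simp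
  add_comm D E := by ext; simp [add_comm]
  neg_add_cancel D := by ext; simp
  nsmul := nsmulRec
  zsmul := zsmulRec

section Over

variable {k : Type u} [CommRing k]

/-- The elements of the base ring `k`, seen as functions on a `k`-scheme. -/
noncomputable def constHom (X : Over (Spec (.of k))) : k →+* Γ(X.left, ⊤) :=
  (Scheme.Hom.appTop (X := X.left) (Y := Spec (.of k)) X.hom).hom.comp
    (Scheme.ΓSpecIso (.of k)).inv.hom

lemma constHom_app {X Y : Over (Spec (.of k))} (f : X ⟶ Y) (c : k) :
    f.left.app ⊤ (constHom Y c) = constHom X c := by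
  have h : f.left ≫ Y.hom = X.hom := Over.w f
  have h' : (Scheme.Hom.appTop (X := Y.left) (Y := Spec (.of k)) Y.hom) ≫ f.left.appTop =
      Scheme.Hom.appTop (X := X.left) (Y := Spec (.of k)) X.hom := by
    rw [← Scheme.Hom.comp_appTop]
    exact congrArg (Scheme.Hom.appTop (X := X.left) (Y := Spec (.of k))) h
  exact congrArg (fun t => t.hom ((Scheme.ΓSpecIso (.of k)).inv c)) h'

/-- Regular vector fields on a `k`-scheme: derivations of the structure sheaf vanishing on `k`. -/
noncomputable def vectorFields (X : Over (Spec (.of k))) : AddSubgroup (SchemeDerivation X.left) where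
  carrier := {D | ∀ c : k, D.app ⊤ (constHom X c) = 0}
  zero_mem' c := rfl
  add_mem' {D E} hD hE c := by
    rw [SchemeDerivation.add_app, Derivation.add_apply, hD c, hE c, add_zero]
  neg_mem' {D} hD c := by rw [SchemeDerivation.neg_app, Derivation.neg_apply, hD c, neg_zero]

/-- The space `𝔛(X)` of regular vector fields on a `k`-scheme. -/
noncomputable abbrev VectorField (X : Over (Spec (.of k))) := vectorFields X

lemma VectorField.app_const {X : Over (Spec (.of k))} (D : VectorField X) {U : X.left.Opens}
    (c : k) : D.1.app U (res le_top (constHom X c)) = 0 := by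
  refine (D.1.map_res le_top _).trans ?_
  rw [D.2 c, map_zero]

noncomputable instance (X : Over (Spec (.of k))) : SMul k (VectorField X) :=
  ⟨fun c D => ⟨⟨fun U => res (X := X.left) (le_top : U ≤ ⊤) (constHom X c) • D.1.app U,
    fun {U V} h s => by
      rw [Derivation.smul_apply, Derivation.smul_apply, D.1.map_res, smul_eq_mul, smul_eq_mul,
        map_mul]
      congr 1
      exact (res_res le_top h _).symm⟩,
    fun b => by
      change res (X := X.left) (U := ⊤) (V := ⊤) le_top (constHom X c) • D.1.app ⊤ (constHom X b) = 0
      rw [D.2 b, smul_zero]⟩⟩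

lemma VectorField.smul_app {X : Over (Spec (.of k))} (c : k) (D : VectorField X) (U : X.left.Opens)
    (s : Γ(X.left, U)) :
    (c • D).1.app U s = res (X := X.left) (le_top : U ≤ ⊤) (constHom X c) * D.1.app U s := rfl

lemma VectorField.add_app {X : Over (Spec (.of k))} (D E : VectorField X) (U : X.left.Opens)
    (s : Γ(X.left, U)) : (D + E).1.app U s = D.1.app U s + E.1.app U s := rfl

lemma VectorField.zero_app {X : Over (Spec (.of k))} (U : X.left.Opens)
    (s : Γ(X.left, U)) : (0 : VectorField X).1.app U s = 0 := rfl

lemma VectorField.ext' {X : Over (Spec (.of k))} {D E : VectorField X}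
    (h : ∀ U s, D.1.app U s = E.1.app U s) : D = E :=
  Subtype.ext (SchemeDerivation.ext h)

noncomputable instance (X : Over (Spec (.of k))) : Module k (VectorField X) where
  one_smul D := VectorField.ext' fun U s => by
    rw [VectorField.smul_app, map_one, map_one, one_mul]
  mul_smul a b D := VectorField.ext' fun U s => by
    simp only [VectorField.smul_app, map_mul, mul_assoc]
  smul_zero a := VectorField.ext' fun U s => by
    rw [VectorField.smul_app, VectorField.zero_app, mul_zero]
  smul_add a D E := VectorField.ext' fun U s => by
    simp only [VectorField.smul_app, VectorField.add_app, mul_add]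
  add_smul a b D := VectorField.ext' fun U s => by
    simp only [VectorField.smul_app, VectorField.add_app, map_add, add_mul]
  zero_smul D := VectorField.ext' fun U s => by
    rw [VectorField.smul_app, VectorField.zero_app, map_zero, map_zero, zero_mul]

lemma VectorField.app_structure {X : Over (Spec (.of k))} (D : VectorField X)
    (c : Γ(Spec (.of k), ⊤)) :
    D.1.app ⊤ (Scheme.Hom.app (X := X.left) (Y := Spec (.of k)) X.hom ⊤ c) = 0 := by
  obtain ⟨a, rfl⟩ : ∃ a : k, (Scheme.ΓSpecIso (.of k)).inv a = c :=
    ⟨(Scheme.ΓSpecIso (.of k)).hom c, by simp⟩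
  exact D.2 a

/-- `D ⊗ 1 + 1 ⊗ E` on the product of two `k`-schemes. -/
theorem existsUnique_prodField {X Y : Over (Spec (.of k))} (D : VectorField X) (E : VectorField Y) :
    ∃! F : SchemeDerivation (X ⊗ Y).left,
      IsDifferential F D.1 (fst X Y).left ∧ IsDifferential F E.1 (snd X Y).left :=
  existsUnique_prodDerivation (X := X.left) (Y := Y.left) (S := Spec (.of k)) X.hom Y.hom D.1 E.1
    (VectorField.app_structure D) (VectorField.app_structure E)

/-- The derivation `D ⊗ 1 + 1 ⊗ E` of the product `X × Y` of two `k`-schemes: the unique derivation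
for which both projections are morphisms of schemes with derivation. -/
noncomputable def prodDer {X Y : Over (Spec (.of k))} (D : VectorField X) (E : VectorField Y) :
    SchemeDerivation (X ⊗ Y).left :=
  (existsUnique_prodField D E).choose

lemma prodDer_fst {X Y : Over (Spec (.of k))} (D : VectorField X) (E : VectorField Y) :
    IsDifferential (prodDer D E) D.1 (fst X Y).left :=
  (existsUnique_prodField D E).choose_spec.1.1

lemma prodDer_snd {X Y : Over (Spec (.of k))} (D : VectorField X) (E : VectorField Y) :
    IsDifferential (prodDer D E) E.1 (snd X Y).left :=
  (existsUnique_prodField D E).choose_spec.1.2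

lemma prodDer_unique {X Y : Over (Spec (.of k))} {D : VectorField X} {E : VectorField Y}
    {F : SchemeDerivation (X ⊗ Y).left} (h₁ : IsDifferential F D.1 (fst X Y).left)
    (h₂ : IsDifferential F E.1 (snd X Y).left) : F = prodDer D E :=
  (existsUnique_prodField D E).choose_spec.2 F ⟨h₁, h₂⟩

lemma IsDifferential.add {X Y : Scheme.{u}} {D D' : SchemeDerivation X} {E E' : SchemeDerivation Y}
    {f : X ⟶ Y} (h : IsDifferential D E f) (h' : IsDifferential D' E' f) :
    IsDifferential (D + D') (E + E') f := fun U s => by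
  rw [SchemeDerivation.add_app, SchemeDerivation.add_app, Derivation.add_apply,
    Derivation.add_apply, h, h', map_add]

lemma prodDer_add {X Y : Over (Spec (.of k))} (D D' : VectorField X) (E E' : VectorField Y) :
    prodDer (D + D') (E + E') = prodDer D E + prodDer D' E' :=
  (prodDer_unique ((prodDer_fst D E).add (prodDer_fst D' E'))
    ((prodDer_snd D E).add (prodDer_snd D' E'))).symm

/-- The derivation `D ⊗ 1 + 1 ⊗ E` vanishes on `k`. -/
noncomputable def prodField {X Y : Over (Spec (.of k))} (D : VectorField X) (E : VectorField Y) :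
    VectorField (X ⊗ Y) :=
  ⟨prodDer D E, fun c => by
    rw [← constHom_app (fst X Y) c]
    refine (prodDer_fst D E ⊤ (constHom X c)).trans ?_
    erw [D.2 c, map_zero]
    rfl⟩

lemma res_constHom_app {X Y : Over (Spec (.of k))} (f : X ⟶ Y) (U : Y.left.Opens) (c : k) :
    f.left.app U (res (X := Y.left) (le_top : U ≤ ⊤) (constHom Y c)) =
      res (X := X.left) (le_top : f.left ⁻¹ᵁ U ≤ ⊤) (constHom X c) := by
  rw [res_app, ← constHom_app f c]
  rfl

lemma IsDifferential.smul {X Y : Over (Spec (.of k))} {D : VectorField X} {E : VectorField Y}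
    {f : X ⟶ Y} (h : IsDifferential D.1 E.1 f.left) (c : k) :
    IsDifferential (c • D).1 (c • E).1 f.left := fun U s => by
  rw [VectorField.smul_app, VectorField.smul_app, h, map_mul, res_constHom_app]

lemma prodField_smul {X Y : Over (Spec (.of k))} (c : k) (D : VectorField X) (E : VectorField Y) :
    prodField (c • D) (c • E) = c • prodField D E :=
  Subtype.ext (prodDer_unique
    (IsDifferential.smul (D := prodField D E) (prodDer_fst D E) c)
    (IsDifferential.smul (D := prodField D E) (prodDer_snd D E) c)).symm

end Over

/-! ### Algebraic varieties, groups and homogeneous spaces -/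

section Groups

variable {C : Type u} [Field C]

/-- Algebraic varieties over `C`: reduced separated schemes of finite type. -/
structure IsVariety (X : Over (Spec (.of C))) : Prop where
  isReduced : IsReduced X.left
  isSeparated : IsSeparated X.hom
  locallyOfFiniteType : LocallyOfFiniteType X.hom
  quasiCompact : QuasiCompact X.hom

variable (G M : Over (Spec (.of C))) [GrpObj G] [ModObj G M]

/-- The action morphism `G × M ⟶ M`. -/
noncomputable def act : G ⊗ M ⟶ M := ModObj.smul (M := G) (X := M)

/-- `M` is a homogeneous `G`-space: `(σ, x) ↦ (σ x, x)` is surjective. -/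
def IsHomogeneous : Prop := Surjective (lift (act G M) (snd G M)).left

/-- The action is faithful: the intersection of the isotropy subgroups of the closed points of `M`
is trivial. We use this over an algebraically closed field `C` of characteristic zero: the closed
points are the `C`-points, and a subgroup is determined by its `C`-points. -/
def IsFaithful : Prop :=
  ∀ g : 𝟙_ (Over (Spec (.of C))) ⟶ G,
    (∀ x : 𝟙_ (Over (Spec (.of C))) ⟶ M, lift g x ≫ act G M = x) → g = η[G]

variable {M} in
/-- Right translation by a `C`-point. -/
noncomputable def rightTranslation (σ : 𝟙_ (Over (Spec (.of C))) ⟶ G) : G ⟶ G :=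
  lift (𝟙 G) (toUnit G ≫ σ) ≫ μ[G]

/-- The space `ℛ(G)` of right invariant vector fields of `G`, for an algebraically closed `C`: those
which are invariant under the right translations by all the `C`-points of `G`. -/
noncomputable def rightInvariant : Submodule C (VectorField G) where
  carrier := {A | ∀ σ : 𝟙_ (Over (Spec (.of C))) ⟶ G,
    IsDifferential A.1 A.1 (rightTranslation G σ).left}
  zero_mem' σ U s := by
    rw [VectorField.zero_app, VectorField.zero_app, map_zero]
  add_mem' hA hB σ := (hA σ).add (hB σ)
  smul_mem' c A hA σ := (hA σ).smul c

/-- The morphism `x ↦ (e, x)`, a section of the action. -/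
noncomputable def unitSection : M ⟶ G ⊗ M := lift (toUnit M ≫ η[G]) (𝟙 M)

lemma unitSection_act : unitSection G M ≫ act G M = 𝟙 M := by
  have h := ModObj.one_smul (M := G) (X := M)
  have h2 : unitSection G M = (λ_ M).inv ≫ (η[G] ▷ M) := by
    ext1 <;> simp [unitSection]
  rw [h2, Category.assoc]
  exact (congrArg (fun t => (λ_ M).inv ≫ t) h).trans (by simp)

end Groups

section Fundamental

variable {C : Type u} [Field C] {G M : Over (Spec (.of C))} [GrpObj G] [ModObj G M]

lemma appLE_section {X Y : Scheme.{u}} {a : X ⟶ Y} {s : Y ⟶ X} (h : s ≫ a = 𝟙 Y) (U : Y.Opens)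
    (e : U ≤ s ⁻¹ᵁ a ⁻¹ᵁ U) (f : Γ(Y, U)) : s.appLE (a ⁻¹ᵁ U) U e (a.app U f) = f := by
  have h1 : a.app U ≫ s.appLE (a ⁻¹ᵁ U) U e = 𝟙 _ := by
    rw [Scheme.Hom.app_eq_appLE, Scheme.Hom.appLE_comp_appLE]
    simp only [h]
    simp only [Scheme.Hom.appLE, Scheme.Hom.id_app]
    exact (Category.id_comp _).trans (Y.presheaf.map_id _)
  exact congrArg (fun t => t.hom f) h1

lemma le_section {X Y : Scheme.{u}} {a : X ⟶ Y} {s : Y ⟶ X} (h : s ≫ a = 𝟙 Y) (U : Y.Opens) :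
    U ≤ s ⁻¹ᵁ a ⁻¹ᵁ U := by
  rw [← Scheme.Hom.comp_preimage, h]
  exact le_rfl

lemma appLE_res {X Y : Scheme.{u}} (s : Y ⟶ X) {U U' : X.Opens} {V V' : Y.Opens} (e : V ≤ s ⁻¹ᵁ U)
    (e' : V' ≤ s ⁻¹ᵁ U') (hU : U' ≤ U) (hV : V' ≤ V) (t : Γ(X, U)) :
    s.appLE U' V' e' (res hU t) = res hV (s.appLE U V e t) := by
  have h1 : X.presheaf.map (homOfLE hU).op ≫ s.appLE U' V' e' =
      s.appLE U V e ≫ Y.presheaf.map (homOfLE hV).op := by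
    rw [Scheme.Hom.map_appLE, Scheme.Hom.appLE_map]
  exact congrArg (fun r => r.hom t) h1

/-- For a morphism `a : P ⟶ M` with a section `s`, and a derivation `F` of `P`, the derivation
`s♯ ∘ F ∘ a♯` of `M`. -/
noncomputable def projectDer {P M : Scheme.{u}} (a : P ⟶ M) (s : M ⟶ P) (h : s ≫ a = 𝟙 M)
    (F : SchemeDerivation P) : SchemeDerivation M where
  app U := Derivation.mk' (AddMonoidHom.toIntLinearMap (AddMonoidHom.mk'
    (fun f => s.appLE (a ⁻¹ᵁ U) U (le_section h U) (F.app (a ⁻¹ᵁ U) (a.app U f)))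
    fun f g => by simp only [map_add])) fun f g => by
      change s.appLE (a ⁻¹ᵁ U) U (le_section h U) (F.app (a ⁻¹ᵁ U) (a.app U (f * g))) =
        f • s.appLE (a ⁻¹ᵁ U) U (le_section h U) (F.app (a ⁻¹ᵁ U) (a.app U g)) +
          g • s.appLE (a ⁻¹ᵁ U) U (le_section h U) (F.app (a ⁻¹ᵁ U) (a.app U f))
      rw [map_mul, Derivation.leibniz, map_add, smul_eq_mul, smul_eq_mul, map_mul, map_mul,
        appLE_section h, appLE_section h, smul_eq_mul, smul_eq_mul]
  map_res {U V} hV f := by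
    change s.appLE (a ⁻¹ᵁ V) V (le_section h V) (F.app (a ⁻¹ᵁ V) (a.app V (res hV f))) =
      res hV (s.appLE (a ⁻¹ᵁ U) U (le_section h U) (F.app (a ⁻¹ᵁ U) (a.app U f)))
    rw [res_app, ← appLE_res s (le_section h U) (le_section h V) (preimage_le a hV) hV]
    congr 1
    exact F.map_res (preimage_le a hV) (a.app U f)

lemma projectDer_app {P M : Scheme.{u}} (a : P ⟶ M) (s : M ⟶ P) (h : s ≫ a = 𝟙 M)
    (F : SchemeDerivation P) (U : M.Opens) (f : Γ(M, U)) :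
    (projectDer a s h F).app U f =
      s.appLE (a ⁻¹ᵁ U) U (le_section h U) (F.app (a ⁻¹ᵁ U) (a.app U f)) := rfl

lemma unitSection_act_left : (unitSection G M).left ≫ (act G M).left = 𝟙 M.left := by
  rw [← Over.comp_left, unitSection_act, Over.id_left]

/-- If a derivation `F` projects onto a derivation `X` along a morphism `a` with a section `s`,
then `X` is `s♯ ∘ F ∘ a♯`. -/
lemma IsDifferential.eq_projectDer {P M : Scheme.{u}} {a : P ⟶ M} {s : M ⟶ P} (h : s ≫ a = 𝟙 M)
    {F : SchemeDerivation P} {X : SchemeDerivation M} (hX : IsDifferential F X a) :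
    X = projectDer a s h F :=
  SchemeDerivation.ext fun U f => by
    rw [projectDer_app, hX, appLE_section h]

lemma appLE_const {k : Type u} [CommRing k] {X Y : Over (Spec (.of k))} (s : Y ⟶ X)
    (U : X.left.Opens) (V : Y.left.Opens) (e : V ≤ s.left ⁻¹ᵁ U) (c : k) :
    s.left.appLE U V e (res (X := X.left) (le_top : U ≤ ⊤) (constHom X c)) =
      res (X := Y.left) (le_top : V ≤ ⊤) (constHom Y c) := by
  rw [appLE_res s.left (V := ⊤) le_top e le_top le_top, ← constHom_app s c,
    Scheme.Hom.app_eq_appLE]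
  rfl

variable (M) in
/-- The projection along the action `a : G × M ⟶ M` of the vector field `A ⊗ 1`. -/
noncomputable def projectField (A : VectorField G) : VectorField M :=
  ⟨projectDer (act G M).left (unitSection G M).left unitSection_act_left
    (prodDer A (0 : VectorField M)), fun c => by
      rw [projectDer_app, constHom_app (act G M) c, ← constHom_app (fst G M) c]
      have h := prodDer_fst A (0 : VectorField M) ⊤ (constHom G c)
      rw [A.2 c, map_zero] at h
      exact (congrArg _ h).trans (map_zero _)⟩

lemma projectField_app (A : VectorField G) (U : M.left.Opens) (f : Γ(M.left, U)) :
    (projectField M A).1.app U f =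
      (unitSection G M).left.appLE ((act G M).left ⁻¹ᵁ U) U (le_section unitSection_act_left U)
        ((prodDer A (0 : VectorField M)).app ((act G M).left ⁻¹ᵁ U) ((act G M).left.app U f)) :=
  rfl

lemma projectField_add (A B : VectorField G) :
    projectField M (A + B) = projectField M A + projectField M B :=
  VectorField.ext' fun U f => by
    have h := prodDer_add A B (0 : VectorField M) 0
    rw [add_zero] at h
    rw [VectorField.add_app, projectField_app, projectField_app, projectField_app, h,
      SchemeDerivation.add_app, Derivation.add_apply, map_add]

lemma projectField_smul (c : C) (A : VectorField G) :
    projectField M (c • A) = c • projectField M A :=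
  VectorField.ext' fun U f => by
    have h := prodField_smul c A (0 : VectorField M)
    rw [smul_zero] at h
    have h' : prodDer (c • A) (0 : VectorField M) = (c • prodField A (0 : VectorField M)).1 :=
      congrArg Subtype.val h
    rw [VectorField.smul_app, projectField_app, projectField_app, h', VectorField.smul_app, map_mul,
      appLE_const (unitSection G M)]
    rfl

variable (G M) in
/-- The map `A ↦ A^M` sending a right invariant vector field `A` of `G` to its fundamental field:
the projection of `A ⊗ 1` along the action `a : G × M ⟶ M`. Since `x ↦ (e, x)` is a section of `a`,
this projection is the restriction of `(A ⊗ 1) ∘ a♯` to `{e} × M`. -/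
noncomputable def fundamentalField : rightInvariant G →ₗ[C] VectorField M where
  toFun A := projectField M A.1
  map_add' A B := projectField_add A.1 B.1
  map_smul' c A := projectField_smul c A.1

variable (G M) in
/-- The space `ℛ(G, M)` of fundamental fields. -/
noncomputable def fundamentalFields : Submodule C (VectorField M) :=
  LinearMap.range (fundamentalField G M)

end Fundamental

/-! ### Non-autonomous vector fields -/

/-- `C` is the field of constants of the differential field `K`. -/
class IsConstantField (C K : Type u) [Field C] [Field K] [Differential K] [Algebra C K] : Prop where
  deriv_eq_zero_iff (x : K) : Differential.deriv x = 0 ↔ x ∈ Set.range (algebraMap C K)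

section NonAutonomous

variable (C K : Type u) [Field C] [Field K] [Algebra C K]

/-- `Spec K` as a scheme over `C`. -/
noncomputable abbrev specOver : Over (Spec (.of C)) :=
  Over.mk (Spec.map (CommRingCat.ofHom (algebraMap C K)))

variable {C}

/-- The extended scheme `X_K = X ×_C Spec K`, as a scheme over `K`. -/
noncomputable abbrev extend (X : Over (Spec (.of C))) : Over (Spec (.of K)) :=
  Over.mk (X := Spec (.of K)) (snd X (specOver C K)).left

variable {K}

lemma constHom_extend (X : Over (Spec (.of C))) (x : K) :
    constHom (extend K X) x =
      (snd X (specOver C K)).left.app ⊤ ((Scheme.ΓSpecIso (.of K)).inv x) := rfl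

lemma constHom_specOver (c : C) :
    constHom (specOver C K) c = (Scheme.ΓSpecIso (.of K)).inv (algebraMap C K c) := by
  have := Scheme.ΓSpecIso_inv_naturality (CommRingCat.ofHom (algebraMap C K))
  exact (congrArg (fun t => t.hom c) this).symm

variable (K) in
/-- The extension `A ⊗ 1` of a vector field `A` of `X` to a vector field of `X_K` over `K`. -/
noncomputable def extendField (X : Over (Spec (.of C))) : VectorField X →+ VectorField (extend K X) where
  toFun A := ⟨prodDer A (0 : VectorField (specOver C K)), fun x => by
    rw [constHom_extend]
    exact (prodDer_snd A (0 : VectorField (specOver C K)) ⊤ _).trans (map_zero _)⟩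
  map_zero' := Subtype.ext (prodDer_unique
    (D := (0 : VectorField X)) (E := (0 : VectorField (specOver C K))) (F := 0)
    (fun U s => by
      rw [VectorField.zero_app, map_zero]
      rfl)
    (fun U s => by
      rw [VectorField.zero_app, map_zero]
      rfl)).symm
  map_add' A B := Subtype.ext (by
    have h := prodDer_add A B (0 : VectorField (specOver C K)) 0
    rw [add_zero] at h
    exact h)

lemma extendField_smul (X : Over (Spec (.of C))) (c : C) (A : VectorField X) :
    extendField K X (c • A) = algebraMap C K c • extendField K X A := by
  have h := prodField_smul c A (0 : VectorField (specOver C K))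
  rw [smul_zero] at h
  refine Subtype.ext ((congrArg Subtype.val h).trans (SchemeDerivation.ext fun U s => ?_))
  have e : constHom (X ⊗ specOver C K) c = constHom (extend K X) (algebraMap C K c) := by
    rw [constHom_extend, ← constHom_specOver, constHom_app]
  rw [VectorField.smul_app, e]
  rfl

variable (K) in
/-- Non-autonomous vector fields of `X`, seen as vector fields of `X_K` over `K`:
`∑ Aᵢ ⊗ fᵢ` is sent to `∑ fᵢ (Aᵢ ⊗ 1)`. -/
noncomputable def nonAutonomous (X : Over (Spec (.of C))) :
    VectorField X ⊗[C] K →+ VectorField (extend K X) :=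
  TensorProduct.liftAddHom
    (AddMonoidHom.mk' (fun A => AddMonoidHom.mk' (fun f : K => f • extendField K X A)
      fun f g => add_smul f g _) fun A B => by
        refine AddMonoidHom.ext fun f => ?_
        change f • extendField K X (A + B) = f • extendField K X A + f • extendField K X B
        rw [map_add, smul_add])
    fun c A f => by
      change f • extendField K X (c • A) = (c • f) • extendField K X A
      rw [extendField_smul, smul_smul, Algebra.smul_def, mul_comm]

variable [Differential K] [IsConstantField C K]

variable (C K) in
/-- The derivation of `Spec K`, which vanishes on `C`. -/
noncomputable def baseDer : VectorField (specOver C K) :=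
  ⟨specDerivation (.of K) Differential.deriv, fun c => by
    rw [constHom_specOver]
    refine (specDerivation_app (.of K) Differential.deriv _).trans ?_
    rw [(IsConstantField.deriv_eq_zero_iff (C := C) _).mpr ⟨c, rfl⟩, map_zero]⟩

variable (K) in
/-- The canonical derivation `∂` of `X_K = X ×_C (Spec K, ∂)`. -/
noncomputable def canonicalDer (X : Over (Spec (.of C))) : SchemeDerivation (extend K X).left :=
  prodDer (0 : VectorField X) (baseDer C K)

/-- The derivation `∂_X = ∂ + X` of the extended scheme attached to a non-autonomous vector
field `X`. -/
noncomputable def assocDer {Z : Over (Spec (.of C))} (X : VectorField Z ⊗[C] K) :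
    SchemeDerivation (extend K Z).left :=
  canonicalDer K Z + (nonAutonomous K Z X).1

lemma canonicalDer_const (X : Over (Spec (.of C))) (x : K) :
    (canonicalDer K X).app ⊤ (constHom (extend K X) x) =
      constHom (extend K X) (Differential.deriv x) := by
  rw [constHom_extend, constHom_extend]
  refine (prodDer_snd (0 : VectorField X) (baseDer C K) ⊤ _).trans ?_
  congr 1
  exact specDerivation_app (.of K) Differential.deriv x

/-- A `K`-scheme with derivation `(X, D)` splits if it is isomorphic to `Y ×_C (Spec K, ∂)` for some
scheme `Y` over `C`. -/
def Splits (C : Type u) [Field C] [Algebra C K] [IsConstantField C K] (X : Over (Spec (.of K)))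
    (D : SchemeDerivation X.left) : Prop :=
  ∃ (Y : Over (Spec (.of C))) (φ : X ≅ extend K Y), IsDifferential D (canonicalDer K Y) φ.hom.left

end NonAutonomous

/-! ### Tangent vectors and the logarithmic derivative -/

section Tangent

variable {K : Type u} [Field K]

/-- The value `s(p) ∈ K` at a `K`-point `p` of a section `s` defined around `p`. -/
noncomputable def evalAt {X : Scheme.{u}} (p : Spec (.of K) ⟶ X) (U : X.Opens)
    (hU : ⊤ ≤ p ⁻¹ᵁ U) : Γ(X, U) →+* K :=
  (Scheme.ΓSpecIso (.of K)).hom.hom.comp (p.appLE U ⊤ hU).hom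

lemma evalAt_res {X : Scheme.{u}} (p : Spec (.of K) ⟶ X) {U V : X.Opens} (h : V ≤ U)
    (hV : ⊤ ≤ p ⁻¹ᵁ V) (s : Γ(X, U)) :
    evalAt p V hV (res h s) = evalAt p U (hV.trans (preimage_le p h)) s := by
  change (Scheme.ΓSpecIso (.of K)).hom (p.appLE V ⊤ hV (res h s)) = _
  rw [appLE_res p (hV.trans (preimage_le p h)) hV h le_rfl, res_self]
  rfl

lemma evalAt_app {X Y : Scheme.{u}} (p : Spec (.of K) ⟶ X) (f : X ⟶ Y) (q : Spec (.of K) ⟶ Y)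
    (h : p ≫ f = q) (U : Y.Opens) (hU : ⊤ ≤ q ⁻¹ᵁ U) (hU' : ⊤ ≤ p ⁻¹ᵁ f ⁻¹ᵁ U) (s : Γ(Y, U)) :
    evalAt p (f ⁻¹ᵁ U) hU' (f.app U s) = evalAt q U hU s := by
  subst h
  have h1 : f.app U ≫ p.appLE (f ⁻¹ᵁ U) ⊤ hU' = (p ≫ f).appLE U ⊤ hU := by
    rw [Scheme.Hom.app_eq_appLE, Scheme.Hom.appLE_comp_appLE]
  exact congrArg (fun t => (Scheme.ΓSpecIso (.of K)).hom (t.hom s)) h1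

lemma evalAt_const {X : Over (Spec (.of K))} (p : Spec (.of K) ⟶ X.left)
    (hp : p ≫ X.hom = 𝟙 (Spec (.of K))) (hU : ⊤ ≤ p ⁻¹ᵁ ⊤) (x : K) :
    evalAt p ⊤ hU (constHom X x) = x := by
  have h1 := evalAt_app p (X.hom : X.left ⟶ Spec (.of K)) (𝟙 _) hp ⊤ le_rfl hU
    ((Scheme.ΓSpecIso (.of K)).inv x)
  refine h1.trans ?_
  change (Scheme.ΓSpecIso (.of K)).hom (res le_rfl ((Scheme.ΓSpecIso (.of K)).inv x)) = x
  rw [res_self]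
  simp

/-- The tangent space at a `K`-point `p` of a `K`-scheme `X`: the `K`-derivations with values in `K`
of the ring of germs of functions at `p`. Such a derivation is given by its values on the sections
defined around `p`, compatibly with restrictions. -/
@[ext]
structure TangentVector (X : Over (Spec (.of K))) (p : Spec (.of K) ⟶ X.left) where
  toFun (U : X.left.Opens) (hU : ⊤ ≤ p ⁻¹ᵁ U) : Γ(X.left, U) → K
  map_res {U V : X.left.Opens} (h : V ≤ U) (hV : ⊤ ≤ p ⁻¹ᵁ V) (s : Γ(X.left, U)) :
    toFun V hV (res h s) = toFun U (hV.trans (preimage_le p h)) s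
  map_add (U : X.left.Opens) (hU : ⊤ ≤ p ⁻¹ᵁ U) (s t : Γ(X.left, U)) :
    toFun U hU (s + t) = toFun U hU s + toFun U hU t
  leibniz (U : X.left.Opens) (hU : ⊤ ≤ p ⁻¹ᵁ U) (s t : Γ(X.left, U)) :
    toFun U hU (s * t) = evalAt p U hU s * toFun U hU t + evalAt p U hU t * toFun U hU s
  map_const (x : K) : toFun ⊤ (le_refl ⊤) (constHom X x) = 0

/-- The value at `p` of a vector field. -/
noncomputable def VectorField.valueAt {X : Over (Spec (.of K))} (A : VectorField X)
    (p : Spec (.of K) ⟶ X.left) : TangentVector X p where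
  toFun U hU s := evalAt p U hU (A.1.app U s)
  map_res h hV s := by
    rw [← evalAt_res p h hV]
    exact congrArg _ (A.1.map_res h s)
  map_add U hU s t := by rw [_root_.map_add, _root_.map_add]
  leibniz U hU s t := by
    rw [Derivation.leibniz, _root_.map_add, smul_eq_mul, smul_eq_mul, map_mul, map_mul]
  map_const x := by rw [A.2 x, map_zero]

/-- The image of a tangent vector by a morphism `f` of `K`-schemes mapping `p` to `q`. -/
noncomputable def TangentVector.push {X Y : Over (Spec (.of K))} {p : Spec (.of K) ⟶ X.left}
    (v : TangentVector X p) (f : X ⟶ Y) (q : Spec (.of K) ⟶ Y.left) (h : p ≫ f.left = q) :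
    TangentVector Y q where
  toFun U hU s := v.toFun (f.left ⁻¹ᵁ U) (by rwa [← Scheme.Hom.comp_preimage, h]) (f.left.app U s)
  map_res {U V} hVU hV s := by
    rw [← v.map_res (preimage_le f.left hVU) (by rwa [← Scheme.Hom.comp_preimage, h]), ← res_app]
  map_add U hU s t := by rw [_root_.map_add, v.map_add]
  leibniz U hU s t := by
    rw [map_mul, v.leibniz, evalAt_app p f.left q h U hU, evalAt_app p f.left q h U hU]
  map_const x := by
    rw [constHom_app]
    exact v.map_const x

variable [Differential K]

/-- For a derivation `D` of a `K`-scheme extending the derivation `∂` of `K`, the commutator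
`[∂, p♯] = ∂ ∘ p♯ - p♯ ∘ D` is a tangent vector at the `K`-point `p`. -/
noncomputable def commutator {X : Over (Spec (.of K))} (D : SchemeDerivation X.left)
    (hD : ∀ x, D.app ⊤ (constHom X x) = constHom X (Differential.deriv x))
    (p : Spec (.of K) ⟶ X.left) (hp : p ≫ X.hom = 𝟙 (Spec (.of K))) : TangentVector X p where
  toFun U hU s := Differential.deriv (evalAt p U hU s) - evalAt p U hU (D.app U s)
  map_res h hV s := by
    rw [evalAt_res, ← evalAt_res p h hV (D.app _ s)]
    congr 2
    exact D.map_res h s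
  map_add U hU s t := by
    simp only [_root_.map_add]
    ring
  leibniz U hU s t := by
    simp only [_root_.map_add, map_mul, Derivation.leibniz, smul_eq_mul]
    ring
  map_const x := by
    rw [hD]
    have h := evalAt_const p hp (le_refl ⊤)
    refine (congrArg₂ (fun a b => Differential.deriv a - b) (h x) (h (Differential.deriv x))).trans ?_
    exact sub_self _

end Tangent

section LogDer

variable {C K : Type u} [Field C] [Field K] [Algebra C K]
  {G : Over (Spec (.of C))} [GrpObj G]

/-- A `K`-point of a `C`-scheme, as a `K`-point of the extended scheme. -/
noncomputable def kPoint {X : Over (Spec (.of C))} (x : specOver C K ⟶ X) :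
    Spec (.of K) ⟶ (extend K X).left :=
  (lift x (𝟙 (specOver C K))).left

lemma kPoint_hom {X : Over (Spec (.of C))} (x : specOver C K ⟶ X) :
    kPoint x ≫ (extend K X).hom = 𝟙 (Spec (.of K)) := by
  change (lift x (𝟙 (specOver C K)) ≫ snd X (specOver C K)).left = 𝟙 (Spec (.of K))
  rw [lift_snd]
  rfl

/-- The right translation `g ↦ g σ` of `G_K` by a `K`-point `σ` of `G`. -/
noncomputable def rightTranslationK (σ : specOver C K ⟶ G) : extend K G ⟶ extend K G :=
  Over.homMk (lift (lift (fst G (specOver C K)) (snd G (specOver C K) ≫ σ) ≫ μ[G])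
    (snd G (specOver C K))).left (by
      change (lift (lift (fst G (specOver C K)) (snd G (specOver C K) ≫ σ) ≫ μ[G])
        (snd G (specOver C K)) ≫ snd G (specOver C K)).left = _
      rw [lift_snd]
      rfl)

/-- The gauge transformation induced by a `K`-point `σ` of `G`: the left translation `g ↦ σ g`
of `G_K`. -/
noncomputable def gauge (σ : specOver C K ⟶ G) : extend K G ⟶ extend K G :=
  Over.homMk (lift (lift (snd G (specOver C K) ≫ σ) (fst G (specOver C K)) ≫ μ[G])
    (snd G (specOver C K))).left (by
      change (lift (lift (snd G (specOver C K) ≫ σ) (fst G (specOver C K)) ≫ μ[G])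
        (snd G (specOver C K)) ≫ snd G (specOver C K)).left = _
      rw [lift_snd]
      rfl)

variable (G K) in
/-- The identity element of `G(K)`. -/
noncomputable def unitPoint : specOver C K ⟶ G := toUnit (specOver C K) ≫ η[G]

lemma kPoint_rightTranslationK (σ : specOver C K ⟶ G) :
    kPoint σ ≫ (rightTranslationK (σ ≫ ι[G])).left = kPoint (unitPoint K G) := by
  have h : lift σ (𝟙 (specOver C K)) ≫
      lift (lift (fst G (specOver C K)) (snd G (specOver C K) ≫ σ ≫ ι[G]) ≫ μ[G])
        (snd G (specOver C K)) = lift (unitPoint K G) (𝟙 (specOver C K)) := by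
    ext1
    · simp only [Category.assoc, lift_fst, comp_lift_assoc, lift_snd_assoc, Category.id_comp]
      simp [unitPoint]
    · simp
  exact congrArg (fun t => t.left) h

variable [Differential K] [IsConstantField C K]

/-- The logarithmic derivative of a `K`-point `σ` of `G`: the translation to the identity element of
`G_K`, by the right translation of `σ⁻¹`, of the tangent vector `[∂, σ♯]` at `σ`. -/
noncomputable def logDeriv (σ : specOver C K ⟶ G) :
    TangentVector (extend K G) (kPoint (unitPoint K G)) :=
  (commutator (canonicalDer K G) (canonicalDer_const G) (kPoint σ) (kPoint_hom σ)).push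
    (rightTranslationK (σ ≫ ι[G])) _ (kPoint_rightTranslationK σ)

/-- `σ` is a solution of the automorphic equation `l∂(σ) = A`. The space of automorphic vector
fields is identified with the tangent space of `G_K` at the identity element through `A ↦ A_e`. -/
def IsAutomorphicSolution (A : VectorField G ⊗[C] K) (σ : specOver C K ⟶ G) : Prop :=
  logDeriv σ = VectorField.valueAt (nonAutonomous K G A) (kPoint (unitPoint K G))

end LogDer

/-! ### Spaces of constants -/

section Const

/-- The differential points of a scheme with derivation: those which correspond to differential
ideals in each of their affine neighbourhoods. -/
def diffPoints {X : Scheme.{u}} (D : SchemeDerivation X) : Set X :=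
  {x | ∀ U : X.Opens, IsAffineOpen U → x ∈ U →
    ∀ f : Γ(X, U), x ∉ X.basicOpen f → x ∉ X.basicOpen (D.app U f)}

/-- The topological subspace of differential points. -/
def constSpace {X : Scheme.{u}} (D : SchemeDerivation X) : TopCat.{u} := TopCat.of (diffPoints D)

/-- The rings of germs of functions at the differential points. -/
abbrev constStalk {X : Scheme.{u}} (D : SchemeDerivation X) (x : constSpace D) : Type u :=
  X.presheaf.stalk x.1

/-- Families of germs which are the germs of a constant regular function of `X`. -/
def isConstGerm {X : Scheme.{u}} (D : SchemeDerivation X) :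
    TopCat.PrelocalPredicate (constStalk D) where
  pred {W} s := ∃ (U : X.Opens) (f : Γ(X, U)), D.app U f = 0 ∧
    ∀ y : W, ∃ hy : y.1.1 ∈ U, s y = X.presheaf.germ U y.1.1 hy f
  res {_ _} i s h := by
    obtain ⟨U, f, hf, hs⟩ := h
    exact ⟨U, f, hf, fun y => hs ⟨y.1, i.le y.2⟩⟩

/-- The sections over an open set `W` of the restriction to the differential points of the sheaf of
constant functions: the families of germs which are locally the germs of a constant regular
function of `X`. -/
def constSections {X : Scheme.{u}} (D : SchemeDerivation X) (W : Opens (constSpace D)) :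
    Subring (∀ x : W, constStalk D x.1) where
  carrier := {s | (isConstGerm D).sheafify.pred s}
  one_mem' x := ⟨W, x.2, 𝟙 _, ⊤, 1, by simp, fun y => ⟨trivial, by simp⟩⟩
  zero_mem' x := ⟨W, x.2, 𝟙 _, ⊤, 0, by simp, fun y => ⟨trivial, by simp⟩⟩
  neg_mem' {s} hs x := by
    obtain ⟨V, hx, i, U, f, hf, h⟩ := hs x
    refine ⟨V, hx, i, U, -f, by rw [map_neg, hf, neg_zero], fun y => ⟨(h y).1, ?_⟩⟩
    rw [map_neg, ← (h y).2]
    rfl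
  add_mem' {s t} hs ht x := by
    obtain ⟨V, hx, i, U, f, hf, h⟩ := hs x
    obtain ⟨V', hx', i', U', f', hf', h'⟩ := ht x
    refine ⟨V ⊓ V', ⟨hx, hx'⟩, Opens.infLELeft _ _ ≫ i, U ⊓ U',
      res inf_le_left f + res inf_le_right f', ?_, fun y => ⟨⟨(h ⟨y.1, y.2.1⟩).1,
        (h' ⟨y.1, y.2.2⟩).1⟩, ?_⟩⟩
    · rw [map_add, show D.app _ (res inf_le_left f) = res inf_le_left (D.app U f) from D.map_res _ _,
        show D.app _ (res inf_le_right f') = res inf_le_right (D.app U' f') from D.map_res _ _,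
        hf, hf', map_zero, map_zero, add_zero]
    · rw [map_add]
      have e := (h ⟨y.1, y.2.1⟩).2.trans (X.presheaf.germ_res_apply (homOfLE (inf_le_left : U ⊓ U' ≤ U))
        y.1.1 ⟨(h ⟨y.1, y.2.1⟩).1, (h' ⟨y.1, y.2.2⟩).1⟩ f).symm
      have e' := (h' ⟨y.1, y.2.2⟩).2.trans (X.presheaf.germ_res_apply
        (homOfLE (inf_le_right : U ⊓ U' ≤ U')) y.1.1
        ⟨(h ⟨y.1, y.2.1⟩).1, (h' ⟨y.1, y.2.2⟩).1⟩ f').symm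
      exact congrArg₂ (fun a b : X.presheaf.stalk y.1.1 => a + b) e e'
  mul_mem' {s t} hs ht x := by
    obtain ⟨V, hx, i, U, f, hf, h⟩ := hs x
    obtain ⟨V', hx', i', U', f', hf', h'⟩ := ht x
    refine ⟨V ⊓ V', ⟨hx, hx'⟩, Opens.infLELeft _ _ ≫ i, U ⊓ U',
      res inf_le_left f * res inf_le_right f', ?_, fun y => ⟨⟨(h ⟨y.1, y.2.1⟩).1,
        (h' ⟨y.1, y.2.2⟩).1⟩, ?_⟩⟩
    · rw [Derivation.leibniz,
        show D.app _ (res inf_le_left f) = res inf_le_left (D.app U f) from D.map_res _ _,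
        show D.app _ (res inf_le_right f') = res inf_le_right (D.app U' f') from D.map_res _ _,
        hf, hf', map_zero, map_zero, smul_zero, smul_zero, add_zero]
    · rw [map_mul]
      have e := (h ⟨y.1, y.2.1⟩).2.trans (X.presheaf.germ_res_apply (homOfLE (inf_le_left : U ⊓ U' ≤ U))
        y.1.1 ⟨(h ⟨y.1, y.2.1⟩).1, (h' ⟨y.1, y.2.2⟩).1⟩ f).symm
      have e' := (h' ⟨y.1, y.2.2⟩).2.trans (X.presheaf.germ_res_apply
        (homOfLE (inf_le_right : U ⊓ U' ≤ U')) y.1.1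
        ⟨(h ⟨y.1, y.2.1⟩).1, (h' ⟨y.1, y.2.2⟩).1⟩ f').symm
      exact congrArg₂ (fun a b : X.presheaf.stalk y.1.1 => a * b) e e'

/-- The presheaf of rings `W ↦ constSections D W`. -/
noncomputable def constPresheaf {X : Scheme.{u}} (D : SchemeDerivation X) :
    TopCat.Presheaf CommRingCat.{u} (constSpace D) where
  obj W := .of (constSections D W.unop)
  map {W W'} i := CommRingCat.ofHom
    { toFun s := ⟨fun x => s.1 ⟨x.1, i.unop.le x.2⟩, (isConstGerm D).sheafify.res i.unop s.1 s.2⟩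
      map_one' := rfl
      map_mul' _ _ := rfl
      map_zero' := rfl
      map_add' _ _ := rfl }

lemma constPresheaf_isSheaf {X : Scheme.{u}} (D : SchemeDerivation X) :
    (constPresheaf D).IsSheaf := by
  refine (TopCat.Presheaf.isSheaf_iff_isSheaf_comp (forget CommRingCat) _).mpr ?_
  exact TopCat.Presheaf.isSheaf_of_iso (NatIso.ofComponents fun _ => Iso.refl _ :
      TopCat.subpresheafToTypes (isConstGerm D).sheafify.toPrelocalPredicate ≅
        constPresheaf D ⋙ forget CommRingCat)
    (TopCat.subpresheafToTypes.isSheaf _)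

/-- The space of constants `Const(X, D)` of a scheme with derivation: the topological subspace of
differential points, endowed with the restriction of the sheaf of constant regular functions. -/
noncomputable def Const {X : Scheme.{u}} (D : SchemeDerivation X) : SheafedSpace CommRingCat.{u} where
  carrier := constSpace D
  presheaf := constPresheaf D
  IsSheaf := constPresheaf_isSheaf D

/-- `(X, D)` is almost-constant if its space of constants is a scheme. -/
def IsAlmostConstant {X : Scheme.{u}} (D : SchemeDerivation X) : Prop :=
  ∃ Z : Scheme.{u}, Nonempty (Const D ≅ Z.toSheafedSpace)

/-- For a `K`-scheme with derivation, the space of constants is isomorphic to the `C`-scheme `Z`.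
The isomorphism is over `C`: the pull-back of `c ∈ C`, seen as a function on `Z`, is the family of
germs of `c`, seen as a function on `X`. -/
def ConstIso {C K : Type u} [Field C] [Field K] [Algebra C K] {X : Over (Spec (.of K))}
    (D : SchemeDerivation X.left) (Z : Over (Spec (.of C))) : Prop :=
  ∃ φ : Const D ≅ Z.left.toSheafedSpace, ∀ (c : C) (x : constSpace D),
    (show constSections D ⊤ from φ.hom.hom.c.app (.op ⊤) (constHom Z c)).1 ⟨x, trivial⟩ =
      X.left.presheaf.germ ⊤ x.1 trivial (constHom X (algebraMap C K c))

end Const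

/-! ### Lie-Vessiot systems -/

section Statement

variable (C K : Type u) [Field C] [Field K] [Algebra C K]
  (G M : Over (Spec (.of C))) [GrpObj G] [ModObj G M]

/-- The space `ℛ(G) ⊗ K` of automorphic vector fields of `G` with coefficients in `K`. -/
abbrev AutomorphicField := rightInvariant G ⊗[C] K

/-- The space `ℛ(G, M) ⊗ K` of Lie-Vessiot vector fields of `M` with coefficients in `K`. -/
abbrev LieVessiotField := fundamentalFields G M ⊗[C] K

variable {C K G M}

/-- An automorphic vector field, as a non-autonomous vector field of `G`. -/
noncomputable def AutomorphicField.toField (A : AutomorphicField C K G) : VectorField G ⊗[C] K :=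
  (rightInvariant G).subtype.rTensor K A

/-- A Lie-Vessiot vector field, as a non-autonomous vector field of `M`. -/
noncomputable def LieVessiotField.toField (X : LieVessiotField C K G M) : VectorField M ⊗[C] K :=
  (fundamentalFields G M).subtype.rTensor K X

variable (C K G M) in
/-- The map from automorphic vector fields to Lie-Vessiot vector fields induced by `A ↦ A^M`. -/
noncomputable def AutomorphicField.toLieVessiot :
    AutomorphicField C K G →ₗ[C] LieVessiotField C K G M :=
  (fundamentalField G M).rangeRestrict.rTensor K

end Statement

end LieVessiot

/-! All six statements amount to the existence of a differential `K`-point of `(G_K, ∂_A)`. Such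
points are the solutions of the automorphic equation (`isAutomorphicSolution_iff`), because right
invariance of `A` moves an equation between tangent vectors at the identity to the point `σ`. If `σ`
is one of them, its action on `M_K` carries the canonical derivation `∂` to `∂_X`
(`isDifferential_actOver`), so `σ⁻¹` splits the system. For the regular action of `G` on itself this
is the gauge transformation.

The substantial direction is `exists_differential_kPoint`: a splitting produces a differential
`K`-point. Dividing an affine ring of `G_K` by a maximal differential ideal gives a differential
point `ε` with values in a field `E` over `K`; as `C` is algebraically closed, `E` has no constants
outside `C`. To see that `E = K` it suffices, in characteristic zero, that any two `K`-embeddings of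
`E` in a field `L` agree. The orbit map of a point `x` of `M(C)` carries `ε` to a differential point
of `M_K`, which is isomorphic to some `Y_K`. Its component in `Y` has constant coordinates, so it
does not depend on the embedding. The two `L`-points of `G` obtained from `ε` therefore act in the
same way on `M(C)`, and they coincide because faithfulness extends to `L`-points
(`eq_one_of_smul_eq`). The coordinates of `ε` generate `E` as a field, so the embeddings agree.

For the spaces of constants, the differential ideals of `A ⊗ K` are extended from `A`
(`map_comap_of_isDiffIdeal`), and primes of `A` stay prime after extension because `C` is
algebraically closed (`isPrime_map_of_isPushout`). Hence the differential points of an extended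
scheme are the points of the `C`-scheme, and its constant functions are locally the functions of the
`C`-scheme (`IsConstantModel`). -/

namespace LieVessiot

/-! ### Constants of differential modules and rings -/

section ConstantVectors

variable {C K : Type u} [Field C] [Field K] [Differential K] [Algebra C K] [IsConstantField C K]

variable (C) in
lemma exists_const {x : K} (h : Differential.deriv x = 0) : ∃ c : C, algebraMap C K c = x :=
  (IsConstantField.deriv_eq_zero_iff x).mp h

lemma deriv_algebraMap (c : C) : Differential.deriv (algebraMap C K c) = 0 :=
  (IsConstantField.deriv_eq_zero_iff _).mpr ⟨c, rfl⟩

variable {E : Type*} [AddCommGroup E] [Module K E] [Module C E] [IsScalarTower C K E]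
  {D : E →+ E} (hD : ∀ (k : K) e, D (k • e) = Differential.deriv k • e + k • D e)

include hD in
/-- Constants which are linearly independent over the field of constants are linearly
independent. -/
theorem linearIndependent_of_const {ι : Type*} {w : ι → E} (hw : ∀ i, D (w i) = 0)
    (h : LinearIndependent C w) : LinearIndependent K w := by
  classical
  rw [linearIndependent_iff']
  intro s
  induction s using Finset.induction_on with
  | empty => simp
  | insert j t hj ih =>
    intro g hg
    by_cases hgj : g j = 0
    · rw [Finset.sum_insert hj, hgj, zero_smul, zero_add] at hg
      intro i hi
      rcases Finset.mem_insert.mp hi with rfl | hi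
      · exact hgj
      · exact ih g hg i hi
    · exfalso
      -- Dividing by `g j` makes the coefficient at `j` equal to 1, so differentiating leaves a
      -- relation on `t` alone; by induction the other coefficients are constant.
      have h1 : w j + ∑ i ∈ t, ((g j)⁻¹ * g i) • w i = 0 := by
        have := congrArg (fun e => (g j)⁻¹ • e) hg
        simp only [Finset.sum_insert hj, smul_add, smul_zero, smul_smul, inv_mul_cancel₀ hgj,
          one_smul, Finset.smul_sum] at this
        exact this
      have h2 : ∑ i ∈ t, Differential.deriv ((g j)⁻¹ * g i) • w i = 0 := by
        have := congrArg D h1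
        simpa only [map_add, map_sum, hD, hw, smul_zero, add_zero, zero_add, map_zero] using this
      have h3 := ih _ h2
      have h4 : ∀ i, ∃ c : C, i ∈ t → algebraMap C K c = (g j)⁻¹ * g i := fun i => by
        by_cases hi : i ∈ t
        · obtain ⟨c, hc⟩ := exists_const C (h3 i hi)
          exact ⟨c, fun _ => hc⟩
        · exact ⟨0, fun h => absurd h hi⟩
      choose c hc using h4
      rw [linearIndependent_iff'] at h
      -- A relation over `C` with coefficient 1 at `j` contradicts independence over `C`.
      have h5 := h (insert j t) (fun i => if i = j then 1 else c i) (by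
        rw [Finset.sum_insert hj, if_pos rfl, one_smul, ← h1]
        congr 1
        refine Finset.sum_congr rfl fun i hi => ?_
        have hij : i ≠ j := fun e => hj (e ▸ hi)
        rw [if_neg hij, ← hc i hi, algebraMap_smul]) j (Finset.mem_insert_self _ _)
      simp at h5

include hD in
-- A `C`-basis of `W` stays independent over `K`, so the derivative of an expansion in this basis
-- vanishes only if all the coefficients are constant.
theorem mem_of_const_of_mem_span {W : Submodule C E} (hW : ∀ w ∈ W, D w = 0) {x : E}
    (hx : x ∈ Submodule.span K (W : Set E)) (hDx : D x = 0) : x ∈ W := by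
  let b := Module.Basis.ofVectorSpace C W
  have hb : LinearIndependent K (fun i => (b i : E)) :=
    linearIndependent_of_const hD (fun i => hW _ (b i).2)
      (b.linearIndependent.map' W.subtype (Submodule.ker_subtype W))
  have hx' : x ∈ Submodule.span K (Set.range fun i => (b i : E)) := by
    refine Submodule.span_le.mpr (fun w hw => ?_) hx
    have : w ∈ Submodule.span C (Set.range fun i => (b i : E)) := by
      have h1 : (⟨w, hw⟩ : W) ∈ Submodule.span C (Set.range b) := by
        rw [b.span_eq]; trivial
      have h2 := Submodule.mem_map_of_mem (f := W.subtype) h1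
      rw [Submodule.map_span, ← Set.range_comp] at h2
      exact h2
    exact Submodule.span_le_restrictScalars C K _ this
  obtain ⟨l, rfl⟩ := (Finsupp.mem_span_range_iff_exists_finsupp).mp hx'
  rw [Finsupp.sum] at hDx ⊢
  simp only [map_sum, hD, hW _ (b _).2, smul_zero, add_zero] at hDx
  refine Submodule.sum_mem _ fun i hi => ?_
  obtain ⟨c, hc⟩ := exists_const C (linearIndependent_iff'.mp hb _ _ hDx i hi)
  rw [← hc, algebraMap_smul]
  exact W.smul_mem _ (b i).2

include hD in
/-- A differential subspace of a space spanned by constants is spanned by constants. -/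
theorem le_span_const {W : Submodule C E} (hW : ∀ w ∈ W, D w = 0) {N : Submodule K E}
    (hN : ∀ n ∈ N, D n ∈ N) {n : E} (hn : n ∈ N) (hn' : n ∈ Submodule.span K (W : Set E)) :
    n ∈ Submodule.span K ((N : Set E) ∩ W) := by
  classical
  -- Induction on the number of constants in the expression: once one coefficient is normalised to
  -- 1, either all are constant or the element is a sum of two elements of `N` that involve fewer
  -- constants.
  have main : ∀ (m : ℕ) (s : Finset E), s.card = m → (∀ w ∈ s, w ∈ W) → ∀ k : E → K,
      ∑ w ∈ s, k w • w ∈ N → ∑ w ∈ s, k w • w ∈ Submodule.span K ((N : Set E) ∩ W) := by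
    intro m
    induction m with
    | zero =>
      intro s hs _ k _
      rw [Finset.card_eq_zero.mp hs, Finset.sum_empty]
      exact Submodule.zero_mem _
    | succ m ih =>
      intro s hs hsW k hk
      have ih' : ∀ j ∈ s, ∀ k : E → K, k j = 0 → ∑ w ∈ s, k w • w ∈ N →
          ∑ w ∈ s, k w • w ∈ Submodule.span K ((N : Set E) ∩ W) := by
        intro j hj k hkj hkN
        have e : ∑ w ∈ s, k w • w = ∑ w ∈ s.erase j, k w • w := by
          rw [← Finset.add_sum_erase s _ hj, hkj, zero_smul, zero_add]
        rw [e] at hkN ⊢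
        exact ih _ (by rw [Finset.card_erase_of_mem hj, hs]; rfl)
          (fun w hw => hsW w (Finset.mem_of_mem_erase hw)) k hkN
      obtain ⟨j, hj⟩ : s.Nonempty := Finset.card_pos.mp (by omega)
      by_cases hkj : k j = 0
      · exact ih' j hj k hkj hk
      let l : E → K := fun w => (k j)⁻¹ * k w
      have hl : ∑ w ∈ s, l w • w = (k j)⁻¹ • ∑ w ∈ s, k w • w := by
        rw [Finset.smul_sum]
        simp only [smul_smul, l]
      have hlN : ∑ w ∈ s, l w • w ∈ N := hl ▸ N.smul_mem _ hk
      suffices h : ∑ w ∈ s, l w • w ∈ Submodule.span K ((N : Set E) ∩ W) by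
        have := Submodule.smul_mem _ (k j) h
        rwa [hl, smul_smul, mul_inv_cancel₀ hkj, one_smul] at this
      have hDl : D (∑ w ∈ s, l w • w) = ∑ w ∈ s, Differential.deriv (l w) • w := by
        rw [map_sum]
        refine Finset.sum_congr rfl fun w hw => ?_
        rw [hD, hW w (hsW w hw), smul_zero, add_zero]
      have hlj : Differential.deriv (l j) = 0 := by
        simp [l, inv_mul_cancel₀ hkj]
      by_cases hconst : ∀ w ∈ s, Differential.deriv (l w) = 0
      · refine Submodule.subset_span ⟨hlN, Submodule.sum_mem _ fun w hw => ?_⟩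
        obtain ⟨c, hc⟩ := exists_const C (hconst w hw)
        rw [← hc, algebraMap_smul]
        exact W.smul_mem _ (hsW w hw)
      · push Not at hconst
        obtain ⟨i, hi, hli⟩ := hconst
        -- `q` gives the multiple of the derivative that has the same coefficient as `l` at `i`.
        -- Since `l j = 1`, it has no term at `j`, while `l - q` has none at `i`.
        let q : E → K := fun w => l i * (Differential.deriv (l i))⁻¹ * Differential.deriv (l w)
        have hq : ∑ w ∈ s, q w • w =
            (l i * (Differential.deriv (l i))⁻¹) • D (∑ w ∈ s, l w • w) := by
          rw [hDl, Finset.smul_sum]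
          simp only [smul_smul, q]
        have hqN : ∑ w ∈ s, q w • w ∈ N := hq ▸ N.smul_mem _ (hN _ hlN)
        have h1 := ih' j hj q (by simp only [q, hlj, mul_zero]) hqN
        have hsub : ∑ w ∈ s, (l w - q w) • w = ∑ w ∈ s, l w • w - ∑ w ∈ s, q w • w := by
          simp only [sub_smul, Finset.sum_sub_distrib]
        have h2 := ih' i hi (fun w => l w - q w)
          (by simp only [q, mul_assoc, inv_mul_cancel₀ hli, mul_one, sub_self])
          (hsub ▸ N.sub_mem hlN hqN)
        rw [hsub] at h2
        simpa using Submodule.add_mem _ h2 h1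
  obtain ⟨k, s, hs, hsum⟩ := Submodule.mem_span_iff_exists_finset_subset.mp hn'
  rw [← hsum.2] at hn ⊢
  exact main _ s rfl (fun w hw => hs hw) k hn

end ConstantVectors

/-! ### Differential ideals -/

/-- Ideals stable under a derivation. -/
def IsDiffIdeal {R : Type*} [CommRing R] (D : Derivation ℤ R R) (I : Ideal R) : Prop :=
  ∀ a ∈ I, D a ∈ I

/-- The derivation induced on the quotient by a differential ideal. -/
noncomputable def quotDerivation {R : Type*} [CommRing R] (D : Derivation ℤ R R) {I : Ideal R}
    (hI : IsDiffIdeal D I) : Derivation ℤ (R ⧸ I) (R ⧸ I) :=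
  Derivation.mk' (AddMonoidHom.toIntLinearMap
    (QuotientAddGroup.map I.toAddSubgroup I.toAddSubgroup D.toLinearMap.toAddMonoidHom hI))
    fun a b => by
      obtain ⟨a, rfl⟩ := Ideal.Quotient.mk_surjective a
      obtain ⟨b, rfl⟩ := Ideal.Quotient.mk_surjective b
      change Ideal.Quotient.mk I (D (a * b)) = Ideal.Quotient.mk I a * Ideal.Quotient.mk I (D b) +
        Ideal.Quotient.mk I b * Ideal.Quotient.mk I (D a)
      simp

/-- The minimal primes of a `ℚ`-algebra are differential ideals. -/
theorem isDiffIdeal_of_mem_minimalPrimes {R : Type*} [CommRing R] [Algebra ℚ R]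
    (D : Derivation ℤ R R) {P : Ideal R} (hP : P ∈ minimalPrimes R) : IsDiffIdeal D P := by
  have hPp : P.IsPrime := hP.1.1
  intro a ha
  by_contra hDa
  -- some `s ∉ P` kills a power of `a`
  have h1 : ∃ s ∉ P, ∃ n, s * a ^ n = 0 := by
    have hnil : IsNilpotent (algebraMap R (Localization.AtPrime P) a) := by
      have h := IsLocalization.AtPrime.radical_map_of_mem_minimalPrimes
        (A := Localization.AtPrime P) P ⊥ hP
      rw [Ideal.map_bot] at h
      rw [← mem_nilradical, nilradical]
      refine (congrArg (fun J => algebraMap R (Localization.AtPrime P) a ∈ J) h).mpr ?_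
      exact Ideal.mem_map_of_mem _ ha
    obtain ⟨n, hn⟩ := hnil
    rw [← map_pow, IsLocalization.map_eq_zero_iff P.primeCompl] at hn
    obtain ⟨s, hs⟩ := hn
    exact ⟨s, s.2, n, hs⟩
  obtain ⟨s, hs, n, hn⟩ := h1
  induction n generalizing s with
  | zero =>
    rw [pow_zero, mul_one] at hn
    exact hs (hn ▸ P.zero_mem)
  | succ n ih =>
    -- Multiplying the derivative of `s * a ^ (n + 1) = 0` by `s` kills the term in `D s`. As `n +
    -- 1` is invertible, `s ^ 2 * D a`, which is outside `P`, kills `a ^ n`.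
    refine ih (s ^ 2 * D a) (fun h => ?_) ?_
    · rcases hPp.mem_or_mem h with h | h
      · exact hs (hPp.mem_of_pow_mem _ h)
      · exact hDa h
    · have h2 : D (s * a ^ (n + 1)) = 0 := by rw [hn, map_zero]
      rw [Derivation.leibniz, Derivation.leibniz_pow] at h2
      simp only [smul_eq_mul, nsmul_eq_mul, Nat.add_sub_cancel] at h2
      have h3 : ((n + 1 : ℕ) : R) * (s ^ 2 * D a * a ^ n) = 0 := by
        have := congrArg (s * ·) h2
        simp only [mul_zero] at this
        linear_combination this - D s * hn
      have hu : IsUnit ((n + 1 : ℕ) : R) := by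
        have : IsUnit ((n + 1 : ℕ) : ℚ) := by
          rw [isUnit_iff_ne_zero]; positivity
        simpa using this.map (algebraMap ℚ R)
      exact (hu.mul_right_eq_zero).mp h3

open scoped TensorProduct

/-! ### Differential fields generated by finitely many elements -/

lemma linearIndependent_pow_iff_transcendental {F R : Type*} [Field F] [CommRing R] [Algebra F R]
    {b : R} : LinearIndependent F (fun n : ℕ => b ^ n) ↔ Transcendental F b := by
  have e : (fun n : ℕ => b ^ n) = (Polynomial.aeval b).toLinearMap ∘ Polynomial.basisMonomials F := by
    ext n
    simp
  rw [e]
  constructor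
  · intro h
    rw [← e, linearIndependent_iff'] at h
    rw [transcendental_iff]
    intro p hp
    rw [Polynomial.aeval_eq_sum_range] at hp
    ext n
    by_cases hn : n < p.natDegree + 1
    · exact h _ _ hp n (Finset.mem_range.mpr hn)
    · exact Polynomial.coeff_eq_zero_of_natDegree_lt (by omega)
  · intro h
    exact (Polynomial.basisMonomials F).linearIndependent.map' _
      (LinearMap.ker_eq_bot.mpr (transcendental_iff_injective.mp h))

section Simple

open Polynomial in
/-- If `b` is transcendental over `K` in the algebra `R` of finite type, then `b` takes almost all
the values of `K`. -/
lemma exists_polynomial_not_isUnit_sub {K R : Type*} [Field K] [CommRing R] [IsDomain R]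
    [Algebra K R] [Algebra.FiniteType K R] {b : R} (hb : Transcendental K b) :
    ∃ f : K[X], f ≠ 0 ∧ ∀ c : K, f.eval c ≠ 0 → ¬ IsUnit (b - algebraMap K R c) := by
  let φ : K[X] →ₐ[K] R := aeval b
  have hφ : Function.Injective φ := transcendental_iff_injective.mp hb
  have hfp : φ.toRingHom.FinitePresentation := by
    rw [← RingHom.FinitePresentation.of_finiteType]
    have h : (φ.toRingHom.comp (algebraMap K K[X])).FiniteType := by
      have e : φ.toRingHom.comp (algebraMap K K[X]) = algebraMap K R := φ.comp_algebraMap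
      rw [e]
      exact RingHom.finiteType_algebraMap.mpr ‹_›
    exact RingHom.FiniteType.of_comp_finiteType h
  -- A constructible subset of the affine line contains or avoids a non-empty basic open subset;
  -- this symmetric form is stable under complements, as the induction requires.
  have hcons : ∀ s : Set (PrimeSpectrum K[X]), Topology.IsConstructible s →
      ∃ f : K[X], f ≠ 0 ∧ ((PrimeSpectrum.basicOpen f : Set (PrimeSpectrum K[X])) ⊆ s ∨
        (PrimeSpectrum.basicOpen f : Set (PrimeSpectrum K[X])) ⊆ sᶜ) := by
    intro s hs
    induction hs using Topology.IsConstructible.empty_union_induction with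
    | open_retrocompact U hU _ =>
      rcases U.eq_empty_or_nonempty with rfl | ⟨x, hx⟩
      · exact ⟨1, one_ne_zero, Or.inr (by simp)⟩
      · obtain ⟨_, ⟨f, rfl⟩, hxf, hf⟩ :=
          PrimeSpectrum.isTopologicalBasis_basic_opens.exists_subset_of_mem_open hx hU
        refine ⟨f, ?_, Or.inl hf⟩
        rintro rfl
        simp at hxf
    | union s hs t ht ihs iht =>
      obtain ⟨f, hf0, hf⟩ := ihs
      obtain ⟨g, hg0, hg⟩ := iht
      rcases hf with hf | hf
      · exact ⟨f, hf0, Or.inl (hf.trans Set.subset_union_left)⟩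
      rcases hg with hg | hg
      · exact ⟨g, hg0, Or.inl (hg.trans Set.subset_union_right)⟩
      refine ⟨f * g, mul_ne_zero hf0 hg0, Or.inr ?_⟩
      rw [Set.compl_union]
      refine Set.subset_inter (subset_trans ?_ hf) (subset_trans ?_ hg)
      · exact PrimeSpectrum.basicOpen_mul_le_left f g
      · exact PrimeSpectrum.basicOpen_mul_le_right f g
    | compl s hs ih =>
      obtain ⟨f, hf0, hf⟩ := ih
      exact ⟨f, hf0, by rw [compl_compl]; exact hf.symm⟩
  -- By Chevalley's theorem the image of `Spec R` is constructible. It contains the generic point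
  -- since `φ` is injective, so it contains a basic open subset.
  obtain ⟨f, hf0, hf⟩ := hcons _ (PrimeSpectrum.isConstructible_range_comap hfp)
  have hf' : (PrimeSpectrum.basicOpen f : Set (PrimeSpectrum K[X])) ⊆
      Set.range (PrimeSpectrum.comap φ.toRingHom) := by
    refine hf.resolve_right fun h => ?_
    refine h (a := ⟨⊥, Ideal.isPrime_bot⟩) (by simpa using hf0) ⟨⟨⊥, Ideal.isPrime_bot⟩, ?_⟩
    refine PrimeSpectrum.ext ?_
    exact Ideal.comap_bot_of_injective _ hφ
  refine ⟨f, hf0, fun c hc hu => ?_⟩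
  -- The prime `(X - c)` lies under a prime of `R`, which then contains `b - c`.
  have hX : (Ideal.span {X - C c} : Ideal K[X]).IsPrime :=
    (Ideal.span_singleton_prime (X_sub_C_ne_zero c)).mpr (prime_X_sub_C c)
  obtain ⟨P, hP⟩ := hf' (a := ⟨_, hX⟩) (by
    change f ∉ Ideal.span {X - C c}
    rw [Ideal.mem_span_singleton, dvd_iff_isRoot]
    exact hc)
  have h1 : X - C c ∈ P.asIdeal.comap φ.toRingHom := by
    have := congrArg PrimeSpectrum.asIdeal hP
    change P.asIdeal.comap φ.toRingHom = _ at this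
    rw [this]
    exact Ideal.mem_span_singleton_self _
  have h2 : b - algebraMap K R c ∈ P.asIdeal := by
    have h3 : φ (X - C c) = b - algebraMap K R c := by simp [φ]
    rw [← h3]
    exact h1
  exact P.2.ne_top (Ideal.eq_top_of_isUnit_mem _ h2 hu)

variable {C K : Type u} [Field C] [Field K] [Differential K] [Algebra C K] [IsConstantField C K]

/-- Puts the Leibniz rule in the form required by the results on constant vectors. -/
lemma derivation_smul {R : Type*} [CommRing R] [Algebra K R] {D : Derivation ℤ R R}
    (hD : ∀ k, D (algebraMap K R k) = algebraMap K R (Differential.deriv k)) (k : K) (r : R) :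
    D.toLinearMap.toAddMonoidHom (k • r) =
      Differential.deriv k • r + k • D.toLinearMap.toAddMonoidHom r := by
  change D (k • r) = _ • r + k • D r
  rw [Algebra.smul_def, Algebra.smul_def, Algebra.smul_def, Derivation.leibniz, hD, smul_eq_mul,
    smul_eq_mul]
  ring

variable (C) in
/-- The constants of a simple differential algebra of finite type are the constants of the base. -/
theorem const_of_simple [IsAlgClosed C] {R : Type*} [CommRing R] [IsDomain R] [Algebra K R]
    [Algebra.FiniteType K R] {D : Derivation ℤ R R}
    (hD : ∀ k, D (algebraMap K R k) = algebraMap K R (Differential.deriv k))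
    (hs : ∀ I : Ideal R, IsDiffIdeal D I → I = ⊥ ∨ I = ⊤) {b : R} (hb : D b = 0) :
    ∃ c : C, algebraMap K R (algebraMap C K c) = b := by
  let : Algebra C R := ((algebraMap K R).comp (algebraMap C K)).toAlgebra
  have : IsScalarTower C K R := IsScalarTower.of_algebraMap_eq fun _ => rfl
  have hDC : ∀ c : C, D (algebraMap C R c) = 0 := fun c => by
    rw [IsScalarTower.algebraMap_apply C K R, hD, deriv_algebraMap, map_zero]
  classical
  -- If `b` is transcendental over `K`, each `b - c` with `c` in `C` is a nonzero constant, so it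
  -- generates a differential ideal and is a unit by simplicity. This contradicts
  -- `exists_polynomial_not_isUnit_sub`, as `C` is infinite.
  by_cases ht : Transcendental K b
  · exfalso
    obtain ⟨f, hf0, hf⟩ := exists_polynomial_not_isUnit_sub ht
    have : Infinite C := IsAlgClosed.instInfinite
    obtain ⟨c, hc⟩ : ∃ c : C, f.eval (algebraMap C K c) ≠ 0 := by
      obtain ⟨x, ⟨c, rfl⟩, hx⟩ := (Set.infinite_range_of_injective
        (algebraMap C K).injective).exists_notMem_finset f.roots.toFinset
      refine ⟨c, fun h => hx ?_⟩
      rw [Multiset.mem_toFinset, Polynomial.mem_roots hf0]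
      exact h
    refine hf _ hc ?_
    have hne : b - algebraMap K R (algebraMap C K c) ≠ 0 := fun h => by
      rw [sub_eq_zero] at h
      exact ht (h ▸ isAlgebraic_algebraMap _)
    have hdiff : IsDiffIdeal D (Ideal.span {b - algebraMap K R (algebraMap C K c)}) := by
      intro a ha
      obtain ⟨r, rfl⟩ := Ideal.mem_span_singleton'.mp ha
      have hz : D (b - algebraMap K R (algebraMap C K c)) = 0 := by
        rw [map_sub, hb, hD, deriv_algebraMap, map_zero, sub_zero]
      rw [Derivation.leibniz, hz, smul_zero, zero_add, smul_eq_mul]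
      exact Ideal.mul_mem_right _ _ (Ideal.mem_span_singleton_self _)
    rcases hs _ hdiff with h | h
    · exact absurd (Ideal.span_singleton_eq_bot.mp h) hne
    · exact Ideal.span_singleton_eq_top.mp h
  -- If `b` is algebraic over `K`, it is algebraic over `C`: otherwise its powers, which are
  -- constants independent over `C`, would be independent over `K`.
  · have halg : IsIntegral C b := by
      rw [← isAlgebraic_iff_isIntegral]
      by_contra htC
      refine ht ?_
      have h1 : LinearIndependent C fun n : ℕ => b ^ n :=
        linearIndependent_pow_iff_transcendental.mpr htC
      have h2 : LinearIndependent K fun n : ℕ => b ^ n :=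
        linearIndependent_of_const (derivation_smul hD) (fun n => by
          change D (b ^ n) = 0
          rw [Derivation.leibniz_pow, hb, smul_zero, smul_zero]) h1
      exact linearIndependent_pow_iff_transcendental.mp h2
    have hint : Algebra.IsIntegral C (Algebra.adjoin C {b}) :=
      Algebra.IsIntegral.adjoin fun x hx => by
        rw [Set.mem_singleton_iff.mp hx]; exact halg
    obtain ⟨c, hc⟩ := (IsAlgClosed.algebraMap_bijective_of_isIntegral (k := C)
      (K := Algebra.adjoin C {b})).2 ⟨b, Algebra.self_mem_adjoin_singleton C b⟩
    exact ⟨c, congrArg Subtype.val hc⟩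

/-- The derivation attached to a section `s ↦ s + ε D s` of the dual numbers. -/
def derivationOfDual {R : Type*} [CommRing R] (ψ : R →+* DualNumber R)
    (hψ : ∀ r, (ψ r).fst = r) : Derivation ℤ R R :=
  Derivation.mk' (AddMonoidHom.toIntLinearMap (AddMonoidHom.mk' (fun r => (ψ r).snd)
    fun a b => by rw [map_add]; rfl)) fun a b => by
      change (ψ (a * b)).snd = a * (ψ b).snd + b * (ψ a).snd
      rw [map_mul, DualNumber.snd_mul, hψ, hψ]
      ring

/-- A derivation of a domain extends to its field of fractions. -/
lemma exists_derivation_fractionField {R F : Type u} [CommRing R] [IsDomain R] [Field F]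
    [Algebra R F] [IsFractionRing R F] (D : Derivation ℤ R R) :
    ∃ d : Derivation ℤ F F, ∀ r, d (algebraMap R F r) = algebraMap R F (D r) := by
  -- A derivation amounts to a homomorphism to dual numbers, and a dual number is a unit as soon as
  -- its first component is; so the universal property of localization applies.
  let φ := dualHom D (algebraMap R F)
  have hu : ∀ s : nonZeroDivisors R, IsUnit (φ s) := fun s => by
    rw [TrivSqZeroExt.isUnit_iff_isUnit_fst]
    exact IsLocalization.map_units F s
  let ψ : F →+* DualNumber F := IsLocalization.lift hu
  have hψ : ∀ r, ψ (algebraMap R F r) = φ r := fun r => IsLocalization.lift_eq hu r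
  have hfst : (TrivSqZeroExt.fstHom F F F).toRingHom.comp ψ = RingHom.id F := by
    refine IsLocalization.ringHom_ext (nonZeroDivisors R) (RingHom.ext fun r => ?_)
    simp only [RingHom.comp_apply, hψ]
    rfl
  refine ⟨derivationOfDual ψ fun r => congrArg (fun f : F →+* F => f r) hfst, fun r => ?_⟩
  change (ψ (algebraMap R F r)).snd = _
  rw [hψ]
  rfl

/-- The quotient by such an ideal is differentially simple, which is what forces its constants to
lie in `C`. -/
lemma exists_maximal_isDiffIdeal {R : Type*} [CommRing R] [Nontrivial R] [IsNoetherianRing R]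
    (D : Derivation ℤ R R) : ∃ I : Ideal R, IsDiffIdeal D I ∧ I ≠ ⊤ ∧
      ∀ J : Ideal R, IsDiffIdeal D J → I ≤ J → J = I ∨ J = ⊤ := by
  obtain ⟨I, ⟨hI, hI'⟩, hmax⟩ := set_has_maximal_iff_noetherian.mpr
    (inferInstance : IsNoetherian R R) {I : Ideal R | IsDiffIdeal D I ∧ I ≠ ⊤}
    ⟨⊥, fun a ha => by rw [Ideal.mem_bot.mp ha, map_zero]; exact Ideal.zero_mem _, bot_ne_top⟩
  refine ⟨I, hI, hI', fun J hJ hIJ => ?_⟩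
  by_contra! h
  exact hmax J ⟨hJ, h.2⟩ (lt_of_le_of_ne hIJ h.1.symm)

variable (C) in
-- The minimal primes are differential, so simplicity makes `Q` a domain, and `E` is its field of
-- fractions. A constant fraction has a differential ideal of denominators, which must be the unit
-- ideal; the fraction then lies in `Q` and `const_of_simple` applies. The last clause serves to
-- compare embeddings of `E` on the image of `Q`.
lemma exists_differential_field_of_simple [IsAlgClosed C] [CharZero K] {Q : Type u} [CommRing Q]
    [Nontrivial Q] [Algebra K Q] [Algebra.FiniteType K Q] {dQ : Derivation ℤ Q Q}
    (hdQ : ∀ k, dQ (algebraMap K Q k) = algebraMap K Q (Differential.deriv k))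
    (hsimple : ∀ J : Ideal Q, IsDiffIdeal dQ J → J = ⊥ ∨ J = ⊤) :
    ∃ (E : Type u) (_ : Field E) (_ : Algebra K E) (d : Derivation ℤ E E) (ρ : Q →ₐ[K] E),
      (∀ r, d (ρ r) = ρ (dQ r)) ∧
      (∀ e, d e = 0 → ∃ c : C, algebraMap K E (algebraMap C K c) = e) ∧
      ∀ e, ∃ r s, ρ s ≠ 0 ∧ ρ s * e = ρ r := by
  let : Algebra ℚ Q := ((algebraMap K Q).comp (algebraMap ℚ K)).toAlgebra
  have hQ : IsDomain Q := by
    obtain ⟨P, hP⟩ : (minimalPrimes Q).Nonempty :=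
      Set.nonempty_coe_sort.mp (Ideal.nonempty_minimalPrimes bot_ne_top)
    have hPp : P.IsPrime := hP.1.1
    rcases hsimple P (isDiffIdeal_of_mem_minimalPrimes dQ hP) with h | h
    · rw [h] at hPp
      exact IsDomain.of_bot_isPrime Q
    · exact absurd h hPp.ne_top
  obtain ⟨F, _, _, _⟩ : ∃ (F : Type u) (_ : Field F) (_ : Algebra Q F), IsFractionRing Q F :=
    ⟨FractionRing Q, inferInstance, inferInstance, inferInstance⟩
  let : Algebra K F := ((algebraMap Q F).comp (algebraMap K Q)).toAlgebra
  have : IsScalarTower K Q F := IsScalarTower.of_algebraMap_eq fun _ => rfl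
  obtain ⟨d, hd⟩ := exists_derivation_fractionField (F := F) dQ
  refine ⟨F, inferInstance, inferInstance, d, IsScalarTower.toAlgHom K Q F, fun r => hd _,
    fun e he => ?_, fun e => ?_⟩
  · -- the ideal of denominators of `e`
    let J : Ideal Q :=
      { carrier := {s | ∃ r, algebraMap Q F s * e = algebraMap Q F r}
        zero_mem' := ⟨0, by simp⟩
        add_mem' := by
          rintro a b ⟨r, hr⟩ ⟨s, hs⟩
          exact ⟨r + s, by rw [map_add, map_add, add_mul, hr, hs]⟩
        smul_mem' := by
          rintro a b ⟨r, hr⟩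
          exact ⟨a * r, by rw [smul_eq_mul, map_mul, map_mul, mul_assoc, hr]⟩ }
    have hJ : IsDiffIdeal dQ J := by
      rintro s ⟨r, hr⟩
      refine ⟨dQ r, ?_⟩
      have := congrArg d hr
      rw [Derivation.leibniz, he, smul_zero, zero_add, smul_eq_mul, hd, hd] at this
      rw [← this, mul_comm]
    have hJ1 : (1 : Q) ∈ J := by
      rcases hsimple J hJ with h | h
      · exfalso
        obtain ⟨r, s, hs⟩ := IsLocalization.exists_mk'_eq (nonZeroDivisors Q) e
        have h1 : (s : Q) ∈ J := ⟨r, by rw [← hs, mul_comm, IsLocalization.mk'_spec]⟩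
        rw [h] at h1
        exact nonZeroDivisors.ne_zero s.2 h1
      · rw [h]; trivial
    obtain ⟨r, hr⟩ := hJ1
    rw [map_one, one_mul] at hr
    have hr0 : dQ r = 0 := by
      rw [hr, hd] at he
      exact (map_eq_zero_iff _ (IsFractionRing.injective Q F)).mp he
    obtain ⟨c, hc⟩ := const_of_simple C hdQ hsimple hr0
    exact ⟨c, by rw [hr, ← hc]; rfl⟩
  · obtain ⟨r, s, hs⟩ := IsLocalization.exists_mk'_eq (nonZeroDivisors Q) e
    refine ⟨r, s, (IsLocalization.map_units F s).ne_zero, ?_⟩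
    change algebraMap Q F s * e = algebraMap Q F r
    rw [← hs, mul_comm, IsLocalization.mk'_spec]

variable (C) in
/-- A non-zero differential algebra of finite type has a differential point with values in a
differential field without new constants. -/
theorem exists_differential_field [IsAlgClosed C] [CharZero C] {R : Type u} [CommRing R]
    [Nontrivial R] [Algebra K R] [Algebra.FiniteType K R] (D : Derivation ℤ R R)
    (hD : ∀ k, D (algebraMap K R k) = algebraMap K R (Differential.deriv k)) :
    ∃ (E : Type u) (_ : Field E) (_ : Algebra K E) (d : Derivation ℤ E E) (ρ : R →ₐ[K] E),
      (∀ r, d (ρ r) = ρ (D r)) ∧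
      (∀ e, d e = 0 → ∃ c : C, algebraMap K E (algebraMap C K c) = e) ∧
      ∀ e, ∃ r s, ρ s ≠ 0 ∧ ρ s * e = ρ r := by
  have : CharZero K := charZero_of_injective_algebraMap (algebraMap C K).injective
  have : IsNoetherianRing R := Algebra.FiniteType.isNoetherianRing K R
  obtain ⟨I, hI, hItop, hImax⟩ := exists_maximal_isDiffIdeal D
  let Q := R ⧸ I
  let dQ : Derivation ℤ Q Q := quotDerivation D hI
  have : Nontrivial Q := Ideal.Quotient.nontrivial_iff.mpr hItop
  have hdQ : ∀ k, dQ (algebraMap K Q k) = algebraMap K Q (Differential.deriv k) := fun k => by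
    change Ideal.Quotient.mk I (D (algebraMap K R k)) = _
    rw [hD]
    rfl
  have hsimple : ∀ J : Ideal Q, IsDiffIdeal dQ J → J = ⊥ ∨ J = ⊤ := by
    intro J hJ
    have hJ' := hImax (J.comap (Ideal.Quotient.mk I)) (fun a ha => hJ _ ha) (by
      conv_lhs => rw [← Ideal.mk_ker (I := I)]
      exact Ideal.comap_mono bot_le)
    have hmap := Ideal.map_comap_of_surjective _ Ideal.Quotient.mk_surjective J
    rcases hJ' with h | h
    · left
      rw [← hmap, h, Ideal.map_quotient_self]
    · right
      rw [← hmap, h, Ideal.map_top]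
  obtain ⟨E, _, _, d, ρ, h1, h2, h3⟩ := exists_differential_field_of_simple C hdQ hsimple
  refine ⟨E, inferInstance, inferInstance, d, ρ.comp (Ideal.Quotient.mkₐ K I), fun r => h1 _, h2,
    fun e => ?_⟩
  obtain ⟨r, s, hs, hrs⟩ := h3 e
  obtain ⟨r, rfl⟩ := Ideal.Quotient.mk_surjective r
  obtain ⟨s, rfl⟩ := Ideal.Quotient.mk_surjective s
  exact ⟨r, s, hs, hrs⟩

end Simple

/-! ### Descent to `K` by comparison of embeddings -/

/-- In characteristic zero, an element of an extension `E` of `K` on which all pairs of embeddings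
of `E` agree belongs to `K`. -/
theorem mem_range_of_forall_algHom_eq {K E : Type u} [Field K] [CharZero K] [Field E] [Algebra K E]
    (e : E) (h : ∀ (L : Type u) [Field L] [Algebra K L] (f g : E →ₐ[K] L), f e = g e) :
    ∃ k, algebraMap K E k = e := by
  let S := E ⊗[K] E
  let x : S := e ⊗ₜ 1
  let y : S := 1 ⊗ₜ e
  -- Every residue field of `E ⊗ E` receives two embeddings of `E`, so `x - y` lies in every prime
  -- ideal.
  have hnil : IsNilpotent (x - y) := by
    rw [← mem_nilradical, nilradical_eq_sInf, Submodule.mem_sInf]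
    intro P hP
    have hPp : Ideal.IsPrime P := hP
    let L := Ideal.ResidueField (I := P)
    let q : S →ₐ[K] L := IsScalarTower.toAlgHom K S L
    have := h L (q.comp Algebra.TensorProduct.includeLeft)
      (q.comp Algebra.TensorProduct.includeRight)
    change algebraMap S L x = algebraMap S L y at this
    rw [← sub_eq_zero, ← map_sub] at this
    exact (Ideal.algebraMap_residueField_eq_zero).mp this
  -- `e` is algebraic
  have halg : IsAlgebraic K e := by
    by_contra ht
    have h1 : Transcendental E y := by
      have := Module.Flat.linearIndependent_one_tmul (S := E)
        (linearIndependent_pow_iff_transcendental.mpr ht)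
      have e2 : (fun n : ℕ => y ^ n) = fun n => (1 : E) ⊗ₜ[K] (e ^ n) := by
        ext n
        rw [Algebra.TensorProduct.tmul_pow, one_pow]
      exact linearIndependent_pow_iff_transcendental.mp (e2 ▸ this)
    obtain ⟨n, hn⟩ := hnil
    -- Nilpotency of `x - y` is an algebraic relation for `y` over the left factor, whereas `y` has
    -- remained transcendental there by flatness.
    have h2 : Polynomial.aeval y ((Polynomial.C e - Polynomial.X) ^ n) = 0 := by
      rw [map_pow, map_sub, Polynomial.aeval_C, Polynomial.aeval_X]
      exact hn
    have h3 := (transcendental_iff.mp h1) _ h2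
    have h4 : (Polynomial.X - Polynomial.C e : Polynomial E) = 0 := by
      rw [← neg_sub, eq_zero_of_pow_eq_zero h3, neg_zero]
    exact Polynomial.X_sub_C_ne_zero e h4
  have hint : IsIntegral K e := halg.isIntegral
  have hsep : (minpoly K e).Separable := (minpoly.irreducible hint).separable
  -- Both are roots of the separable polynomial `p` and they differ by a nilpotent element, so they
  -- coincide by the uniqueness part of Newton's method.
  have hxy : x = y := by
    let p := minpoly K e
    have hx0 : Polynomial.aeval x p = 0 := by
      have : x = (Algebra.TensorProduct.includeLeft : E →ₐ[K] S) e := rfl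
      rw [this, Polynomial.aeval_algHom_apply, minpoly.aeval, map_zero]
    have hye : y = (Algebra.TensorProduct.includeRight : E →ₐ[K] S) e := rfl
    have hy0 : Polynomial.aeval y p = 0 := by
      rw [hye, Polynomial.aeval_algHom_apply, minpoly.aeval, map_zero]
    have hy1 : IsUnit (Polynomial.aeval y (Polynomial.derivative p)) := by
      rw [hye, Polynomial.aeval_algHom_apply]
      exact (isUnit_iff_ne_zero.mpr (hsep.aeval_derivative_ne_zero (minpoly.aeval K e))).map _
    obtain ⟨r, -, hr⟩ := Polynomial.existsUnique_nilpotent_sub_and_aeval_eq_zero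
      (hy0 ▸ IsNilpotent.zero) hy1
    rw [hr x ⟨by simpa using hnil.neg, hx0⟩, hr y ⟨by rw [sub_self]; exact IsNilpotent.zero, hy0⟩]
  by_contra! hK
  -- If `e` is not in `K`, then `1` and `e` are independent over `K`, hence `1 ⊗ 1` and `1 ⊗ e` over
  -- the left factor; this excludes `x = y`.
  have h1 : LinearIndependent K ![1, e] := by
    refine LinearIndependent.pair_iff.mpr fun s t hst => ?_
    have ht : t = 0 := by
      by_contra ht
      refine hK (-(t⁻¹ * s)) ?_
      have := congrArg (t⁻¹ • ·) hst
      simp only [smul_add, smul_smul, inv_mul_cancel₀ ht, one_smul, smul_zero] at this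
      rw [map_neg, Algebra.algebraMap_eq_smul_one]
      linear_combination -this
    refine ⟨?_, ht⟩
    rw [ht, zero_smul, add_zero] at hst
    exact (smul_eq_zero.mp hst).resolve_right one_ne_zero
  have h2 := Module.Flat.linearIndependent_one_tmul (S := E) h1
  rw [Fintype.linearIndependent_iff] at h2
  have h3 := h2 ![e, -1] (by
    simp only [Fin.sum_univ_two, Matrix.cons_val_zero, Matrix.cons_val_one,
      TensorProduct.smul_tmul', smul_eq_mul, mul_one]
    exact add_neg_eq_zero.mpr hxy) 1
  simp at h3

/-! ### Base change of algebras of finite type over an algebraically closed field -/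

/-- A non-zero function on a reduced algebra of finite type over an algebraically closed field `C`
does not vanish at some `C`-point. -/
lemma exists_algHom_ne_zero {C A : Type*} [Field C] [IsAlgClosed C] [CommRing A] [Algebra C A]
    [Algebra.FiniteType C A] {p : Ideal A} (hp : p.IsRadical) {a : A} (ha : a ∉ p) :
    ∃ z : A →ₐ[C] C, (∀ b ∈ p, z b = 0) ∧ z a ≠ 0 := by
  have : IsJacobsonRing A := isJacobsonRing_of_finiteType (A := C)
  -- In a Jacobson ring a radical ideal is an intersection of maximal ideals; by the Nullstellensatz
  -- their residue fields are `C`.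
  have h1 : a ∉ p.jacobson := by
    rwa [← Ideal.radical_eq_jacobson, hp.radical]
  rw [Ideal.jacobson, Submodule.mem_sInf] at h1
  push Not at h1
  obtain ⟨m, ⟨hpm, hm⟩, ham⟩ := h1
  let : Field (A ⧸ m) := Ideal.Quotient.field m
  have hfin : Module.Finite C (A ⧸ m) := finite_of_finite_type_of_isJacobsonRing C (A ⧸ m)
  have hbij : Function.Bijective (algebraMap C (A ⧸ m)) :=
    IsAlgClosed.algebraMap_bijective_of_isIntegral
  let e : C ≃ₐ[C] (A ⧸ m) := AlgEquiv.ofBijective (Algebra.ofId C (A ⧸ m)) hbij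
  have hz : ∀ b, (e.symm.toAlgHom.comp (Ideal.Quotient.mkₐ C m)) b = 0 ↔ b ∈ m := fun b => by
    change e.symm (Ideal.Quotient.mk m b) = 0 ↔ _
    rw [EmbeddingLike.map_eq_zero_iff, Ideal.Quotient.eq_zero_iff_mem]
  exact ⟨_, fun b hb => (hz b).mpr (hpm hb), fun h => ham ((hz a).mp h)⟩

section Pushout

variable {C A K B : Type*} [Field C] [CommRing A] [CommRing K] [CommRing B] [Algebra C A]
  [Algebra C K] [Algebra C B] [Algebra A B] [Algebra K B] [IsScalarTower C A B]
  [IsScalarTower C K B] [h : Algebra.IsPushout C A K B]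

variable (C A K B) in
/-- An `A`-basis of `A ⊗ K` from a basis of `K`. -/
lemma exists_basis_of_isPushout : ∃ (b : Module.Basis (Module.Basis.ofVectorSpaceIndex C K) A B),
    ∀ i, b i = algebraMap K B (Module.Basis.ofVectorSpace C K i) := by
  refine ⟨((Module.Basis.ofVectorSpace C K).baseChange A).map h.out.equiv, fun i => ?_⟩
  rw [Module.Basis.map_apply, Module.Basis.baseChange_apply, IsBaseChange.equiv_tmul, one_smul]
  rfl

variable (C A K B) in
include C h in
lemma span_range_of_isPushout : Submodule.span K (Set.range (algebraMap A B)) = ⊤ := by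
  obtain ⟨b, hb⟩ := exists_basis_of_isPushout C A K B
  refine Submodule.eq_top_iff'.mpr fun x => ?_
  rw [← b.linearCombination_repr x, Finsupp.linearCombination_apply, Finsupp.sum]
  refine Submodule.sum_mem _ fun i _ => ?_
  rw [hb, Algebra.smul_def, mul_comm, ← Algebra.smul_def]
  exact Submodule.smul_mem _ _ (Submodule.subset_span ⟨_, rfl⟩)

omit h in
-- The extended ideal is `p • ⊤`, which is computed coordinatewise in a basis; this reduces
-- questions on `A ⊗ K` to coordinates in `A`.
lemma mem_map_iff_repr {ι : Type*} (b : Module.Basis ι A B) (p : Ideal A) (x : B) :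
    x ∈ p.map (algebraMap A B) ↔ ∀ i, b.repr x i ∈ p := by
  constructor
  · intro hx
    have hx' : x ∈ p • (⊤ : Submodule A B) := by
      rw [Ideal.smul_top_eq_map]; exact hx
    refine Submodule.smul_induction_on hx' (fun a ha y _ i => ?_) fun y z hy hz i => ?_
    · rw [map_smul]
      exact Ideal.mul_mem_right _ _ ha
    · rw [map_add]
      exact Ideal.add_mem _ (hy i) (hz i)
  · intro hx
    rw [← b.linearCombination_repr x, Finsupp.linearCombination_apply, Finsupp.sum]
    refine Ideal.sum_mem _ fun i _ => ?_
    rw [Algebra.smul_def]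
    exact Ideal.mul_mem_right _ _ (Ideal.mem_map_of_mem _ (hx i))

end Pushout

section PushoutField

variable {C A K B : Type*} [Field C] [CommRing A] [Field K] [CommRing B] [Algebra C A]
  [Algebra C K] [Algebra C B] [Algebra A B] [Algebra K B] [IsScalarTower C A B]
  [IsScalarTower C K B] [h : Algebra.IsPushout C A K B]

variable (C K B) in
include h in
-- The basis need not contain `1`, but some coordinate of `1` in `K` is a nonzero scalar of `C`;
-- dividing the corresponding coordinate of the image of `a` by it recovers `a`.
lemma comap_map_of_isPushout (p : Ideal A) :
    (p.map (algebraMap A B)).comap (algebraMap A B) = p := by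
  refine le_antisymm (fun a ha => ?_) Ideal.le_comap_map
  obtain ⟨b, hb⟩ := exists_basis_of_isPushout C A K B
  let κ := Module.Basis.ofVectorSpace C K
  have h1 : algebraMap A B a = ∑ i ∈ (κ.repr 1).support, (a * algebraMap C A (κ.repr 1 i)) • b i := by
    have h2 := κ.linearCombination_repr 1
    rw [Finsupp.linearCombination_apply, Finsupp.sum] at h2
    have h3 := congrArg (fun k => a • algebraMap K B k) h2
    simp only [map_sum, map_one, Finset.smul_sum] at h3
    rw [Algebra.algebraMap_eq_smul_one, ← h3]
    refine Finset.sum_congr rfl fun i _ => ?_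
    rw [hb, mul_smul, algebraMap_smul, Algebra.smul_def (κ.repr 1 i) (κ i), map_mul,
      ← IsScalarTower.algebraMap_apply, ← Algebra.smul_def]
  have h2 : ∀ i, b.repr (algebraMap A B a) i = a * algebraMap C A (κ.repr 1 i) := by
    intro i
    classical
    rw [h1]
    simp only [map_sum, map_smul, Module.Basis.repr_self, Finsupp.coe_finsetSum, Finset.sum_apply,
      Finsupp.smul_apply, Finsupp.single_apply, smul_eq_mul, mul_ite, mul_one, mul_zero,
      Finset.sum_ite_eq']
    split_ifs with hi
    · rfl
    · rw [Finsupp.notMem_support_iff.mp hi, map_zero, mul_zero]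
  obtain ⟨i, hi⟩ : ∃ i, κ.repr 1 i ≠ 0 := by
    by_contra! h0
    exact one_ne_zero (κ.repr.map_eq_zero_iff.mp (Finsupp.ext h0))
  have h3 := (mem_map_iff_repr b p _).mp ha i
  rw [h2] at h3
  have h4 := p.mul_mem_right (algebraMap C A (κ.repr 1 i)⁻¹) h3
  rwa [mul_assoc, ← map_mul, mul_inv_cancel₀ hi, map_one, mul_one] at h4

variable (C K B) in
include h in
/-- Over an algebraically closed field, the extension of a prime ideal is prime. -/
theorem isPrime_map_of_isPushout [IsAlgClosed C] [Algebra.FiniteType C A] (p : Ideal A)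
    [hp : p.IsPrime] : (p.map (algebraMap A B)).IsPrime := by
  obtain ⟨b, hb⟩ := exists_basis_of_isPushout C A K B
  refine ⟨fun h1 => hp.ne_top ?_, fun {x y} hxy => ?_⟩
  · rw [← comap_map_of_isPushout C K B p, h1, Ideal.comap_top]
  · by_contra! hne
    obtain ⟨hx, hy⟩ := hne
    rw [mem_map_iff_repr b] at hx hy
    push Not at hx hy
    obtain ⟨i, hi⟩ := hx
    obtain ⟨j, hj⟩ := hy
    -- Two coordinates outside the prime `p` have their product outside `p`, so some `C`-point of
    -- the zero locus of `p` is a zero of neither.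
    obtain ⟨z, hz, hzij⟩ := exists_algHom_ne_zero (C := C) hp.isRadical
      (show b.repr x i * b.repr y j ∉ p from fun h => (hp.mem_or_mem h).elim hi hj)
    rw [map_mul, mul_ne_zero_iff] at hzij
    -- the `K`-point above `z`
    let w : B →ₐ[C] K := Algebra.pushoutDesc B ((Algebra.ofId C K).comp z) (AlgHom.id C K)
      fun _ _ => mul_comm _ _
    have hwA : ∀ a, w (algebraMap A B a) = algebraMap C K (z a) := fun a =>
      Algebra.pushoutDesc_left B _ _ _ a
    have hwK : ∀ k, w (algebraMap K B k) = k := fun k =>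
      Algebra.pushoutDesc_right B _ _ _ k
    -- In the chosen `C`-basis of `K`, the coordinates of `w x` are the values at `z` of the
    -- coordinates of `x`, so one nonzero value is enough.
    have hw : ∀ x, ∀ i, z (b.repr x i) ≠ 0 → w x ≠ 0 := by
      intro x i hi h0
      rw [← b.linearCombination_repr x, Finsupp.linearCombination_apply, Finsupp.sum, map_sum] at h0
      have h2 : ∑ i ∈ (b.repr x).support, z (b.repr x i) • Module.Basis.ofVectorSpace C K i = 0 := by
        rw [← h0]
        refine Finset.sum_congr rfl fun i _ => ?_
        rw [Algebra.smul_def, Algebra.smul_def, map_mul, hwA, hb, hwK]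
      have h3 := linearIndependent_iff'.mp (Module.Basis.ofVectorSpace C K).linearIndependent _ _ h2
      by_cases hi' : i ∈ (b.repr x).support
      · exact hi (h3 i hi')
      · rw [Finsupp.notMem_support_iff.mp hi', map_zero] at hi
        exact hi rfl
    refine mul_ne_zero (hw x i hzij.1) (hw y j hzij.2) ?_
    rw [← map_mul]
    have : p.map (algebraMap A B) ≤ RingHom.ker w := by
      rw [Ideal.map_le_iff_le_comap]
      intro a ha
      change w (algebraMap A B a) = 0
      rw [hwA, hz a ha, map_zero]
    exact this hxy

end PushoutField

/-- The differential ideals of `A ⊗ K` are extended from `A`. -/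
theorem map_comap_of_isDiffIdeal {C K : Type u} [Field C] [Field K] [Differential K] [Algebra C K]
    [IsConstantField C K] {A B : Type*} [CommRing A] [CommRing B] [Algebra C A]
    [Algebra C B] [Algebra A B] [Algebra K B] [IsScalarTower C A B] [IsScalarTower C K B]
    [Algebra.IsPushout C A K B] {D : Derivation ℤ B B}
    (hD : ∀ k, D (algebraMap K B k) = algebraMap K B (Differential.deriv k))
    (hA : ∀ a, D (algebraMap A B a) = 0) {I : Ideal B} (hI : IsDiffIdeal D I) :
    (I.comap (algebraMap A B)).map (algebraMap A B) = I := by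
  refine le_antisymm Ideal.map_comap_le fun x hx => ?_
  let W : Submodule C B := LinearMap.range (IsScalarTower.toAlgHom C A B).toLinearMap
  -- `I` is a `K`-subspace stable under `D`, and `B` is spanned over `K` by the constants coming
  -- from `A`; hence `I` is spanned over `K` by the elements that it shares with the image of `A`.
  have h1 := le_span_const (E := B) (D := D.toLinearMap.toAddMonoidHom)
    (derivation_smul hD) (W := W) (N := I.restrictScalars K)
    (by rintro _ ⟨a, rfl⟩; exact hA a) hI hx (by
      have := span_range_of_isPushout C A K B
      have e : (W : Set B) = Set.range (algebraMap A B) := rfl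
      rw [e, this]
      trivial)
  refine Submodule.span_le (p := ((I.comap (algebraMap A B)).map (algebraMap A B)).restrictScalars K)
    |>.mpr ?_ h1
  rintro _ ⟨hy, a, rfl⟩
  exact Ideal.mem_map_of_mem _ hy

open Limits Opposite TopologicalSpace MonoidalCategory CartesianMonoidalCategory
open scoped TensorProduct MonObj

/-! ### Derivations along a morphism -/

/-- Derivations of the structure sheaf of `P` with values in the direct image of the structure sheaf
of `Q`, for a morphism `h : Q ⟶ P`. -/
structure DerivationAlong {Q P : Scheme.{u}} (h : Q ⟶ P) where
  app (U : P.Opens) : Γ(P, U) → Γ(Q, h ⁻¹ᵁ U)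
  map_add (U : P.Opens) (s t : Γ(P, U)) : app U (s + t) = app U s + app U t
  leibniz (U : P.Opens) (s t : Γ(P, U)) :
    app U (s * t) = h.app U s * app U t + h.app U t * app U s
  map_res {U V : P.Opens} (hV : V ≤ U) (s : Γ(P, U)) :
    app V (res hV s) = res (preimage_le h hV) (app U s)

namespace DerivationAlong

variable {Q P : Scheme.{u}} {h : Q ⟶ P}

lemma map_one (δ : DerivationAlong h) (U : P.Opens) : δ.app U 1 = 0 := by
  have := δ.leibniz U 1 1
  rw [one_mul, _root_.map_one, one_mul] at this
  exact left_eq_add.mp this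

lemma map_zero (δ : DerivationAlong h) (U : P.Opens) : δ.app U 0 = 0 := by
  have := δ.map_add U 0 0
  rw [add_zero] at this
  exact left_eq_add.mp this

/-- The ring homomorphism `s ↦ h♯ s + ε δ s`. -/
def toDual (δ : DerivationAlong h) (U : P.Opens) : Γ(P, U) →+* DualNumber Γ(Q, h ⁻¹ᵁ U) where
  toFun s := (h.app U s, δ.app U s)
  map_one' := Prod.ext (_root_.map_one (h.app U).hom) (δ.map_one U)
  map_zero' := Prod.ext (_root_.map_zero (h.app U).hom) (δ.map_zero U)
  map_add' s t := Prod.ext (_root_.map_add (h.app U).hom s t) (δ.map_add U s t)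
  map_mul' s t := by
    refine Prod.ext (map_mul (h.app U).hom s t) ?_
    change δ.app U (s * t) = h.app U s • δ.app U t + MulOpposite.op (h.app U t) • δ.app U s
    rw [δ.leibniz]
    simp [mul_comm]

lemma toDual_eq_iff {δ δ' : DerivationAlong h} {U : P.Opens} {s : Γ(P, U)} :
    δ.toDual U s = δ'.toDual U s ↔ δ.app U s = δ'.app U s :=
  ⟨fun e => congrArg Prod.snd e, fun e => Prod.ext rfl e⟩

/-- The derivation `D ∘ h♯`. -/
def left (D : SchemeDerivation Q) (h : Q ⟶ P) : DerivationAlong h where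
  app U s := D.app _ (h.app U s)
  map_add U s t := by rw [_root_.map_add, _root_.map_add]
  leibniz U s t := by rw [map_mul, Derivation.leibniz, smul_eq_mul, smul_eq_mul]
  map_res {U V} hV s := by
    rw [res_app]
    exact D.map_res _ _

/-- The derivation `h♯ ∘ F`. -/
def right (h : Q ⟶ P) (F : SchemeDerivation P) : DerivationAlong h where
  app U s := h.app U (F.app U s)
  map_add U s t := by rw [_root_.map_add, _root_.map_add]
  leibniz U s t := by
    rw [Derivation.leibniz, _root_.map_add, smul_eq_mul, smul_eq_mul, map_mul, map_mul]
  map_res {U V} hV s := by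
    rw [← res_app h hV]
    exact congrArg _ (F.map_res _ _)

/-- The derivation `δ ∘ p♯`. -/
def precomp (δ : DerivationAlong h) {X : Scheme.{u}} (p : P ⟶ X) : DerivationAlong (h ≫ p) where
  app U s := δ.app (p ⁻¹ᵁ U) (p.app U s)
  map_add U s t := by rw [_root_.map_add, δ.map_add]; rfl
  leibniz U s t := by
    rw [map_mul, δ.leibniz, Scheme.Hom.comp_app]
    rfl
  map_res {U V} hV s := by
    rw [res_app, δ.map_res]
    rfl

/-- Derivations along `h` which agree on an affine neighbourhood of every point of the image agree
everywhere. -/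
theorem app_eq_of_isAffineOpen {δ δ' : DerivationAlong h}
    (H : ∀ x : Q, ∃ V : P.Opens, IsAffineOpen V ∧ h x ∈ V ∧ ∀ s, δ.app V s = δ'.app V s)
    (U : P.Opens) (s : Γ(P, U)) : δ.app U s = δ'.app U s := by
  refine section_ext fun x hx => ?_
  obtain ⟨V, hV, hxV, hδ⟩ := H x
  obtain ⟨b, hb, hxb⟩ := hV.exists_basicOpen_le (V := U) ⟨h x, hx⟩ hxV
  refine ⟨h ⁻¹ᵁ P.basicOpen b, preimage_le h hb, hxb, ?_⟩
  rw [← δ.map_res hb, ← δ'.map_res hb]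
  -- As homomorphisms to dual numbers, both derivations are determined on a basic open subset by
  -- their values on functions from `V`.
  have : δ.toDual (P.basicOpen b) = δ'.toDual (P.basicOpen b) :=
    ringHom_ext_basicOpen hV b fun a => by
      rw [toDual_eq_iff, δ.map_res, δ'.map_res, hδ]
  exact toDual_eq_iff.mp (congrArg (fun f => f (res hb s)) this)

/-- Agreement of two derivations on the functions pulled back by `p`. -/
def Agree (δ δ' : DerivationAlong h) {X : Scheme.{u}} (p : P ⟶ X) : Prop :=
  ∀ (U : X.Opens) (s : Γ(X, U)), δ.app (p ⁻¹ᵁ U) (p.app U s) = δ'.app (p ⁻¹ᵁ U) (p.app U s)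

lemma Agree.comp {δ δ' : DerivationAlong h} {X Y : Scheme.{u}} {p : P ⟶ X} (H : Agree δ δ' p)
    (r : X ⟶ Y) : Agree δ δ' (p ≫ r) := fun U s => by
  rw [Scheme.Hom.comp_app]
  exact H (r ⁻¹ᵁ U) (r.app U s)

section Prod

variable {k : Type u} [CommRing k] {X Y : Over (Spec (.of k))}

/-- Products of affine open subsets cover the product, and their rings of sections are pushouts, out
of which a homomorphism to dual numbers is determined by its two components. -/
theorem app_eq_of_prod {h : Q ⟶ (X ⊗ Y).left} {δ δ' : DerivationAlong h}
    (H₁ : Agree δ δ' (fst X Y).left) (H₂ : Agree δ δ' (snd X Y).left)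
    (U : (X ⊗ Y).left.Opens) (s : Γ((X ⊗ Y).left, U)) : δ.app U s = δ'.app U s := by
  refine app_eq_of_isAffineOpen (fun x => ?_) U s
  obtain ⟨U, hU, hxU, -⟩ := Opens.isBasis_iff_nbhd.mp X.left.isBasis_affineOpens
    (show (fst X Y).left (h x) ∈ (⊤ : X.left.Opens) from trivial)
  obtain ⟨V, hV, hxV, -⟩ := Opens.isBasis_iff_nbhd.mp Y.left.isBasis_affineOpens
    (show (snd X Y).left (h x) ∈ (⊤ : Y.left.Opens) from trivial)
  have hpo := isPushout_prod (S := Spec (.of k)) X.hom Y.hom hU hV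
  let W : (X ⊗ Y).left.Opens := (fst X Y).left ⁻¹ᵁ U ⊓ (snd X Y).left ⁻¹ᵁ V
  refine ⟨W, isAffineOpen_prod (S := Spec (.of k)) X.hom Y.hom hU hV, ⟨hxU, hxV⟩, ?_⟩
  have : CommRingCat.ofHom (δ.toDual W) = CommRingCat.ofHom (δ'.toDual W) := by
    refine hpo.hom_ext ?_ ?_
    · refine CommRingCat.hom_ext (RingHom.ext fun a => ?_)
      change δ.toDual W (res inf_le_left ((fst X Y).left.app U a)) =
        δ'.toDual W (res inf_le_left ((fst X Y).left.app U a))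
      rw [toDual_eq_iff, δ.map_res, δ'.map_res, H₁]
    · refine CommRingCat.hom_ext (RingHom.ext fun a => ?_)
      change δ.toDual W (res inf_le_right ((snd X Y).left.app V a)) =
        δ'.toDual W (res inf_le_right ((snd X Y).left.app V a))
      rw [toDual_eq_iff, δ.map_res, δ'.map_res, H₂]
  intro s
  exact toDual_eq_iff.mp (congrArg (fun f => f.hom s) this)

/-- The same criterion for functions pulled back along a morphism to a product; it allows products
of three factors to be treated one factor at a time. -/
theorem agree_prod {P : Over (Spec (.of k))} {h : Q ⟶ P.left} {δ δ' : DerivationAlong h}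
    {p : P ⟶ X ⊗ Y} (H₁ : Agree δ δ' (p ≫ fst X Y).left) (H₂ : Agree δ δ' (p ≫ snd X Y).left) :
    Agree δ δ' p.left := fun U s =>
  app_eq_of_prod (δ := δ.precomp p.left) (δ' := δ'.precomp p.left)
    (fun U s => by
      have := H₁ U s
      rw [Over.comp_left, Scheme.Hom.comp_app] at this
      exact this)
    (fun U s => by
      have := H₂ U s
      rw [Over.comp_left, Scheme.Hom.comp_app] at this
      exact this) U s

end Prod

end DerivationAlong

/-! ### Morphisms of schemes with derivation -/

lemma IsDifferential.comp {X Y Z : Scheme.{u}} {D : SchemeDerivation X} {E : SchemeDerivation Y}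
    {F : SchemeDerivation Z} {f : X ⟶ Y} {g : Y ⟶ Z} (hf : IsDifferential D E f)
    (hg : IsDifferential E F g) : IsDifferential D F (f ≫ g) := fun U s => by
  rw [Scheme.Hom.comp_app]
  exact (hf _ _).trans (congrArg _ (hg U s))

lemma IsDifferential.id {X : Scheme.{u}} (D : SchemeDerivation X) : IsDifferential D D (𝟙 X) :=
  fun U s => by
    rw [Scheme.Hom.id_app]
    rfl

/-- A morphism which is differential after composition with a differential epimorphism. -/
lemma IsDifferential.of_comp {X Y Z : Scheme.{u}} {D : SchemeDerivation X} {E : SchemeDerivation Y}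
    {F : SchemeDerivation Z} {f : X ⟶ Y} {g : Y ⟶ Z} (hf : IsDifferential D E f)
    (hfg : IsDifferential D F (f ≫ g)) (hinj : ∀ U, Function.Injective (f.app U)) :
    IsDifferential E F g := fun U s => hinj _ (by
  have := hfg U s
  rw [Scheme.Hom.comp_app] at this
  exact (hf _ _).symm.trans this)

lemma IsDifferential.inv {X Y : Scheme.{u}} {D : SchemeDerivation X} {E : SchemeDerivation Y}
    {f : X ⟶ Y} {g : Y ⟶ X} (hf : IsDifferential D E f) (hfg : f ≫ g = 𝟙 X) (hgf : g ≫ f = 𝟙 Y) :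
    IsDifferential E D g := by
  refine IsDifferential.of_comp hf (hfg ▸ IsDifferential.id D) fun U => ?_
  have : IsIso f := ⟨g, hfg, hgf⟩
  exact (ConcreteCategory.bijective_of_isIso (f.app U)).1

lemma isDifferential_of_isAffineOpen {X Y : Scheme.{u}} {D : SchemeDerivation X}
    {E : SchemeDerivation Y} {f : X ⟶ Y}
    (H : ∀ x : X, ∃ V : Y.Opens, IsAffineOpen V ∧ f x ∈ V ∧
      ∀ s, D.app (f ⁻¹ᵁ V) (f.app V s) = f.app V (E.app V s)) : IsDifferential D E f :=
  DerivationAlong.app_eq_of_isAffineOpen (δ := .left D f) (δ' := .right f E) H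

/-- Supplies the hypotheses `Agree`: to test `h` on functions pulled back by `p`, it is enough that
`p` and `h ≫ p` are differential. -/
lemma IsDifferential.agree {Q P X : Scheme.{u}} {D : SchemeDerivation Q} {F : SchemeDerivation P}
    {E : SchemeDerivation X} {h : Q ⟶ P} {p : P ⟶ X} (hp : IsDifferential F E p)
    (hhp : IsDifferential D E (h ≫ p)) :
    DerivationAlong.Agree (.left D h) (.right h F) p := fun U s => by
  change D.app _ (h.app _ (p.app U s)) = h.app _ (F.app _ (p.app U s))
  have := hhp U s
  rw [Scheme.Hom.comp_app] at this
  rw [hp]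
  exact this

section Over

variable {k : Type u} [CommRing k] {X Y : Over (Spec (.of k))}

lemma isDifferential_of_prod {Q : Scheme.{u}} {h : Q ⟶ (X ⊗ Y).left} {D : SchemeDerivation Q}
    {F : SchemeDerivation (X ⊗ Y).left}
    (H₁ : DerivationAlong.Agree (.left D h) (.right h F) (fst X Y).left)
    (H₂ : DerivationAlong.Agree (.left D h) (.right h F) (snd X Y).left) : IsDifferential D F h :=
  DerivationAlong.app_eq_of_prod H₁ H₂

/-- The universal property of `prodDer`, by which compatibility with a product is checked on its
factors. -/
lemma isDifferential_prodDer {Q : Scheme.{u}} {h : Q ⟶ (X ⊗ Y).left} {D : SchemeDerivation Q}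
    {A : VectorField X} {B : VectorField Y} (H₁ : IsDifferential D A.1 (h ≫ (fst X Y).left))
    (H₂ : IsDifferential D B.1 (h ≫ (snd X Y).left)) : IsDifferential D (prodDer A B) h :=
  isDifferential_of_prod ((prodDer_fst A B).agree H₁) ((prodDer_snd A B).agree H₂)

lemma isDifferential_whiskerRight {Z : Over (Spec (.of k))} {f : X ⟶ Y} {A : VectorField X}
    {B : VectorField Y} (h : IsDifferential A.1 B.1 f.left) (E : VectorField Z) :
    IsDifferential (prodDer A E) (prodDer B E) (f ▷ Z).left := by
  refine isDifferential_prodDer ?_ ?_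
  · rw [← Over.comp_left, whiskerRight_fst, Over.comp_left]
    exact (prodDer_fst A E).comp h
  · rw [← Over.comp_left, whiskerRight_snd]
    exact prodDer_snd A E

lemma isDifferential_whiskerLeft {Z : Over (Spec (.of k))} {f : X ⟶ Y} {A : VectorField X}
    {B : VectorField Y} (h : IsDifferential A.1 B.1 f.left) (E : VectorField Z) :
    IsDifferential (prodDer E A) (prodDer E B) (Z ◁ f).left := by
  refine isDifferential_prodDer ?_ ?_
  · rw [← Over.comp_left, whiskerLeft_fst]
    exact prodDer_fst E A
  · rw [← Over.comp_left, whiskerLeft_snd, Over.comp_left]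
    exact (prodDer_snd E A).comp h

lemma isDifferential_zero {f : X ⟶ Y} :
    IsDifferential (0 : VectorField X).1 (0 : VectorField Y).1 f.left := fun U s => by
  rw [VectorField.zero_app, VectorField.zero_app, map_zero]

end Over

/-! ### Functoriality of the extension of scalars -/

section Extend

variable {C K : Type u} [Field C] [Field K] [Algebra C K] {Z Z' : Over (Spec (.of C))}

variable (K) in
/-- The extension of a morphism to `K`. -/
noncomputable def extendMap (f : Z ⟶ Z') : extend K Z ⟶ extend K Z' :=
  Over.homMk (f ▷ specOver C K).left (by
    change (f ▷ specOver C K ≫ snd Z' (specOver C K)).left = _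
    rw [whiskerRight_snd]
    rfl)

/-- A morphism of `C`-schemes which is compatible with linear families of vector fields is
compatible with the corresponding non-autonomous vector fields. -/
lemma isDifferential_nonAutonomous {S : Type u} [AddCommGroup S] [Module C S]
    (a : S →ₗ[C] VectorField Z) (b : S →ₗ[C] VectorField Z') {f : extend K Z ⟶ extend K Z'}
    (h : ∀ s, IsDifferential (extendField K Z (a s)).1 (extendField K Z' (b s)).1 f.left)
    (t : S ⊗[C] K) :
    IsDifferential (nonAutonomous K Z (a.rTensor K t)).1 (nonAutonomous K Z' (b.rTensor K t)).1
      f.left := by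
  induction t using TensorProduct.induction_on with
  | zero =>
    rw [map_zero, map_zero, map_zero, map_zero]
    exact isDifferential_zero
  | tmul s x => exact IsDifferential.smul (h s) x
  | add t t' ht ht' =>
    rw [map_add, map_add, map_add, map_add]
    exact ht.add ht'

variable [Differential K] [IsConstantField C K]

lemma isDifferential_canonicalDer (f : Z ⟶ Z') :
    IsDifferential (canonicalDer K Z) (canonicalDer K Z') (f ▷ specOver C K).left :=
  isDifferential_whiskerRight isDifferential_zero _

/-- The two families share the parameter space `S`, so corresponding non-autonomous fields come from
one tensor `t` and can be compared on pure tensors; the canonical part is functorial by itself. -/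
theorem isDifferential_assocDer {S : Type u} [AddCommGroup S] [Module C S]
    (a : S →ₗ[C] VectorField Z) (b : S →ₗ[C] VectorField Z') {f : Z ⟶ Z'}
    (h : ∀ s, IsDifferential (a s).1 (b s).1 f.left) (t : S ⊗[C] K) :
    IsDifferential (assocDer (a.rTensor K t)) (assocDer (b.rTensor K t))
      (f ▷ specOver C K).left :=
  (isDifferential_canonicalDer f).add
    (isDifferential_nonAutonomous a b (f := extendMap K f)
      (fun s => isDifferential_whiskerRight (h s) _) t)

lemma assocDer_zero : assocDer (0 : VectorField Z ⊗[C] K) = canonicalDer K Z := by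
  rw [assocDer, map_zero]
  exact add_zero _

lemma assocDer_const (X : VectorField Z ⊗[C] K) (x : K) :
    (assocDer X).app ⊤ (constHom (extend K Z) x) =
      constHom (extend K Z) (Differential.deriv x) := by
  rw [assocDer, SchemeDerivation.add_app, Derivation.add_apply, canonicalDer_const,
    (nonAutonomous K Z X).2, add_zero]

end Extend

lemma appLE_comp_eq {X Y Z : Scheme.{u}} {f : X ⟶ Y} {g : Y ⟶ Z} {h : X ⟶ Z} (e : f ≫ g = h)
    {U : Z.Opens} {V : Y.Opens} {W : X.Opens} (e₁ : V ≤ g ⁻¹ᵁ U) (e₂ : W ≤ f ⁻¹ᵁ V)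
    (e₃ : W ≤ h ⁻¹ᵁ U) : g.appLE U V e₁ ≫ f.appLE V W e₂ = h.appLE U W e₃ := by
  subst e
  exact Scheme.Hom.appLE_comp_appLE _ _ _ _ _ _ _

/-! ### Points with values in a field -/

section Points

variable {k : Type u} [Field k]

lemma top_le_preimage {X : Scheme.{u}} (p : Spec (.of k) ⟶ X) {U : X.Opens}
    {x : Spec (.of k)} (hx : p x ∈ U) : ⊤ ≤ p ⁻¹ᵁ U := fun y _ => by
  have : y = x := Subsingleton.elim (α := PrimeSpectrum k) _ _
  rw [this]
  exact hx

/-- A point of a field with values in an affine open subset is determined by the values of the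
functions. -/
lemma point_ext {X : Scheme.{u}} {U : X.Opens} (hU : IsAffineOpen U) {p q : Spec (.of k) ⟶ X}
    (hp : ⊤ ≤ p ⁻¹ᵁ U) (hq : ⊤ ≤ q ⁻¹ᵁ U) (h : ∀ s, evalAt p U hp s = evalAt q U hq s) : p = q := by
  have e : p.appLE U ⊤ hp = q.appLE U ⊤ hq := by
    refine CommRingCat.hom_ext (RingHom.ext fun s => ?_)
    exact (ConcreteCategory.bijective_of_isIso (Scheme.ΓSpecIso (.of k)).hom).1 (h s)
  have hp' := hU.SpecMap_appLE_fromSpec p (isAffineOpen_top _) hp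
  have hq' := hU.SpecMap_appLE_fromSpec q (isAffineOpen_top _) hq
  rw [e, hq', IsAffineOpen.fromSpec_top] at hp'
  exact ((cancel_epi _).mp hp').symm

/-- The point of an affine open subset given by a ring homomorphism. -/
noncomputable def pointOfHom {X : Scheme.{u}} {U : X.Opens} (hU : IsAffineOpen U)
    (φ : Γ(X, U) →+* k) : Spec (.of k) ⟶ X :=
  Spec.map (CommRingCat.ofHom φ) ≫ hU.fromSpec

lemma pointOfHom_le {X : Scheme.{u}} {U : X.Opens} (hU : IsAffineOpen U) (φ : Γ(X, U) →+* k) :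
    ⊤ ≤ pointOfHom hU φ ⁻¹ᵁ U := by
  rw [pointOfHom, Scheme.Hom.comp_preimage, hU.fromSpec_preimage_self]
  exact le_rfl

lemma appLE_specMap {R S : CommRingCat.{u}} (φ : R ⟶ S) (h : ⊤ ≤ Spec.map φ ⁻¹ᵁ ⊤) :
    (Scheme.ΓSpecIso R).inv ≫ (Spec.map φ).appLE ⊤ ⊤ h ≫ (Scheme.ΓSpecIso S).hom = φ := by
  have h1 : (Spec.map φ).appLE ⊤ ⊤ h = (Spec.map φ).appTop := by
    exact (Scheme.Hom.app_eq_appLE (Spec.map φ) (U := ⊤)).symm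
  rw [h1, ← Category.assoc, ← Scheme.ΓSpecIso_inv_naturality, Category.assoc, Iso.inv_hom_id,
    Category.comp_id]

lemma evalAt_pointOfHom {X : Scheme.{u}} {U : X.Opens} (hU : IsAffineOpen U) (φ : Γ(X, U) →+* k)
    (h : ⊤ ≤ pointOfHom hU φ ⁻¹ᵁ U) (s : Γ(X, U)) : evalAt (pointOfHom hU φ) U h s = φ s := by
  have h0 : ⊤ ≤ Spec.map (CommRingCat.ofHom φ) ⁻¹ᵁ ⊤ := le_rfl
  have h1 : (pointOfHom hU φ).appLE U ⊤ h =
      hU.fromSpec.appLE U ⊤ (by rw [hU.fromSpec_preimage_self]) ≫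
        (Spec.map (CommRingCat.ofHom φ)).appLE ⊤ ⊤ h0 :=
    (Scheme.Hom.appLE_comp_appLE _ _ _ _ _ _ _).symm
  have h2 : hU.fromSpec.appLE U ⊤ (by rw [hU.fromSpec_preimage_self]) =
      (Scheme.ΓSpecIso Γ(X, U)).inv := by
    rw [Scheme.Hom.appLE, hU.fromSpec_app_self, Category.assoc, ← CategoryTheory.Functor.map_comp]
    have : (Spec Γ(X, U)).presheaf.map (𝟙 (op ⊤)) = 𝟙 _ := CategoryTheory.Functor.map_id _ _
    exact (congrArg (fun t => (Scheme.ΓSpecIso Γ(X, U)).inv ≫ t) this).trans (Category.comp_id _)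
  have h4 : (pointOfHom hU φ).appLE U ⊤ h ≫ (Scheme.ΓSpecIso (.of k)).hom = CommRingCat.ofHom φ := by
    rw [h1, h2, Category.assoc]
    exact appLE_specMap (CommRingCat.ofHom φ) h0
  exact congrArg (fun t => t.hom s) h4

/-- Points of a field with values in the spectrum of a ring. -/
lemma point_ext_spec {R : Type u} [CommRing R] {p q : Spec (.of k) ⟶ Spec (.of R)}
    (h : ∀ c : R, evalAt p ⊤ le_top ((Scheme.ΓSpecIso (.of R)).inv c) =
      evalAt q ⊤ le_top ((Scheme.ΓSpecIso (.of R)).inv c)) : p = q := by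
  refine point_ext (isAffineOpen_top _) le_top le_top fun s => ?_
  obtain ⟨c, rfl⟩ : ∃ c : R, (Scheme.ΓSpecIso (.of R)).inv c = s :=
    ⟨(Scheme.ΓSpecIso (.of R)).hom s, by simp⟩
  exact h c

lemma evalAt_specMap {R : Type u} [CommRing R] (φ : R →+* k) (c : R) :
    evalAt (Spec.map (CommRingCat.ofHom φ)) ⊤ le_top ((Scheme.ΓSpecIso (.of R)).inv c) = φ c :=
  congrArg (fun t => t.hom c) (appLE_specMap (CommRingCat.ofHom φ) le_top)

end Points

/-! ### Sections over products of affine open subsets -/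

section Sections

variable {k : Type u} [CommRing k]

/-- The elements of `k`, seen as functions on an open subset. -/
noncomputable def constOn (X : Over (Spec (.of k))) (U : X.left.Opens) : k →+* Γ(X.left, U) :=
  (res le_top).comp (constHom X)

lemma appLE_constOn {X Y : Over (Spec (.of k))} (f : X ⟶ Y) {U : Y.left.Opens} {V : X.left.Opens}
    (e : V ≤ f.left ⁻¹ᵁ U) (c : k) : f.left.appLE U V e (constOn Y U c) = constOn X V c :=
  appLE_const f U V e c

/-- Replaces the global functions of `Spec k` by `k` itself, so that facts on algebras over a field
apply to rings of sections. -/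
lemma isPushout_sections {P : Scheme.{u}} {X Y : Over (Spec (.of k))} {p : P ⟶ X.left}
    {q : P ⟶ Y.left} (h : IsPullback p q X.hom Y.hom) {U : X.left.Opens} (hU : IsAffineOpen U)
    {V : Y.left.Opens} (hV : IsAffineOpen V) {W : P.Opens} (hW : W = p ⁻¹ᵁ U ⊓ q ⁻¹ᵁ V) :
    IsPushout (CommRingCat.ofHom (constOn X U)) (CommRingCat.ofHom (constOn Y V))
      (p.appLE U W (hW.le.trans inf_le_left)) (q.appLE V W (hW.le.trans inf_le_right)) := by
  have h1 := (isIso_pushoutSection_iff h (US := ⊤) (UX := U) (UT := V) le_top le_top hW).mp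
    (isIso_pushoutSection_of_isAffineOpen _ _ _ _ (isAffineOpen_top (Spec (.of k))) hV hU)
  refine h1.of_iso (Scheme.ΓSpecIso (.of k)) (Iso.refl _) (Iso.refl _) (Iso.refl _) ?_ ?_ ?_ ?_
  · refine (Category.comp_id _).trans ?_
    rw [← Iso.inv_comp_eq]
    rfl
  · refine (Category.comp_id _).trans ?_
    rw [← Iso.inv_comp_eq]
    rfl
  · exact (Category.comp_id _).trans (Category.id_comp _).symm
  · exact (Category.comp_id _).trans (Category.id_comp _).symm

end Sections

/-! ### Density of the rational points -/

section Density

/-- The coordinates of `g` in a `B`-basis coming from a `C`-basis of `A` are elements of the reduced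
algebra `B`. If one of them were nonzero, it would not vanish at some `z`, and the specialisation of
`g` at `z` would be a nontrivial combination of the basis of `A`. -/
lemma eq_zero_of_forall_algHom {C A B P : Type*} [Field C] [IsAlgClosed C] [CommRing A] [CommRing B]
    [CommRing P] [Algebra C A] [Algebra C B] [Algebra C P] [Algebra A P] [Algebra B P]
    [IsScalarTower C A P] [IsScalarTower C B P] [Algebra.IsPushout C B A P]
    [Algebra.FiniteType C B] [IsReduced B] {g : P}
    (h : ∀ z : B →ₐ[C] C, ∃ w : P →+* A, (∀ a, w (algebraMap A P a) = a) ∧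
      (∀ b, w (algebraMap B P b) = algebraMap C A (z b)) ∧ w g = 0) : g = 0 := by
  obtain ⟨β, hβ⟩ := exists_basis_of_isPushout C B A P
  refine β.repr.map_eq_zero_iff.mp (Finsupp.ext fun i => ?_)
  by_contra hi
  obtain ⟨z, -, hz⟩ := exists_algHom_ne_zero (C := C) (A := B) (p := ⊥)
    Ideal.isRadical_bot (a := β.repr g i) hi
  obtain ⟨w, hwA, hwB, hw⟩ := h z
  rw [← β.linearCombination_repr g, Finsupp.linearCombination_apply, Finsupp.sum, map_sum] at hw
  have h2 : ∑ i ∈ (β.repr g).support, z (β.repr g i) • Module.Basis.ofVectorSpace C A i = 0 := by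
    rw [← hw]
    refine Finset.sum_congr rfl fun i _ => ?_
    rw [Algebra.smul_def, Algebra.smul_def, map_mul, hwB, hβ, hwA]
  have h3 := linearIndependent_iff'.mp (Module.Basis.ofVectorSpace C A).linearIndependent _ _ h2
  exact hz (h3 i (Finsupp.mem_support_iff.mpr hi))

variable {C : Type u} [Field C]

/-- The `C`-point of `Y` given by a homomorphism of `C`-algebras. -/
lemma exists_point_of_hom {Y : Over (Spec (.of C))} {V : Y.left.Opens} (hV : IsAffineOpen V)
    (z : Γ(Y.left, V) →+* C) (hz : ∀ c, z (constOn Y V c) = c) :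
    ∃ y : 𝟙_ (Over (Spec (.of C))) ⟶ Y, ∃ h : ⊤ ≤ (show Spec (.of C) ⟶ Y.left from y.left) ⁻¹ᵁ V,
      ∀ s, evalAt (show Spec (.of C) ⟶ Y.left from y.left) V h s = z s := by
  have h1 : pointOfHom hV z ≫ Y.hom = 𝟙 (Spec (.of C)) := by
    refine point_ext_spec (R := C) fun c => ?_
    have h2 := evalAt_app (pointOfHom hV z) (Y.hom : Y.left ⟶ Spec (.of C)) _ rfl ⊤ le_top le_top
      ((Scheme.ΓSpecIso (.of C)).inv c)
    have h3 := evalAt_res (pointOfHom hV z) (le_top : V ≤ ⊤) (pointOfHom_le hV z) (constHom Y c)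
    refine h2.symm.trans (h3.symm.trans ?_)
    rw [evalAt_pointOfHom]
    refine (hz c).trans ?_
    have h4 := evalAt_specMap (RingHom.id C) c
    have h5 : Spec.map (CommRingCat.ofHom (RingHom.id C)) = 𝟙 (Spec (.of C)) := Spec.map_id _
    rw [h5] at h4
    exact h4.symm
  exact ⟨Over.homMk (pointOfHom hV z) h1, pointOfHom_le hV z, evalAt_pointOfHom hV z _⟩

/-- The section `x ↦ (x, y)` of the projection of `X × Y` onto `X`. -/
noncomputable abbrev pointSection (X : Over (Spec (.of C))) {Y : Over (Spec (.of C))}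
    (y : 𝟙_ (Over (Spec (.of C))) ⟶ Y) : X ⟶ X ⊗ Y := lift (𝟙 X) (toUnit X ≫ y)

variable [IsAlgClosed C]

/-- A homomorphism `z` from the functions on `V` to `C` is a rational point `y`, and restriction
along `pointSection X y` is the specialisation at `z` that `eq_zero_of_forall_algHom` asks for. -/
lemma eq_zero_of_pointSection_of_affine {X Y : Over (Spec (.of C))} (hYred : IsReduced Y.left)
    (hY : LocallyOfFiniteType Y.hom) {U : X.left.Opens} (hU : IsAffineOpen U)
    {V : Y.left.Opens} (hV : IsAffineOpen V)
    (g : Γ((X ⊗ Y).left, (fst X Y).left ⁻¹ᵁ U ⊓ (snd X Y).left ⁻¹ᵁ V))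
    (h : ∀ (y : 𝟙_ (Over (Spec (.of C))) ⟶ Y)
      (e : U ≤ (pointSection X y).left ⁻¹ᵁ ((fst X Y).left ⁻¹ᵁ U ⊓ (snd X Y).left ⁻¹ᵁ V)),
      (pointSection X y).left.appLE _ U e g = 0) : g = 0 := by
  let W := (fst X Y).left ⁻¹ᵁ U ⊓ (snd X Y).left ⁻¹ᵁ V
  let A := Γ(X.left, U)
  let B := Γ(Y.left, V)
  let P := Γ((X ⊗ Y).left, W)
  let : Algebra C A := (constOn X U).toAlgebra
  let : Algebra C B := (constOn Y V).toAlgebra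
  let : Algebra C P := (constOn (X ⊗ Y) W).toAlgebra
  let : Algebra A P := ((fst X Y).left.appLE U W inf_le_left).hom.toAlgebra
  let : Algebra B P := ((snd X Y).left.appLE V W inf_le_right).hom.toAlgebra
  have : IsScalarTower C A P := IsScalarTower.of_algebraMap_eq fun c =>
    (appLE_constOn (fst X Y) _ c).symm
  have : IsScalarTower C B P := IsScalarTower.of_algebraMap_eq fun c =>
    (appLE_constOn (snd X Y) _ c).symm
  have hpb : IsPullback (fst X Y).left (snd X Y).left X.hom Y.hom :=
    IsPullback.of_hasPullback X.hom Y.hom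
  have hpo : Algebra.IsPushout C B A P :=
    CommRingCat.isPushout_iff_isPushout.mp (isPushout_sections hpb hU hV rfl).flip
  have : IsReduced B := inferInstance
  have : Algebra.FiniteType C B := by
    have h1 := Scheme.Hom.finiteType_appLE Y.hom (isAffineOpen_top (Spec (.of C))) hV le_top
    have h2 : RingHom.FiniteType (constOn Y V) := h1.comp (RingHom.FiniteType.of_surjective _
      (ConcreteCategory.bijective_of_isIso (Scheme.ΓSpecIso (.of C)).inv).2)
    exact h2
  refine eq_zero_of_forall_algHom (C := C) (A := A) (B := B) (P := P) fun z => ?_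
  obtain ⟨y, hy, hyz⟩ := exists_point_of_hom hV z.toRingHom z.commutes
  have e1 : pointSection X y ≫ fst X Y = 𝟙 X := lift_fst _ _
  have e2 : pointSection X y ≫ snd X Y = toUnit X ≫ y := lift_snd _ _
  have e : U ≤ (pointSection X y).left ⁻¹ᵁ W := by
    intro x hx
    refine ⟨?_, ?_⟩
    · change ((pointSection X y) ≫ fst X Y).left x ∈ U
      rw [e1]
      exact hx
    · change ((pointSection X y) ≫ snd X Y).left x ∈ V
      rw [e2]
      exact hy trivial
  have e1' : (pointSection X y).left ≫ (fst X Y).left = 𝟙 X.left := congrArg (fun t => t.left) e1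
  have e2' : (pointSection X y).left ≫ (snd X Y).left = (X.hom : X.left ⟶ Spec (.of C)) ≫
      (show Spec (.of C) ⟶ Y.left from y.left) := by
    rw [← Over.comp_left, e2, Over.comp_left]
    rfl
  refine ⟨((pointSection X y).left.appLE W U e).hom, fun a => ?_, fun b => ?_, h y e⟩
  · have : (fst X Y).left.appLE U W inf_le_left ≫ (pointSection X y).left.appLE W U e = 𝟙 _ := by
      rw [Scheme.Hom.appLE_comp_appLE]
      simp only [e1']
      simp only [Scheme.Hom.appLE, Scheme.Hom.id_app]
      exact (Category.id_comp _).trans (X.left.presheaf.map_id _)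
    exact congrArg (fun t => t.hom a) this
  · have h3 : (snd X Y).left.appLE V W inf_le_right ≫ (pointSection X y).left.appLE W U e =
        (show Spec (.of C) ⟶ Y.left from y.left).appLE V ⊤ hy ≫
          (X.hom : X.left ⟶ Spec (.of C)).appLE ⊤ U le_top := by
      have e3 : U ≤ ((pointSection X y).left ≫ (snd X Y).left) ⁻¹ᵁ V := fun x hx => (e hx).2
      exact (appLE_comp_eq rfl _ _ e3).trans (appLE_comp_eq e2'.symm _ _ _).symm
    refine (congrArg (fun t => t.hom b) h3).trans ?_
    have h5 : (show Spec (.of C) ⟶ Y.left from y.left).appLE V ⊤ hy b =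
        (Scheme.ΓSpecIso (.of C)).inv (z b) := by
      refine Eq.trans ?_ (congrArg (Scheme.ΓSpecIso (.of C)).inv (hyz b))
      exact (congrArg (fun t => t.hom ((show Spec (.of C) ⟶ Y.left from y.left).appLE V ⊤ hy b))
        (Scheme.ΓSpecIso (.of C)).hom_inv_id).symm
    exact congrArg ((X.hom : X.left ⟶ Spec (.of C)).appLE ⊤ U le_top) h5

end Density

section Density

variable {C : Type u} [Field C] [IsAlgClosed C]

/-- The rational points of a reduced scheme locally of finite type are dense in families. -/
theorem eq_zero_of_pointSection {X Y : Over (Spec (.of C))} (hXred : IsReduced X.left)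
    (hYred : IsReduced Y.left) (hY : LocallyOfFiniteType Y.hom) {O : (X ⊗ Y).left.Opens}
    (f : Γ((X ⊗ Y).left, O))
    (h : ∀ y : 𝟙_ (Over (Spec (.of C))) ⟶ Y, (pointSection X y).left.app O f = 0) : f = 0 := by
  refine section_ext fun x hx => ?_
  obtain ⟨U, hU, hxU, -⟩ := Opens.isBasis_iff_nbhd.mp X.left.isBasis_affineOpens
    (show (fst X Y).left x ∈ (⊤ : X.left.Opens) from trivial)
  obtain ⟨V, hV, hxV, -⟩ := Opens.isBasis_iff_nbhd.mp Y.left.isBasis_affineOpens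
    (show (snd X Y).left x ∈ (⊤ : Y.left.Opens) from trivial)
  have hW : IsAffineOpen (X := (X ⊗ Y).left) ((fst X Y).left ⁻¹ᵁ U ⊓ (snd X Y).left ⁻¹ᵁ V) :=
    isAffineOpen_prod (S := Spec (.of C)) X.hom Y.hom hU hV
  obtain ⟨b, hb, hxb⟩ := hW.exists_basicOpen_le (V := O) ⟨x, hx⟩ ⟨hxU, hxV⟩
  refine ⟨_, hb, hxb, ?_⟩
  rw [map_zero]
  have := hW.isLocalization_basicOpen b
  obtain ⟨n, g, hg⟩ := IsLocalization.Away.surj b (res hb f)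
  replace hg : res hb f * res ((X ⊗ Y).left.basicOpen_le b) b ^ n =
    res ((X ⊗ Y).left.basicOpen_le b) g := hg
  have hub : IsUnit (res ((X ⊗ Y).left.basicOpen_le b) b) :=
    IsLocalization.Away.algebraMap_isUnit (S := Γ((X ⊗ Y).left, (X ⊗ Y).left.basicOpen b)) b
  -- The slices of `g` are known to vanish only where `b` is invertible. Those of `b * g` therefore
  -- have empty nonvanishing locus, and are zero because `X` is reduced.
  have hbg : b * g = 0 := by
    refine eq_zero_of_pointSection_of_affine hYred hY hU hV (b * g) fun y e => ?_
    set i := (pointSection X y).left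
    rw [map_mul]
    set β := i.appLE _ U e b with hβ
    have hD : X.left.basicOpen β ≤ i ⁻¹ᵁ (X ⊗ Y).left.basicOpen b := by
      rw [hβ, Scheme.basicOpen_appLE]
      exact inf_le_right
    have h1 : res (X.left.basicOpen_le β) (i.appLE _ U e g) = 0 := by
      rw [← appLE_res i e hD ((X ⊗ Y).left.basicOpen_le b) (X.left.basicOpen_le β), ← hg, map_mul,
        appLE_res i (U := O) (V := i ⁻¹ᵁ O) le_rfl hD hb (hD.trans (preimage_le i hb)),
        ← Scheme.Hom.app_eq_appLE, h y, map_zero, zero_mul]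
    refine eq_zero_of_basicOpen_eq_bot _ ?_
    have h2 := X.left.basicOpen_res (i.appLE _ U e g) (homOfLE (X.left.basicOpen_le β)).op
    rw [Scheme.basicOpen_mul, ← h2]
    exact (congrArg _ h1).trans (X.left.basicOpen_zero _)
  have h3 := congrArg (res ((X ⊗ Y).left.basicOpen_le b)) hbg
  rw [map_mul, map_zero, ← hg] at h3
  exact (hub.pow n).mul_left_eq_zero.mp (hub.mul_right_eq_zero.mp h3)

end Density

/-! ### Right invariance in families and projection along the action -/

section Invariance

lemma appLE_eq_self {X : Scheme.{u}} {f : X ⟶ X} (h : f = 𝟙 X) {U : X.Opens} (e : U ≤ f ⁻¹ᵁ U)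
    (s : Γ(X, U)) : f.appLE U U e s = s := by
  subst h
  rw [Scheme.Hom.appLE, Scheme.Hom.id_app]
  exact res_self _ s

lemma IsDifferential.appLE {X Y : Scheme.{u}} {D : SchemeDerivation X} {E : SchemeDerivation Y}
    {f : X ⟶ Y} (h : IsDifferential D E f) {U : Y.Opens} {W : X.Opens} (e : W ≤ f ⁻¹ᵁ U)
    (s : Γ(Y, U)) : D.app W (f.appLE U W e s) = f.appLE U W e (E.app U s) :=
  (D.map_res e (f.app U s)).trans (congrArg (res e) (h U s))

/-- A derivation with a weak form of equivariance projects along a morphism with a section. -/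
lemma isDifferential_projectDer {P Q M : Scheme.{u}} {p : P ⟶ M} {s : M ⟶ P} (hs : s ≫ p = 𝟙 M)
    {D : SchemeDerivation P} {F : SchemeDerivation Q} {m k : Q ⟶ P} (hm : IsDifferential F D m)
    (hk : IsDifferential F D k) (hmk : m ≫ p = k ≫ p) {j : P ⟶ Q} (hjm : j ≫ m = 𝟙 P)
    (hjk : j ≫ k = p ≫ s) : IsDifferential D (projectDer p s hs D) p := by
  intro U f
  have hk' : m ⁻¹ᵁ p ⁻¹ᵁ U ≤ k ⁻¹ᵁ p ⁻¹ᵁ U := by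
    rw [← Scheme.Hom.comp_preimage, ← Scheme.Hom.comp_preimage, hmk]
  have hj : p ⁻¹ᵁ U ≤ j ⁻¹ᵁ m ⁻¹ᵁ p ⁻¹ᵁ U := by
    rw [← Scheme.Hom.comp_preimage, hjm]
    exact le_rfl
  have hps : p ⁻¹ᵁ U ≤ (p ≫ s) ⁻¹ᵁ p ⁻¹ᵁ U := by
    rw [← hjk]
    exact hj.trans (preimage_le j hk')
  rw [projectDer_app]
  generalize hx : D.app (p ⁻¹ᵁ U) (p.app U f) = x
  -- The derivations commute with `m♯` and `k♯`, and these agree on functions pulled back by `p`; so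
  -- `x = D (p♯ f)` satisfies `m♯ x = k♯ x`. Pulling this back by `j` gives `x = p♯ (s♯ x)`.
  have h1 : m.app (p ⁻¹ᵁ U) x = k.appLE (p ⁻¹ᵁ U) (m ⁻¹ᵁ p ⁻¹ᵁ U) hk' x := by
    rw [← hx, ← hm, ← hk.appLE]
    congr 1
    rw [Scheme.Hom.app_eq_appLE, Scheme.Hom.app_eq_appLE]
    exact congrArg (fun t => t.hom f) ((appLE_comp_eq (f := m) (g := p) rfl le_rfl le_rfl le_rfl).trans
      (appLE_comp_eq hmk.symm le_rfl hk' le_rfl).symm)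
  have h2 := congrArg (j.appLE (m ⁻¹ᵁ p ⁻¹ᵁ U) (p ⁻¹ᵁ U) hj) h1
  have h3 : j.appLE (m ⁻¹ᵁ p ⁻¹ᵁ U) (p ⁻¹ᵁ U) hj (m.app (p ⁻¹ᵁ U) x) = x := by
    have h4 : m.appLE (p ⁻¹ᵁ U) (m ⁻¹ᵁ p ⁻¹ᵁ U) le_rfl ≫ j.appLE (m ⁻¹ᵁ p ⁻¹ᵁ U) (p ⁻¹ᵁ U) hj =
      (𝟙 P : P ⟶ P).appLE (p ⁻¹ᵁ U) (p ⁻¹ᵁ U) le_rfl := appLE_comp_eq hjm le_rfl hj le_rfl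
    rw [Scheme.Hom.app_eq_appLE]
    exact (congrArg (fun t => t.hom x) h4).trans (appLE_eq_self rfl le_rfl x)
  have h4 := (appLE_comp_eq hjk hk' hj hps).trans (appLE_comp_eq (f := p) (g := s) rfl
    (le_section hs U) (le_refl (p ⁻¹ᵁ U)) hps).symm
  rw [h3] at h2
  refine h2.trans ((congrArg (fun t => t.hom x) h4).trans ?_)
  rw [Scheme.Hom.app_eq_appLE]
  rfl

variable {C : Type u} [Field C]

lemma isDifferential_toUnit {X : Over (Spec (.of C))} (A : VectorField X) :
    IsDifferential A.1 (0 : VectorField (𝟙_ (Over (Spec (.of C))))).1 (toUnit X).left := by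
  refine isDifferential_of_isAffineOpen fun x => ⟨⊤, isAffineOpen_top (Spec (.of C)), trivial,
    fun s => ?_⟩
  rw [VectorField.zero_app, map_zero]
  exact VectorField.app_structure A s

lemma isDifferential_pointSection {X Y : Over (Spec (.of C))} (A : VectorField X)
    (y : 𝟙_ (Over (Spec (.of C))) ⟶ Y) :
    IsDifferential A.1 (prodDer A (0 : VectorField Y)) (pointSection X y).left := by
  refine isDifferential_prodDer ?_ ?_
  · rw [← Over.comp_left, lift_fst]
    exact IsDifferential.id _
  · rw [← Over.comp_left, lift_snd, Over.comp_left]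
    exact (isDifferential_toUnit A).comp isDifferential_zero

variable [IsAlgClosed C] {G : Over (Spec (.of C))} [GrpObj G]

/-- Right invariance under all rational points is right invariance in families. -/
theorem isDifferential_mul (hG : IsVariety G) {A : VectorField G} (hA : A ∈ rightInvariant G) :
    IsDifferential (prodDer A (0 : VectorField G)) A.1 μ[G].left := fun U s => by
  -- The difference of the two sides is a function on an open subset of `G × G` that vanishes on
  -- each slice `G × {σ}`.
  refine sub_eq_zero.mp (eq_zero_of_pointSection hG.isReduced hG.isReduced hG.locallyOfFiniteType _
    fun σ => ?_)
  have h1 := isDifferential_pointSection A σ (μ[G].left ⁻¹ᵁ U) (μ[G].left.app U s)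
  have h2 := hA σ U s
  rw [rightTranslation, Over.comp_left, Scheme.Hom.comp_app] at h2
  rw [map_sub, sub_eq_zero]
  exact h1.symm.trans h2

variable {M : Over (Spec (.of C))} [ModObj G M]

omit [IsAlgClosed C] in
lemma act_eq_smul : act G M = fst G M • snd G M := by
  rw [Hom.smul_def, lift_fst_snd, Category.id_comp]
  rfl

omit [IsAlgClosed C] in
lemma lift_act {Z : Over (Spec (.of C))} (g : Z ⟶ G) (x : Z ⟶ M) : lift g x ≫ act G M = g • x := rfl

/-- The fundamental field `A^M` is the projection of `A ⊗ 1` along the action. -/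
theorem isDifferential_act (hG : IsVariety G) (A : rightInvariant G) :
    IsDifferential (prodDer A.1 (0 : VectorField M)) (fundamentalField G M A).1 (act G M).left := by
  -- On `G × G × M` this field differentiates the first factor only. It projects trivially along
  -- `(g, h, x) ↦ (g, h x)`, and by right invariance along `m : (g, h, x) ↦ (g h, x)`. By
  -- associativity both morphisms have the same composite with the action.
  let F := prodField A.1 (0 : VectorField (G ⊗ M))
  let m : G ⊗ G ⊗ M ⟶ G ⊗ M := lift (fst G (G ⊗ M) * (snd G (G ⊗ M) ≫ fst G M))
    (snd G (G ⊗ M) ≫ snd G M)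
  have hl : IsDifferential F.1 (prodDer A.1 (0 : VectorField M)) (G ◁ act G M).left :=
    isDifferential_whiskerLeft isDifferential_zero _
  have hm : IsDifferential F.1 (prodDer A.1 (0 : VectorField M)) m.left := by
    refine isDifferential_prodDer ?_ ?_
    · rw [← Over.comp_left, lift_fst]
      have e : fst G (G ⊗ M) * (snd G (G ⊗ M) ≫ fst G M) = (G ◁ fst G M) ≫ μ[G] := by
        rw [Hom.mul_def]
        congr 1
      rw [e, Over.comp_left]
      exact (isDifferential_whiskerLeft isDifferential_zero _).comp (isDifferential_mul hG A.2)
    · rw [← Over.comp_left, lift_snd, Over.comp_left]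
      exact (prodDer_snd _ _).comp isDifferential_zero
  have hw : m ≫ act G M = (G ◁ act G M) ≫ act G M := by
    rw [lift_act, act_eq_smul, ModObj.comp_smul, mul_smul]
    simp [ModObj.comp_smul]
  -- Inserting the identity as first factor is a section of `m`; followed by the other morphism it
  -- gives `(h, x) ↦ (e, h x)`.
  let j : G ⊗ M ⟶ G ⊗ G ⊗ M := lift 1 (𝟙 _)
  have hjm : j ≫ m = 𝟙 _ := by
    ext1
    · simp [j, m, MonObj.comp_mul, Hom.one_def]
    · simp [j, m]
  have hjk : j ≫ (G ◁ act G M) = act G M ≫ unitSection G M := by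
    ext1 <;> simp [j, unitSection, Hom.one_def]
  refine isDifferential_projectDer unitSection_act_left hm hl ?_ (j := j.left) ?_ ?_
  · rw [← Over.comp_left, hw, Over.comp_left]
  · rw [← Over.comp_left, hjm, Over.id_left]
  · rw [← Over.comp_left, hjk, Over.comp_left]

end Invariance

/-! ### Differential points -/

section DifferentialPoint

variable {E : Type u} [Field E] {d : Derivation ℤ E E} {X : Scheme.{u}} {D : SchemeDerivation X}
  {p : Spec (.of E) ⟶ X}

lemma specDerivation_evalAt (t : Γ(Spec (.of E), ⊤)) :
    d ((Scheme.ΓSpecIso (.of E)).hom t) =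
      (Scheme.ΓSpecIso (.of E)).hom ((specDerivation (.of E) d).app ⊤ t) := by
  obtain ⟨a, rfl⟩ : ∃ a : E, (Scheme.ΓSpecIso (.of E)).inv a = t :=
    ⟨(Scheme.ΓSpecIso (.of E)).hom t, by simp⟩
  rw [specDerivation_app (.of E) d a]
  simp

lemma IsDifferential.deriv_evalAt (h : IsDifferential (specDerivation (.of E) d) D p)
    {U : X.Opens} (hU : ⊤ ≤ p ⁻¹ᵁ U) (s : Γ(X, U)) :
    d (evalAt p U hU s) = evalAt p U hU (D.app U s) := by
  change d ((Scheme.ΓSpecIso (.of E)).hom (p.appLE U ⊤ hU s)) =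
    (Scheme.ΓSpecIso (.of E)).hom (p.appLE U ⊤ hU (D.app U s))
  rw [specDerivation_evalAt, h.appLE]

/-- As `Spec E` has a single point, one affine open subset is enough. -/
lemma isDifferential_of_deriv_evalAt {U : X.Opens} (hU : IsAffineOpen U) (hp : ⊤ ≤ p ⁻¹ᵁ U)
    (h : ∀ s, d (evalAt p U hp s) = evalAt p U hp (D.app U s)) :
    IsDifferential (specDerivation (.of E) d) D p := by
  refine isDifferential_of_isAffineOpen fun x => ⟨U, hU, hp trivial, fun s => ?_⟩
  have hinj : Function.Injective (res hp : Γ(Spec (.of E), p ⁻¹ᵁ U) →+* Γ(Spec (.of E), ⊤)) := by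
    have e : p ⁻¹ᵁ U = ⊤ := top_le_iff.mp hp
    intro a b hab
    have := congrArg (res e.le) hab
    rwa [res_res, res_res, res_self, res_self] at this
  refine hinj ?_
  have h1 := h s
  change d ((Scheme.ΓSpecIso (.of E)).hom (p.appLE U ⊤ hp s)) =
    (Scheme.ΓSpecIso (.of E)).hom (p.appLE U ⊤ hp (D.app U s)) at h1
  rw [specDerivation_evalAt] at h1
  exact ((specDerivation (.of E) d).map_res hp (p.app U s)).symm.trans
    ((ConcreteCategory.bijective_of_isIso (Scheme.ΓSpecIso (.of E)).hom).1 h1)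

end DifferentialPoint

/-! ### Translations by the points with values in `K` -/

section Translation

variable {C K : Type u} [Field C] [Field K] [Algebra C K]
  {G M : Over (Spec (.of C))} [GrpObj G] [ModObj G M]

variable (M) in
/-- The action of a `K`-point of `G` on `M_K`, over `C`. -/
noncomputable def actOver (σ : specOver C K ⟶ G) : M ⊗ specOver C K ⟶ M ⊗ specOver C K :=
  lift ((snd M (specOver C K) ≫ σ) • fst M (specOver C K)) (snd M (specOver C K))

/-- A left action reverses the diagrammatic order of composition. -/
lemma actOver_comp (σ τ : specOver C K ⟶ G) :
    actOver M σ ≫ actOver M τ = actOver M (τ * σ) := by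
  ext1
  · simp [actOver, ModObj.comp_smul, MonObj.comp_mul, mul_smul]
  · simp [actOver]

lemma actOver_one : actOver M (1 : specOver C K ⟶ G) = 𝟙 _ := by
  ext1
  · simp [actOver, MonObj.comp_one]
  · simp [actOver]

variable (M) in
/-- The action of a `K`-point of `G` on `M_K`. -/
noncomputable def actIso (σ : specOver C K ⟶ G) : extend K M ≅ extend K M :=
  Over.isoMk ⟨(actOver M σ).left, (actOver M σ⁻¹).left, by
      rw [← Over.comp_left, actOver_comp, inv_mul_cancel, actOver_one, Over.id_left]
      rfl, by
      rw [← Over.comp_left, actOver_comp, mul_inv_cancel, actOver_one, Over.id_left]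
      rfl⟩ (by
    change (actOver M σ ≫ snd M (specOver C K)).left = (snd M (specOver C K)).left
    rw [actOver, lift_snd])

/-- Right invariant vector fields are invariant under the right translations by all `K`-points. -/
lemma isDifferential_rightTranslationK [IsAlgClosed C] (hG : IsVariety G) {A : VectorField G}
    (hA : A ∈ rightInvariant G) (τ : specOver C K ⟶ G) :
    IsDifferential (extendField K G A).1 (extendField K G A).1 (rightTranslationK τ).left := by
  refine isDifferential_prodDer (A := A) (B := (0 : VectorField (specOver C K))) ?_ ?_
  · have e : (rightTranslationK τ).left ≫ (fst G (specOver C K)).left =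
        (G ◁ τ).left ≫ μ[G].left := by
      rw [← Over.comp_left]
      change (lift (lift (fst G (specOver C K)) (snd G (specOver C K) ≫ τ) ≫ μ[G])
        (snd G (specOver C K)) ≫ fst G (specOver C K)).left = _
      rw [lift_fst]
      rfl
    rw [e]
    exact (isDifferential_whiskerLeft isDifferential_zero A).comp (isDifferential_mul hG hA)
  · have e : (rightTranslationK τ).left ≫ (snd G (specOver C K)).left =
        (snd G (specOver C K)).left := by
      change (lift (lift (fst G (specOver C K)) (snd G (specOver C K) ≫ τ) ≫ μ[G])
        (snd G (specOver C K)) ≫ snd G (specOver C K)).left = _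
      rw [lift_snd]
    rw [e]
    exact prodDer_snd A (0 : VectorField (specOver C K))

lemma rightTranslationK_comp (σ τ : specOver C K ⟶ G) :
    (rightTranslationK σ).left ≫ (rightTranslationK τ).left = (rightTranslationK (σ * τ)).left := by
  change (lift (lift (fst G (specOver C K)) (snd G (specOver C K) ≫ σ) ≫ μ[G])
    (snd G (specOver C K)) ≫ lift (lift (fst G (specOver C K)) (snd G (specOver C K) ≫ τ) ≫ μ[G])
    (snd G (specOver C K))).left = (lift (lift (fst G (specOver C K)) (snd G (specOver C K) ≫ (σ * τ))
      ≫ μ[G]) (snd G (specOver C K))).left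
  congr 1
  simp only [← Hom.mul_def]
  ext1
  · simp [MonObj.comp_mul, mul_assoc]
  · simp

lemma rightTranslationK_one :
    (rightTranslationK (1 : specOver C K ⟶ G)).left = 𝟙 _ := by
  change (lift (lift (fst G (specOver C K)) (snd G (specOver C K) ≫ 1) ≫ μ[G])
    (snd G (specOver C K))).left = (𝟙 (G ⊗ specOver C K) : _ ⟶ _).left
  congr 1
  simp only [← Hom.mul_def]
  ext1
  · simp [MonObj.comp_one]
  · simp

lemma isIso_rightTranslationK (σ : specOver C K ⟶ G) : IsIso (rightTranslationK σ).left :=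
  ⟨(rightTranslationK σ⁻¹).left, by rw [rightTranslationK_comp, mul_inv_cancel, rightTranslationK_one],
    by rw [rightTranslationK_comp, inv_mul_cancel, rightTranslationK_one]⟩

variable [Differential K] [IsConstantField C K]

/-- The solutions of the automorphic equation are the differential `K`-points of `G_K`. -/
theorem isAutomorphicSolution_iff [IsAlgClosed C] (hG : IsVariety G) (A : AutomorphicField C K G)
    (σ : specOver C K ⟶ G) : IsAutomorphicSolution A.toField σ ↔
      IsDifferential (specDerivation (.of K) Differential.deriv) (assocDer A.toField) (kPoint σ) := by
  -- Right invariance lets the value of the field at the identity be computed at `σ`, where the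
  -- equation becomes the condition that `σ` is a differential point.
  have hR : IsDifferential (nonAutonomous K G A.toField).1 (nonAutonomous K G A.toField).1
      (rightTranslationK (σ ≫ ι[G])).left :=
    isDifferential_nonAutonomous (rightInvariant G).subtype (rightInvariant G).subtype
      (fun a => isDifferential_rightTranslationK hG a.2 _) A
  have hkp := kPoint_rightTranslationK σ
  have hle : ∀ {U : (extend K G).left.Opens}, ⊤ ≤ kPoint (unitPoint K G) ⁻¹ᵁ U →
      ⊤ ≤ kPoint σ ⁻¹ᵁ (rightTranslationK (σ ≫ ι[G])).left ⁻¹ᵁ U := fun hU => by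
    rwa [← Scheme.Hom.comp_preimage, hkp]
  have key : ∀ (U : (extend K G).left.Opens) (hU : ⊤ ≤ kPoint (unitPoint K G) ⁻¹ᵁ U)
      (s : Γ((extend K G).left, U)),
      (logDeriv σ).toFun U hU s =
        (VectorField.valueAt (nonAutonomous K G A.toField) (kPoint (unitPoint K G))).toFun U hU s ↔
      Differential.deriv (evalAt (kPoint σ) _ (hle hU)
          ((rightTranslationK (σ ≫ ι[G])).left.app U s)) =
        evalAt (kPoint σ) _ (hle hU) ((assocDer A.toField).app _
          ((rightTranslationK (σ ≫ ι[G])).left.app U s)) := by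
    intro U hU s
    have h1 : (VectorField.valueAt (nonAutonomous K G A.toField)
        (kPoint (unitPoint K G))).toFun U hU s =
        evalAt (kPoint σ) _ (hle hU) ((nonAutonomous K G A.toField).1.app _
          ((rightTranslationK (σ ≫ ι[G])).left.app U s)) := by
      rw [hR U s]
      exact (evalAt_app _ _ _ hkp U hU (hle hU) _).symm
    rw [h1, assocDer, SchemeDerivation.add_app, Derivation.add_apply, map_add, ← sub_eq_iff_eq_add']
    rfl
  constructor
  · intro h
    obtain ⟨U, hU, hxU, -⟩ := Opens.isBasis_iff_nbhd.mp (extend K G).left.isBasis_affineOpens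
      (show kPoint (unitPoint K G) (IsLocalRing.closedPoint K) ∈ (⊤ : (extend K G).left.Opens)
        from trivial)
    have hU' := top_le_preimage _ hxU
    have := isIso_rightTranslationK (σ ≫ ι[G])
    refine isDifferential_of_deriv_evalAt
      (IsAffineOpen.preimage_of_isIso hU (rightTranslationK (σ ≫ ι[G])).left) (hle hU') fun s => ?_
    -- Right translation is an isomorphism, so every function on the translated neighbourhood of `σ`
    -- comes from a function near the identity.
    obtain ⟨s, rfl⟩ := (ConcreteCategory.bijective_of_isIso
      ((rightTranslationK (σ ≫ ι[G])).left.app U)).2 s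
    exact (key U hU' s).mp (by rw [show logDeriv σ = _ from h])
  · intro h
    refine TangentVector.ext ?_
    funext U hU s
    exact (key U hU s).mpr (h.deriv_evalAt _ _)

/-- `A ↦ A ⊗ 1` on `G × M`. -/
noncomputable def rightInvariantProd (G M : Over (Spec (.of C))) [GrpObj G] :
    rightInvariant G →ₗ[C] VectorField (G ⊗ M) where
  toFun A := prodField A.1 (0 : VectorField M)
  map_add' A B := Subtype.ext (by
    have := prodDer_add A.1 B.1 (0 : VectorField M) 0
    rwa [add_zero] at this)
  map_smul' c A := by
    have := prodField_smul c A.1 (0 : VectorField M)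
    rwa [smul_zero] at this

/-- If `σ` is a differential point of `(G_K, ∂_A)`, then the action of `σ` transforms the canonical
derivation of `M_K` into `∂_X`, where `X` is the image of `A`. -/
theorem isDifferential_actOver (b : rightInvariant G →ₗ[C] VectorField M)
    (hb : ∀ a : rightInvariant G,
      IsDifferential (prodDer a.1 (0 : VectorField M)) (b a).1 (act G M).left)
    (A : AutomorphicField C K G) {σ : specOver C K ⟶ G}
    (hσ : IsDifferential (specDerivation (.of K) Differential.deriv) (assocDer A.toField) (kPoint σ)) :
    IsDifferential (canonicalDer K M) (assocDer (b.rTensor K A)) (actOver M σ).left := by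
  let T := specOver C K
  -- `j` is `(x, t) ↦ ((σ(t), x), t)`; followed by the action it is the action of `σ`. It is
  -- differential because its components in `G_K` and `M_K` are the projection to `Spec K` followed
  -- by `σ`, and the identity.
  let j : M ⊗ T ⟶ (G ⊗ M) ⊗ T := lift (lift (snd M T ≫ σ) (fst M T)) (snd M T)
  have hj : j ≫ (act G M ▷ T) = actOver M σ := by
    ext1
    · simp [j, actOver, lift_act, T]
    · simp [j, actOver, T]
  have h1 : IsDifferential (assocDer ((rightInvariantProd G M).rTensor K A))
      (assocDer (b.rTensor K A)) (act G M ▷ T).left :=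
    isDifferential_assocDer _ _ hb A
  have h2 : IsDifferential (assocDer ((rightInvariantProd G M).rTensor K A))
      (assocDer A.toField) (fst G M ▷ T).left :=
    isDifferential_assocDer (rightInvariantProd G M) (rightInvariant G).subtype
      (fun a => prodDer_fst _ _) A
  have h3 : IsDifferential (assocDer ((rightInvariantProd G M).rTensor K A))
      (canonicalDer K M) (snd G M ▷ T).left := by
    have := isDifferential_assocDer (rightInvariantProd G M)
      (0 : rightInvariant G →ₗ[C] VectorField M) (f := snd G M) (fun a => prodDer_snd _ _) A
    rwa [LinearMap.rTensor_zero, LinearMap.zero_apply, assocDer_zero] at this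
  have hj2 : IsDifferential (canonicalDer K M) (assocDer A.toField) (j.left ≫ (fst G M ▷ T).left) := by
    have e : j ≫ (fst G M ▷ T) = snd M T ≫ lift σ (𝟙 T) := by
      ext1 <;> simp [j]
    rw [← Over.comp_left, e, Over.comp_left]
    exact (prodDer_snd (0 : VectorField M) (baseDer C K)).comp hσ
  have hj3 : IsDifferential (canonicalDer K M) (canonicalDer K M) (j.left ≫ (snd G M ▷ T).left) := by
    have e : j ≫ (snd G M ▷ T) = 𝟙 _ := by
      ext1 <;> simp [j]
    rw [← Over.comp_left, e]
    exact IsDifferential.id _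
  have a2 := h2.agree hj2
  have a3 := h3.agree hj3
  rw [← hj, Over.comp_left]
  refine IsDifferential.comp (isDifferential_of_prod (DerivationAlong.agree_prod ?_ ?_) ?_) h1
  · have := a2.comp (fst G T).left
    rwa [← Over.comp_left, whiskerRight_fst] at this
  · have := a3.comp (fst M T).left
    rwa [← Over.comp_left, whiskerRight_fst] at this
  · have := a2.comp (snd G T).left
    rwa [← Over.comp_left, whiskerRight_snd] at this

end Translation

/-! ### Faithfulness for points with values in extensions -/

section Evaluation

variable {E L : Type u} [Field E] [Field L]

lemma evalAt_eq_zero {X : Scheme.{u}} {p : Spec (.of E) ⟶ X} {U : X.Opens} (hU : ⊤ ≤ p ⁻¹ᵁ U)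
    {s : Γ(X, U)} (h : p (IsLocalRing.closedPoint E) ∉ X.basicOpen s) : evalAt p U hU s = 0 := by
  by_contra hne
  refine h ?_
  have h1 := Scheme.basicOpen_appLE p ⊤ U hU s
  have hu : IsUnit (p.appLE U ⊤ hU s) := by
    have h2 : IsUnit ((Scheme.ΓSpecIso (.of E)).hom (p.appLE U ⊤ hU s)) := isUnit_iff_ne_zero.mpr hne
    have h3 := h2.map (Scheme.ΓSpecIso (.of E)).inv.hom
    have h4 : (Scheme.ΓSpecIso (.of E)).inv ((Scheme.ΓSpecIso (.of E)).hom (p.appLE U ⊤ hU s)) =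
        p.appLE U ⊤ hU s := congrArg (fun t => t.hom (p.appLE U ⊤ hU s))
          (Scheme.ΓSpecIso (.of E)).hom_inv_id
    rw [← h4]
    exact h3
  rw [Scheme.basicOpen_of_isUnit _ hu] at h1
  have h5 : IsLocalRing.closedPoint E ∈ (⊤ : (Spec (.of E)).Opens) := trivial
  rw [h1] at h5
  exact h5.2

lemma notMem_basicOpen_of_evalAt {X : Scheme.{u}} {p : Spec (.of E) ⟶ X} {U : X.Opens}
    (hU : ⊤ ≤ p ⁻¹ᵁ U) {s : Γ(X, U)} (h : evalAt p U hU s = 0) (x : Spec (.of E)) :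
    p x ∉ X.basicOpen s := by
  intro hx
  have h1 := Scheme.basicOpen_appLE p ⊤ U hU s
  have h2 : p.appLE U ⊤ hU s = 0 :=
    (ConcreteCategory.bijective_of_isIso (Scheme.ΓSpecIso (.of E)).hom).1 (h.trans (map_zero _).symm)
  rw [h2, Scheme.basicOpen_zero] at h1
  have h3 : x ∈ (⊥ : (Spec (.of E)).Opens) := by
    rw [h1]
    exact ⟨trivial, hx⟩
  exact h3

lemma evalAt_specMap_comp {X : Scheme.{u}} (g : E →+* L) {p : Spec (.of E) ⟶ X} {U : X.Opens}
    (hU : ⊤ ≤ p ⁻¹ᵁ U) (hU' : ⊤ ≤ (Spec.map (CommRingCat.ofHom g) ≫ p) ⁻¹ᵁ U) (s : Γ(X, U)) :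
    evalAt (Spec.map (CommRingCat.ofHom g) ≫ p) U hU' s = g (evalAt p U hU s) := by
  have h1 := appLE_comp_eq (f := Spec.map (CommRingCat.ofHom g)) (g := p) rfl hU
    (le_top : ⊤ ≤ Spec.map (CommRingCat.ofHom g) ⁻¹ᵁ ⊤) hU'
  have h2 := appLE_specMap (CommRingCat.ofHom g) le_top
  obtain ⟨a, ha⟩ : ∃ a : E, (Scheme.ΓSpecIso (.of E)).inv a = p.appLE U ⊤ hU s :=
    ⟨(Scheme.ΓSpecIso (.of E)).hom (p.appLE U ⊤ hU s), by simp⟩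
  have h3 : evalAt p U hU s = a := by
    change (Scheme.ΓSpecIso (.of E)).hom (p.appLE U ⊤ hU s) = a
    rw [← ha]
    simp
  rw [h3]
  change (Scheme.ΓSpecIso (.of L)).hom ((Spec.map (CommRingCat.ofHom g) ≫ p).appLE U ⊤ hU' s) = g a
  rw [← h1]
  refine Eq.trans ?_ (congrArg (fun t => t.hom a) h2)
  exact congrArg (fun t => (Scheme.ΓSpecIso (.of L)).hom
    ((Spec.map (CommRingCat.ofHom g)).appLE ⊤ ⊤ le_top t)) ha.symm

lemma evalAt_constOn {k : Type u} [CommRing k] {X : Over (Spec (.of k))} {p : Spec (.of E) ⟶ X.left}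
    {i : k →+* E} (hp : p ≫ X.hom = Spec.map (CommRingCat.ofHom i)) {U : X.left.Opens}
    (hU : ⊤ ≤ p ⁻¹ᵁ U) (c : k) : evalAt p U hU (constOn X U c) = i c := by
  have h1 := evalAt_app p (X.hom : X.left ⟶ Spec (.of k)) _ hp ⊤ le_top le_top
    ((Scheme.ΓSpecIso (.of k)).inv c)
  exact (evalAt_res p (le_top : U ≤ ⊤) hU (constHom X c)).trans (h1.trans (evalAt_specMap i c))

end Evaluation

lemma pointOfHom_hom {E : Type u} [Field E] {k : Type u} [CommRing k] {X : Over (Spec (.of k))}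
    {U : X.left.Opens} (hU : IsAffineOpen U) {ρ : Γ(X.left, U) →+* E} {i : k →+* E}
    (h : ∀ c, ρ (constOn X U c) = i c) :
    pointOfHom hU ρ ≫ X.hom = Spec.map (CommRingCat.ofHom i) := by
  refine point_ext_spec (R := k) fun c => ?_
  have h1 := evalAt_app (pointOfHom hU ρ) (X.hom : X.left ⟶ Spec (.of k)) _ rfl ⊤ le_top le_top
    ((Scheme.ΓSpecIso (.of k)).inv c)
  have h2 := evalAt_res (pointOfHom hU ρ) (le_top : U ≤ ⊤) (pointOfHom_le hU ρ) (constHom X c)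
  refine h1.symm.trans (h2.symm.trans ?_)
  rw [evalAt_pointOfHom, evalAt_specMap]
  exact h c

section Faithful

variable {C : Type u} [Field C] {L : Type u} [Field L] [Algebra C L]

lemma toUnit_specOver_left :
    (toUnit (specOver C L)).left = Spec.map (CommRingCat.ofHom (algebraMap C L)) := by
  have : toUnit (specOver C L) = Over.homMk (V := 𝟙_ (Over (Spec (.of C))))
      (Spec.map (CommRingCat.ofHom (algebraMap C L))) (Category.comp_id _) := toUnit_unique _ _
  rw [this]
  rfl

/-- A point of an extension field with the same image as a rational point comes from this rational
point. -/
lemma eq_toUnit_comp {X : Over (Spec (.of C))} {θ : specOver C L ⟶ X}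
    {z : 𝟙_ (Over (Spec (.of C))) ⟶ X}
    (h : (show Spec (.of L) ⟶ X.left from θ.left) (IsLocalRing.closedPoint L) =
      (show Spec (.of C) ⟶ X.left from z.left) (IsLocalRing.closedPoint C)) :
    θ = toUnit _ ≫ z := by
  refine Over.OverMorphism.ext ?_
  let p : Spec (.of L) ⟶ X.left := θ.left
  let q : Spec (.of C) ⟶ X.left := z.left
  change p = (toUnit (specOver C L) ≫ z).left
  rw [Over.comp_left, toUnit_specOver_left]
  change p = Spec.map (CommRingCat.ofHom (algebraMap C L)) ≫ q
  obtain ⟨V, hV, hxV, -⟩ := Opens.isBasis_iff_nbhd.mp X.left.isBasis_affineOpens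
    (show q (IsLocalRing.closedPoint C) ∈ (⊤ : X.left.Opens) from trivial)
  have hq := top_le_preimage q hxV
  have hp : ⊤ ≤ p ⁻¹ᵁ V := top_le_preimage p (x := IsLocalRing.closedPoint L) (by
    change p (IsLocalRing.closedPoint L) ∈ V
    rw [show p (IsLocalRing.closedPoint L) = _ from h]
    exact hxV)
  have hpq : ⊤ ≤ (Spec.map (CommRingCat.ofHom (algebraMap C L)) ≫ q) ⁻¹ᵁ V := fun x _ => hq trivial
  refine point_ext hV hp hpq fun s => ?_
  rw [evalAt_specMap_comp _ hq]
  let c := evalAt q V hq s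
  -- The two points have the same image, so a function that vanishes at `q` vanishes at `p`.
  -- Subtracting its value at `q` shows that every function takes the same value, in `C`, at `p`.
  have hcq : evalAt q V hq (s - constOn X V c) = 0 := by
    rw [map_sub, evalAt_constOn (i := RingHom.id C) ((Over.w z).trans ?_)]
    · exact sub_self _
    · exact (Spec.map_id _).symm
  have hcp : evalAt p V hp (s - constOn X V c) = 0 := by
    refine evalAt_eq_zero hp ?_
    rw [show p (IsLocalRing.closedPoint L) = _ from h]
    exact notMem_basicOpen_of_evalAt hq hcq _
  rw [map_sub, evalAt_constOn (i := algebraMap C L) (Over.w θ), sub_eq_zero] at hcp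
  exact hcp

variable [IsAlgClosed C] {G M : Over (Spec (.of C))} [GrpObj G] [ModObj G M]

/-- A faithful action is faithful on the points with values in extension fields. -/
theorem eq_one_of_smul_eq (hG : IsVariety G) (hM : IsVariety M) (hfaith : IsFaithful G M)
    {θ : specOver C L ⟶ G} (h : ∀ x : 𝟙_ (Over (Spec (.of C))) ⟶ M,
      θ • (toUnit (specOver C L) ≫ x) = toUnit _ ≫ x) : θ = 1 := by
  let g : G.left ⟶ Spec (.of C) := G.hom
  let m : M.left ⟶ Spec (.of C) := M.hom
  have : LocallyOfFiniteType g := hG.locallyOfFiniteType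
  have : LocallyOfFiniteType m := hM.locallyOfFiniteType
  have : JacobsonSpace G.left := LocallyOfFiniteType.jacobsonSpace g
  let pt := IsLocalRing.closedPoint C
  -- The image of `θ` is not known to be a closed point; each orbit map sends it to the closed point
  -- of the corresponding `x`.
  let p := (show Spec (.of L) ⟶ G.left from θ.left) (IsLocalRing.closedPoint L)
  let orb (x : 𝟙_ (Over (Spec (.of C))) ⟶ M) : G ⟶ M := 𝟙 G • (toUnit G ≫ x)
  have horb {Z : Over (Spec (.of C))} (z : Z ⟶ G) (x) : z ≫ orb x = z • (toUnit Z ≫ x) := by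
    simp [orb, ModObj.comp_smul]
  let ev (X : Over (Spec (.of C))) (x : 𝟙_ (Over (Spec (.of C))) ⟶ X) : X.left :=
    (show Spec (.of C) ⟶ X.left from x.left) pt
  have hclosed (x : 𝟙_ (Over (Spec (.of C))) ⟶ M) : IsClosed {ev M x} :=
    (pointEquivClosedPoint m ⟨x.left, Over.w x⟩).2
  have hclosed' (x : 𝟙_ (Over (Spec (.of C))) ⟶ G) : IsClosed {ev G x} :=
    (pointEquivClosedPoint g ⟨x.left, Over.w x⟩).2
  have hp (x : 𝟙_ (Over (Spec (.of C))) ⟶ M) : (orb x).left p = ev M x := by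
    change (θ ≫ orb x).left (IsLocalRing.closedPoint L) = ev M x
    rw [horb, h, Over.comp_left, toUnit_specOver_left]
    change (show Spec (.of C) ⟶ M.left from x.left)
      (Spec.map (CommRingCat.ofHom (algebraMap C L)) (IsLocalRing.closedPoint L)) = _
    congr 1
    exact Subsingleton.elim (α := PrimeSpectrum C) _ _
  -- The fibre of an orbit map over a closed point is closed, so a closed point in the closure of
  -- `p` fixes every rational point of `M` and is the identity by faithfulness.
  have hz : closure {p} ∩ closedPoints G.left ⊆ {ev G η[G]} := by
    rintro z ⟨hzp, hzc⟩
    let ζ : 𝟙_ (Over (Spec (.of C))) ⟶ G :=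
      Over.homMk (pointOfClosedPoint g z hzc) (pointOfClosedPoint_comp g z hzc)
    have hζ : ev G ζ = z := pointOfClosedPoint_apply g z hzc pt
    have : ζ = η[G] := by
      refine hfaith ζ fun x => Over.OverMorphism.ext ?_
      refine ext_of_apply_closedPoint_eq m (Over.w _) (Over.w x) ?_
      have h1 : lift ζ x ≫ act G M = ζ ≫ orb x := by
        rw [horb, lift_act]
        congr 1
      rw [h1]
      change (orb x).left (ev G ζ) = ev M x
      rw [hζ]
      have h2 : closure {p} ⊆ (orb x).left ⁻¹' {ev M x} :=
        closure_minimal (by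
          rintro _ rfl
          exact hp x) ((hclosed x).preimage (orb x).left.continuous)
      exact h2 hzp
    rw [← hζ, this]
    exact rfl
  -- Closed points are dense in the closed set `closure {p}`, which is therefore contained in the
  -- identity.
  have hpe : p = ev G η[G] := by
    have h1 := JacobsonSpace.closure_inter_closedPoints_eq_closure
      (isClosed_closure (s := ({p} : Set G.left))).isLocallyClosed
    have h2 := closure_minimal hz (hclosed' _)
    rw [h1] at h2
    exact h2 (subset_closure (subset_closure rfl))
  exact eq_toUnit_comp hpe

end Faithful

/-! ### Splitting -/

section Splitting

variable {C K : Type u} [Field C] [IsAlgClosed C] [CharZero C] [Field K] [Differential K]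
  [Algebra C K] [IsConstantField C K]

variable (C) in
/-- Differential schemes of finite type have differential points with values in differential fields
without new constants. -/
lemma exists_affine_differential_field {X : Over (Spec (.of K))} (hX : LocallyOfFiniteType X.hom)
    [Nonempty X.left] {D : SchemeDerivation X.left}
    (hD : ∀ k, D.app ⊤ (constHom X k) = constHom X (Differential.deriv k)) :
    ∃ (U : X.left.Opens) (_ : IsAffineOpen U) (E : Type u) (_ : Field E) (_ : Algebra K E)
      (d : Derivation ℤ E E) (ρ : Γ(X.left, U) →+* E),
      (∀ k, ρ (constOn X U k) = algebraMap K E k) ∧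
      (∀ r, d (ρ r) = ρ (D.app U r)) ∧
      (∀ e, d e = 0 → ∃ c : C, algebraMap K E (algebraMap C K c) = e) ∧
      ∀ e, ∃ r s, ρ s ≠ 0 ∧ ρ s * e = ρ r := by
  obtain ⟨x⟩ := ‹Nonempty X.left›
  obtain ⟨U, hU, hxU, -⟩ := Opens.isBasis_iff_nbhd.mp X.left.isBasis_affineOpens
    (show x ∈ (⊤ : X.left.Opens) from trivial)
  let : Algebra K Γ(X.left, U) := (constOn X U).toAlgebra
  have : Nonempty U := ⟨⟨x, hxU⟩⟩
  have : Nontrivial Γ(X.left, U) := inferInstance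
  have : Algebra.FiniteType K Γ(X.left, U) := by
    have h1 := Scheme.Hom.finiteType_appLE X.hom (isAffineOpen_top (Spec (.of K))) hU le_top
    have h2 : RingHom.FiniteType (constOn X U) := h1.comp (RingHom.FiniteType.of_surjective _
      (ConcreteCategory.bijective_of_isIso (Scheme.ΓSpecIso (.of K)).inv).2)
    exact h2
  obtain ⟨E, i1, i2, d, ρ, h1, h2, h3⟩ := exists_differential_field C (D.app U) (fun k =>
    (D.map_res le_top (constHom X k)).trans (congrArg (res le_top) (hD k)))
  exact ⟨U, hU, E, i1, i2, d, ρ.toRingHom, ρ.commutes, h1, h2, h3⟩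

variable {G M : Over (Spec (.of C))} [GrpObj G] [ModObj G M]

/-- If a Lie–Vessiot system splits, then the associated automorphic system has a differential
`K`-point. -/
theorem exists_differential_kPoint (hG : IsVariety G) (hM : IsVariety M) (hfaith : IsFaithful G M)
    (b : rightInvariant G →ₗ[C] VectorField M)
    (hb : ∀ a : rightInvariant G,
      IsDifferential (prodDer a.1 (0 : VectorField M)) (b a).1 (act G M).left)
    (A : AutomorphicField C K G)
    (hs : Splits C (extend K M) (assocDer (b.rTensor K A))) :
    ∃ σ : specOver C K ⟶ G,
      IsDifferential (specDerivation (.of K) Differential.deriv) (assocDer A.toField)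
        (kPoint σ) := by
  obtain ⟨Y, φ, hφ⟩ := hs
  let T := specOver C K
  have hlft : LocallyOfFiniteType (extend K G).hom := by
    have := hG.locallyOfFiniteType
    exact inferInstanceAs (LocallyOfFiniteType (pullback.snd G.hom (specOver C K).hom))
  have : Nonempty (extend K G).left := ⟨kPoint (unitPoint K G) (IsLocalRing.closedPoint K)⟩
  -- The field `E` may be larger than `K`, but it has the same constants; its equality with `K` is
  -- what has to be shown.
  obtain ⟨U, hU, E, _, _, d, ρ, hρk, hρd, hconst, hfrac⟩ :=
    exists_affine_differential_field C hlft (assocDer_const A.toField)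
  let ε := pointOfHom hU ρ
  have hε : IsDifferential (specDerivation (.of E) d) (assocDer A.toField) ε :=
    isDifferential_of_deriv_evalAt hU (pointOfHom_le hU ρ) fun s => by
      rw [evalAt_pointOfHom, evalAt_pointOfHom, hρd]
  have hεK : ε ≫ (snd G T).left = Spec.map (CommRingCat.ofHom (algebraMap K E)) :=
    pointOfHom_hom (X := extend K G) hU hρk
  -- Two embeddings of `E` turn `ε` into two `L`-points of `G`, which coincide by faithfulness once
  -- they act in the same way on `M(C)`.
  have key : ∀ (L : Type u) [Field L] [Algebra K L] (g₁ g₂ : E →ₐ[K] L) (e : E), g₁ e = g₂ e := by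
    intro L _ _ g₁ g₂
    let : Algebra C L := ((algebraMap K L).comp (algebraMap C K)).toAlgebra
    let κ : specOver C L ⟶ T := Over.homMk (Spec.map (CommRingCat.ofHom (algebraMap K L)))
      (Spec.map_comp _ _).symm
    have hgK (g : E →ₐ[K] L) : Spec.map (CommRingCat.ofHom g.toRingHom) ≫ ε ≫ (snd G T).left =
        Spec.map (CommRingCat.ofHom (algebraMap K L)) := by
      rw [hεK, ← Spec.map_comp, ← CommRingCat.ofHom_comp]
      congr 2
      exact g.comp_algebraMap
    let p (g : E →ₐ[K] L) : specOver C L ⟶ G ⊗ T :=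
      Over.homMk (Spec.map (CommRingCat.ofHom g.toRingHom) ≫ ε) (by
        rw [← Over.w (snd G T), Category.assoc, reassoc_of% (hgK g)]
        exact Over.w κ)
    have hpsnd (g : E →ₐ[K] L) : p g ≫ snd G T = κ := Over.OverMorphism.ext
      ((Category.assoc _ _ _).trans (hgK g))
    have hx (x : 𝟙_ (Over (Spec (.of C))) ⟶ M) :
        (p g₁ ≫ fst G T) • (toUnit (specOver C L) ≫ x) =
          (p g₂ ≫ fst G T) • (toUnit (specOver C L) ≫ x) := by
      -- The orbit map of a rational point carries `∂_A` to `∂_X`, since `a ⊗ 1` is tangent to the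
      -- slice `G × {x}`.
      let α : G ⟶ M := 𝟙 G • (toUnit G ≫ x)
      have hα (a : rightInvariant G) : IsDifferential a.1.1 (b a).1 α.left :=
        (isDifferential_pointSection a.1 x).comp (hb a)
      have hψ : IsDifferential (assocDer A.toField) (assocDer (b.rTensor K A)) (α ▷ T).left :=
        isDifferential_assocDer (rightInvariant G).subtype b hα A
      -- The component in `Y` given by the splitting is a differential point for the zero field. Its
      -- values are constants of `E`, that is elements of `C`, on which both embeddings agree.
      let r : Spec (.of E) ⟶ Y.left := ε ≫ (α ▷ T).left ≫ φ.hom.left ≫ (fst Y T).left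
      have hr : IsDifferential (specDerivation (.of E) d) (0 : VectorField Y).1 r :=
        hε.comp (hψ.comp (hφ.comp (prodDer_fst (0 : VectorField Y) (baseDer C K))))
      have hr12 : Spec.map (CommRingCat.ofHom g₁.toRingHom) ≫ r =
          Spec.map (CommRingCat.ofHom g₂.toRingHom) ≫ r := by
        obtain ⟨V, hV, hxV, -⟩ := Opens.isBasis_iff_nbhd.mp Y.left.isBasis_affineOpens
          (show r (IsLocalRing.closedPoint E) ∈ (⊤ : Y.left.Opens) from trivial)
        have hrV := top_le_preimage r hxV
        have hrg (g : E →ₐ[K] L) :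
            ⊤ ≤ (Spec.map (CommRingCat.ofHom g.toRingHom) ≫ r) ⁻¹ᵁ V := fun y _ => hrV trivial
        refine point_ext hV (hrg g₁) (hrg g₂) fun s => ?_
        rw [evalAt_specMap_comp _ hrV, evalAt_specMap_comp _ hrV]
        obtain ⟨c, hc⟩ := hconst (evalAt r V hrV s) (by
          rw [hr.deriv_evalAt, VectorField.zero_app, map_zero])
        rw [← hc]
        exact (g₁.commutes _).trans (g₂.commutes _).symm
      have hp12 : p g₁ ≫ (α ▷ T) = p g₂ ≫ (α ▷ T) := by
        refine Over.OverMorphism.ext ((cancel_mono φ.hom.left).mp ?_)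
        refine pullback.hom_ext ?_ ?_
        · have hpr (g : E →ₐ[K] L) : ((p g ≫ (α ▷ T)).left ≫ φ.hom.left) ≫ (fst Y T).left =
              Spec.map (CommRingCat.ofHom g.toRingHom) ≫ r := by
            simp only [Over.comp_left, Category.assoc, r, p, Over.homMk_left]
          exact (hpr g₁).trans (hr12.trans (hpr g₂).symm)
        · have hps (g : E →ₐ[K] L) : ((p g ≫ (α ▷ T)).left ≫ φ.hom.left) ≫ (snd Y T).left =
              κ.left := by
            have h1 : φ.hom.left ≫ (snd Y T).left = (snd M T).left := Over.w φ.hom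
            rw [Category.assoc, h1, ← Over.comp_left, Category.assoc, whiskerRight_snd, hpsnd]
          exact (hps g₁).trans (hps g₂).symm
      have hpα (g : E →ₐ[K] L) : p g ≫ (α ▷ T) ≫ fst M T =
          (p g ≫ fst G T) • (toUnit (specOver C L) ≫ x) := by
        rw [whiskerRight_fst]
        simp [α, ModObj.comp_smul]
      rw [← hpα, ← hpα, reassoc_of% hp12]
    -- The inverse of the first point times the second fixes every rational point of `M`.
    have h1 : (p g₁ ≫ fst G T)⁻¹ * (p g₂ ≫ fst G T) = 1 :=
      eq_one_of_smul_eq (M := M) hG hM hfaith fun x => by rw [mul_smul, ← hx, inv_smul_smul]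
    have h2 : p g₁ = p g₂ := by
      ext1
      · exact inv_mul_eq_one.mp h1
      · rw [hpsnd, hpsnd]
    have h3 : Spec.map (CommRingCat.ofHom g₁.toRingHom) ≫ ε =
        Spec.map (CommRingCat.ofHom g₂.toRingHom) ≫ ε := congrArg (fun t => t.left) h2
    have h4 (s : Γ((extend K G).left, U)) : g₁ (ρ s) = g₂ (ρ s) := by
      have hg (g : E →ₐ[K] L) :
          ⊤ ≤ (Spec.map (CommRingCat.ofHom g.toRingHom) ≫ ε) ⁻¹ᵁ U :=
        fun y _ => pointOfHom_le hU ρ trivial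
      have h5 (g : E →ₐ[K] L) := evalAt_specMap_comp g.toRingHom (pointOfHom_le hU ρ) (hg g) s
      simp only [evalAt_pointOfHom] at h5
      refine (h5 g₁).symm.trans (Eq.trans ?_ (h5 g₂))
      simp only [ε] at h3
      simp only [h3]
    intro e
    -- The embeddings agree on the image of `ρ`, whose fractions fill `E`.
    obtain ⟨r, s, hs, hrs⟩ := hfrac e
    refine mul_left_cancel₀ (b := g₁ e) ((map_ne_zero g₁).mpr hs) ?_
    rw [← map_mul, hrs, h4, h4, ← map_mul, hrs]
  have : CharZero K := charZero_of_injective_algebraMap (algebraMap C K).injective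
  have hbij : Function.Bijective (algebraMap K E) :=
    ⟨(algebraMap K E).injective, fun e => mem_range_of_forall_algHom_eq e fun L _ _ f g => key L f g e⟩
  -- Since `K → E` is bijective, the point and its compatibility with the derivations are
  -- transported to `K`.
  let eqv := RingEquiv.ofBijective (algebraMap K E) hbij
  let ρ' : Γ((extend K G).left, U) →+* K := eqv.symm.toRingHom.comp ρ
  have hρ' (r) : algebraMap K E (ρ' r) = ρ r := eqv.apply_symm_apply (ρ r)
  have hρ'k (k : K) : ρ' (constOn (extend K G) U k) = RingHom.id K k := by
    refine hbij.1 ?_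
    rw [hρ', hρk]
    rfl
  have hd (k : K) : d (algebraMap K E k) = algebraMap K E (Differential.deriv k) := by
    rw [← hρk, hρd, ← hρk]
    congr 1
    exact ((assocDer A.toField).map_res le_top _).trans
      (congrArg (res le_top) (assocDer_const A.toField k))
  have hρ'd (r) : Differential.deriv (ρ' r) = ρ' ((assocDer A.toField).app U r) := by
    refine hbij.1 ?_
    rw [← hd, hρ', hρ', hρd]
  let π := pointOfHom hU ρ'
  have hπ : π ≫ (snd G T).left = 𝟙 (Spec (.of K)) :=
    (pointOfHom_hom (X := extend K G) hU hρ'k).trans (Spec.map_id _)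
  let π' : T ⟶ G ⊗ T := Over.homMk π (by
    rw [← Over.w (snd G T), reassoc_of% hπ])
  refine ⟨π' ≫ fst G T, ?_⟩
  have h1 : kPoint (π' ≫ fst G T) = π := by
    have h2 : lift (π' ≫ fst G T) (𝟙 T) = π' := by
      ext1
      · simp
      · rw [lift_snd]
        exact Over.OverMorphism.ext hπ.symm
    exact congrArg (fun t => t.left) h2
  rw [h1]
  exact isDifferential_of_deriv_evalAt hU (pointOfHom_le hU ρ') fun s => by
    rw [evalAt_pointOfHom, evalAt_pointOfHom, hρ'd]

end Splitting

/-! ### Constants of split differential algebras -/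

section Algebra

variable {C K : Type u} [Field C] [Field K] [Differential K] [Algebra C K] [IsConstantField C K]
  {A B : Type*} [CommRing A] [CommRing B] {a : C →+* A} {q : A →+* B} {b : K →+* B}
  {D : Derivation ℤ B B}

/-- `B` is the extension of scalars of the `C`-algebra `A`, with the derivation for which the
elements of `A` are constants. -/
structure IsConstantExtension (a : C →+* A) (q : A →+* B) (b : K →+* B) (D : Derivation ℤ B B) :
    Prop where
  comm : q.comp a = b.comp (algebraMap C K)
  isPushout : letI := a.toAlgebra
    letI := q.toAlgebra
    letI := b.toAlgebra
    letI := (q.comp a).toAlgebra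
    haveI : IsScalarTower C A B := .of_algebraMap_eq' rfl
    haveI : IsScalarTower C K B := .of_algebraMap_eq' comm
    Algebra.IsPushout C A K B
  deriv : ∀ k, D (b k) = b (Differential.deriv k)
  const : ∀ x, D (q x) = 0

/-- The coordinates of an element of `B` in a basis made of elements of `K`. -/
lemma IsConstantExtension.exists_coordinates (h : IsConstantExtension a q b D) (f : B) :
    ∃ S : Set A, (∀ I : Ideal B, IsDiffIdeal D I → (f ∈ I ↔ ∀ x ∈ S, q x ∈ I)) ∧
      ∀ g : A, f * q g = 0 → ∀ x ∈ S, x * g = 0 := by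
  let := a.toAlgebra
  let := q.toAlgebra
  let := b.toAlgebra
  let := (q.comp a).toAlgebra
  have : IsScalarTower C A B := .of_algebraMap_eq' rfl
  have : IsScalarTower C K B := .of_algebraMap_eq' h.comm
  have := h.isPushout
  obtain ⟨β, hβ⟩ := exists_basis_of_isPushout C A K B
  -- Membership in a differential ideal can be read on the coordinates because such ideals are
  -- extended from `A`.
  refine ⟨Set.range (β.repr f), fun I hI => ?_, fun g hg => ?_⟩
  · have h1 := map_comap_of_isDiffIdeal (C := C) (K := K) (A := A) h.deriv h.const hI
    rw [Set.forall_mem_range]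
    conv_lhs => rw [← h1]
    exact mem_map_iff_repr β _ f
  · rw [Set.forall_mem_range]
    intro i
    have h1 : g • f = 0 := by
      rw [Algebra.smul_def, mul_comm]
      exact hg
    have h2 := DFunLike.congr_fun (congrArg β.repr h1) i
    rw [map_smul, map_zero, Finsupp.smul_apply, smul_eq_mul] at h2
    rw [mul_comm]
    exact h2

omit [IsConstantField C K] in
-- The extension `p.map q` is prime because `C` is algebraically closed, it contracts to `p`, and it
-- is differential because it is generated by constants.
lemma IsConstantExtension.exists_prime [IsAlgClosed C] (h : IsConstantExtension a q b D)
    (ha : a.FiniteType) (p : Ideal A) [p.IsPrime] :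
    ∃ P : Ideal B, P.IsPrime ∧ P.comap q = p ∧ IsDiffIdeal D P := by
  let := a.toAlgebra
  let := q.toAlgebra
  let := b.toAlgebra
  let := (q.comp a).toAlgebra
  have : IsScalarTower C A B := .of_algebraMap_eq' rfl
  have : IsScalarTower C K B := .of_algebraMap_eq' h.comm
  have := h.isPushout
  have : Algebra.FiniteType C A := ha
  refine ⟨p.map q, isPrime_map_of_isPushout C K B p, comap_map_of_isPushout C K B p, ?_⟩
  intro f hf
  refine Submodule.span_induction (p := fun f _ => D f ∈ p.map q) ?_ ?_ ?_ ?_ hf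
  · rintro _ ⟨x, -, rfl⟩
    rw [h.const]
    exact zero_mem _
  · rw [map_zero]
    exact zero_mem _
  · intro x y _ _ hx hy
    rw [map_add]
    exact add_mem hx hy
  · intro c x hx hDx
    rw [smul_eq_mul, Derivation.leibniz, smul_eq_mul, smul_eq_mul]
    exact add_mem (Ideal.mul_mem_left _ _ hDx) (Ideal.mul_mem_right _ _ hx)

/-- The ring `R` stands for a localization of `B`. The image of `B` in it is spanned over `K` by the
constants coming from `A`, so a constant in that image comes from `A`. -/
lemma IsConstantExtension.exists_eq_of_const (h : IsConstantExtension a q b D) {R : Type*}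
    [CommRing R] {r : B →+* R} {D' : Derivation ℤ R R} (hr : ∀ f, D' (r f) = r (D f)) {t : B}
    (ht : D' (r t) = 0) : ∃ x, r t = r (q x) := by
  let := a.toAlgebra
  let := q.toAlgebra
  let := b.toAlgebra
  let := (q.comp a).toAlgebra
  have : IsScalarTower C A B := .of_algebraMap_eq' rfl
  have : IsScalarTower C K B := .of_algebraMap_eq' h.comm
  have := h.isPushout
  let : Algebra B R := r.toAlgebra
  let : Algebra K R := (r.comp b).toAlgebra
  let : Algebra C R := (r.comp (q.comp a)).toAlgebra
  have : IsScalarTower K B R := .of_algebraMap_eq' rfl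
  have : IsScalarTower C B R := .of_algebraMap_eq' rfl
  have : IsScalarTower C K R := .of_algebraMap_eq' (by
    change r.comp (q.comp a) = (r.comp b).comp _
    rw [h.comm]
    rfl)
  have hD : ∀ k, D' (algebraMap K R k) = algebraMap K R (Differential.deriv k) := fun k => by
    change D' (r (b k)) = r (b _)
    rw [hr, h.deriv]
  let φ : B →ₐ[K] R := IsScalarTower.toAlgHom K B R
  let W : Submodule C R := LinearMap.range
    ((IsScalarTower.toAlgHom C B R).comp (IsScalarTower.toAlgHom C A B)).toLinearMap
  have hspan : r t ∈ Submodule.span K (W : Set R) := by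
    have h1 : t ∈ Submodule.span K (Set.range (algebraMap A B)) := by
      rw [span_range_of_isPushout C A K B]
      trivial
    have h2 := Submodule.mem_map_of_mem (f := φ.toLinearMap) h1
    rw [Submodule.map_span, ← Set.range_comp] at h2
    exact h2
  obtain ⟨x, hx⟩ := mem_of_const_of_mem_span (C := C) (D := D'.toLinearMap.toAddMonoidHom)
    (derivation_smul hD) (W := W) (by
      rintro _ ⟨x, rfl⟩
      change D' (r (q x)) = 0
      rw [hr, h.const, map_zero]) hspan ht
  exact ⟨x, hx.symm⟩

end Algebra

/-! ### Differential points and constants of split differential schemes -/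

section Points

lemma exists_affineOpen {Z : Scheme.{u}} (z : Z) : ∃ U : Z.Opens, IsAffineOpen U ∧ z ∈ U := by
  obtain ⟨U, hU, hz, -⟩ := Opens.isBasis_iff_nbhd.mp Z.isBasis_affineOpens
    (show z ∈ (⊤ : Z.Opens) from trivial)
  exact ⟨U, hU, hz⟩

variable {X : Scheme.{u}} {D : SchemeDerivation X}

/-- The ideal of the functions which vanish at a point. -/
noncomputable def pointIdeal {U : X.Opens} {x : X} (hx : x ∈ U) : Ideal Γ(X, U) :=
  (IsLocalRing.maximalIdeal (X.presheaf.stalk x)).comap (X.presheaf.germ U x hx).hom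

lemma mem_pointIdeal {U : X.Opens} {x : X} (hx : x ∈ U) {f : Γ(X, U)} :
    f ∈ pointIdeal hx ↔ x ∉ X.basicOpen f := by
  rw [X.mem_basicOpen f x hx]
  rfl

instance {U : X.Opens} {x : X} (hx : x ∈ U) : (pointIdeal hx).IsPrime :=
  inferInstanceAs (Ideal.comap _ _).IsPrime

lemma isDiffIdeal_pointIdeal {x : X} (h : x ∈ diffPoints D) {U : X.Opens} (hU : IsAffineOpen U)
    (hx : x ∈ U) : IsDiffIdeal (D.app U) (pointIdeal hx) := fun f hf => by
  rw [mem_pointIdeal] at hf ⊢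
  exact h U hU hx f hf

lemma germ_res {U V : X.Opens} (h : V ≤ U) {x : X} (hx : x ∈ V) (f : Γ(X, U)) :
    X.presheaf.germ V x hx (res h f) = X.presheaf.germ U x (h hx) f :=
  X.presheaf.germ_res_apply (homOfLE h) x hx f

/-- A point is differential if its ideal in one affine neighbourhood is differential. -/
lemma mem_diffPoints_of_isDiffIdeal {U : X.Opens} (hU : IsAffineOpen U) {x : X} (hx : x ∈ U)
    (h : IsDiffIdeal (D.app U) (pointIdeal hx)) : x ∈ diffPoints D := by
  intro V hV hxV f hf
  rw [← mem_pointIdeal hxV] at hf ⊢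
  -- On a basic open subset `f` times a power of `b` comes from `U`. As `b` is invertible at `x`,
  -- the Leibniz rule for this product puts the derivative of `f` in the maximal ideal.
  obtain ⟨b, hb, hxb⟩ := hU.exists_basicOpen_le (V := V) ⟨x, hxV⟩ hx
  have := hU.isLocalization_basicOpen b
  obtain ⟨n, g, hg⟩ := IsLocalization.Away.surj b (res hb f)
  replace hg : res hb f * res (X.basicOpen_le b) (b ^ n) = res (X.basicOpen_le b) g := by
    rw [map_pow]
    exact hg
  let γx := (X.presheaf.germ _ x hxb).hom
  let m := IsLocalRing.maximalIdeal (X.presheaf.stalk x)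
  have hfm : γx (res hb f) ∈ m := by
    rw [show γx (res hb f) = _ from germ_res hb hxb f]
    exact hf
  have hgm : g ∈ pointIdeal hx := by
    change X.presheaf.germ U x hx g ∈ m
    rw [← germ_res (X.basicOpen_le b) hxb g, ← hg]
    change γx _ ∈ m
    rw [map_mul]
    exact Ideal.mul_mem_right _ _ hfm
  have hDg : γx (D.app _ (res (X.basicOpen_le b) g)) ∈ m := by
    rw [show D.app _ (res (X.basicOpen_le b) g) = res (X.basicOpen_le b) (D.app U g) from
      D.map_res _ _, show γx (res (X.basicOpen_le b) (D.app U g)) = _ from germ_res _ hxb _]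
    exact h g hgm
  rw [← hg, Derivation.leibniz, smul_eq_mul, smul_eq_mul, map_add, map_mul, map_mul] at hDg
  have h1 := (Ideal.add_mem_iff_right _ (Ideal.mul_mem_right _ _ hfm)).mp hDg
  have h2 : γx (res (X.basicOpen_le b) (b ^ n)) ∉ m := by
    rw [map_pow, map_pow]
    intro h3
    have h4 := Ideal.IsPrime.mem_of_pow_mem inferInstance _ h3
    refine (IsLocalRing.mem_maximalIdeal _).mp h4 ?_
    rw [show γx (res (X.basicOpen_le b) b) = _ from germ_res _ hxb _]
    exact (X.mem_basicOpen b x hx).mp hxb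
  have h3 := (Ideal.IsPrime.mem_or_mem inferInstance h1).resolve_left h2
  change X.presheaf.germ V x hxV (D.app V f) ∈ m
  rw [← germ_res hb hxb, ← show D.app _ (res hb f) = res hb (D.app V f) from D.map_res _ _]
  exact h3

end Points

/-! ### Points and local constants of an extended scheme -/

section Model

variable {C K : Type u} [Field C] [Field K] [Differential K] [Algebra C K] [IsConstantField C K]
  {X : Over (Spec (.of K))} {Z : Over (Spec (.of C))}

/-- The morphism `q` identifies the `K`-scheme `X` with the extension of scalars of the `C`-scheme
`Z`, and the derivation `D` with the canonical derivation. -/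
structure IsConstantModel (D : SchemeDerivation X.left) (q : X.left ⟶ Z.left) : Prop where
  isPullback : IsPullback q X.hom Z.hom (Spec.map (CommRingCat.ofHom (algebraMap C K)))
  const : ∀ (O : Z.left.Opens) (s : Γ(Z.left, O)), D.app _ (q.app O s) = 0
  deriv : ∀ k, D.app ⊤ (constHom X k) = constHom X (Differential.deriv k)
  locallyOfFiniteType : LocallyOfFiniteType Z.hom

namespace IsConstantModel

variable {D : SchemeDerivation X.left} {q : X.left ⟶ Z.left} (h : IsConstantModel D q)

include h

omit [IsConstantField C K] in
lemma isAffineOpen {U : Z.left.Opens} (hU : IsAffineOpen U) : IsAffineOpen (q ⁻¹ᵁ U) := by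
  have : IsAffineHom q := MorphismProperty.of_isPullback (P := @IsAffineHom) h.isPullback.flip
    inferInstance
  exact hU.preimage q

omit [IsConstantField C K] in
lemma isConstantExtension {U : Z.left.Opens} (hU : IsAffineOpen U) :
    IsConstantExtension (constOn Z U) (q.app U).hom (constOn X (q ⁻¹ᵁ U)) (D.app (q ⁻¹ᵁ U)) := by
  have h0 := (isIso_pushoutSection_iff h.isPullback (US := ⊤) (UX := U) (UT := ⊤) (UY := q ⁻¹ᵁ U)
    le_top le_top (by simp)).mp
    (isIso_pushoutSection_of_isAffineOpen _ _ _ _ (isAffineOpen_top (Spec (.of C)))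
      (isAffineOpen_top (Spec (.of K))) hU)
  have h1 : IsPushout (CommRingCat.ofHom (constOn Z U)) (CommRingCat.ofHom (algebraMap C K))
      (q.app U) (CommRingCat.ofHom (constOn X (q ⁻¹ᵁ U))) := by
    refine h0.of_iso (Scheme.ΓSpecIso (.of C)) (Iso.refl _) (Scheme.ΓSpecIso (.of K)) (Iso.refl _)
      ?_ ?_ ?_ ?_
    · refine (Category.comp_id _).trans ?_
      rw [← Iso.inv_comp_eq]
      rfl
    · have := appLE_specMap (CommRingCat.ofHom (algebraMap C K)) le_top
      rw [← Iso.inv_comp_eq]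
      exact this
    · rw [Scheme.Hom.app_eq_appLE]
      exact (Category.comp_id _).trans (Category.id_comp _).symm
    · refine (Category.comp_id _).trans ?_
      rw [← Iso.inv_comp_eq]
      rfl
  have hcomm : (q.app U).hom.comp (constOn Z U) =
      (constOn X (q ⁻¹ᵁ U)).comp (algebraMap C K) := by
    have := congrArg (fun t => t.hom) h1.w
    exact this
  refine ⟨hcomm, ?_, fun k => ?_, h.const U⟩
  · let := (constOn Z U).toAlgebra
    let := (q.app U).hom.toAlgebra
    let := (constOn X (q ⁻¹ᵁ U)).toAlgebra
    let := ((q.app U).hom.comp (constOn Z U)).toAlgebra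
    have : IsScalarTower C Γ(Z.left, U) Γ(X.left, q ⁻¹ᵁ U) := .of_algebraMap_eq' rfl
    have : IsScalarTower C K Γ(X.left, q ⁻¹ᵁ U) := .of_algebraMap_eq' hcomm
    exact CommRingCat.isPushout_iff_isPushout.mp h1
  · exact (D.map_res le_top (constHom X k)).trans (congrArg (res le_top) (h.deriv k))

omit [Differential K] [Algebra C K] [IsConstantField C K] h in
lemma app_mem_pointIdeal {U : Z.left.Opens} {x : X.left} (hx : x ∈ q ⁻¹ᵁ U) {a : Γ(Z.left, U)} :
    q.app U a ∈ pointIdeal hx ↔ q x ∉ Z.left.basicOpen a := by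
  rw [mem_pointIdeal, ← Scheme.preimage_basicOpen]
  rfl

omit [IsConstantField C K] in
/-- Every point of `Z` is the image of a differential point. -/
lemma exists_diffPoint [IsAlgClosed C] (z : Z.left) : ∃ x ∈ diffPoints D, q x = z := by
  obtain ⟨U, hU, hz⟩ := exists_affineOpen z
  have hW := h.isAffineOpen hU
  have hfin : (constOn Z U).FiniteType := by
    have := h.locallyOfFiniteType
    have h1 := Scheme.Hom.finiteType_appLE Z.hom (isAffineOpen_top (Spec (.of C))) hU le_top
    exact h1.comp (RingHom.FiniteType.of_surjective _
      (ConcreteCategory.bijective_of_isIso (Scheme.ΓSpecIso (.of C)).inv).2)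
  obtain ⟨P, hP, hPz, hPD⟩ := (h.isConstantExtension hU).exists_prime hfin (pointIdeal hz)
  let x : X.left := hW.fromSpec ⟨P, hP⟩
  have hmem (f : Γ(X.left, q ⁻¹ᵁ U)) : x ∈ X.left.basicOpen f ↔ f ∉ P := by
    have := hW.fromSpec_preimage_basicOpen f
    change (⟨P, hP⟩ : PrimeSpectrum _) ∈ hW.fromSpec ⁻¹ᵁ X.left.basicOpen f ↔ _
    rw [this]
    rfl
  have hxW : x ∈ q ⁻¹ᵁ U := X.left.basicOpen_le (1 : Γ(X.left, q ⁻¹ᵁ U)) ((hmem 1).mpr fun h1 =>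
    hP.ne_top ((Ideal.eq_top_iff_one _).mpr h1))
  have hPx : pointIdeal hxW = P := by
    ext f
    rw [mem_pointIdeal, hmem, not_not]
  refine ⟨x, mem_diffPoints_of_isDiffIdeal hW hxW (hPx ▸ hPD), ?_⟩
  -- The ideal of `x` contracts to that of `z`, so `q x` and `z` lie in the same basic open subsets
  -- of `U`; they are inseparable, hence equal.
  have key (a : Γ(Z.left, U)) : q x ∈ Z.left.basicOpen a ↔ z ∈ Z.left.basicOpen a := by
    rw [← not_iff_not, ← app_mem_pointIdeal hxW, hPx, ← mem_pointIdeal hz, ← hPz]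
    rfl
  have hqx : q x ∈ U := hxW
  refine Inseparable.eq (inseparable_iff_forall_isOpen.mpr fun O hO => ⟨fun hx => ?_, fun hx => ?_⟩)
  · obtain ⟨a, ha, hxa⟩ := hU.exists_basicOpen_le (V := ⟨O, hO⟩) ⟨q x, hx⟩ hqx
    exact ha ((key a).mp hxa)
  · obtain ⟨a, ha, hxa⟩ := hU.exists_basicOpen_le (V := ⟨O, hO⟩) ⟨z, hx⟩ hz
    exact ha ((key a).mpr hxa)

/-- The differential points have a basis of neighbourhoods made of inverse images of open subsets of
`Z`. -/
lemma exists_open {x : X.left} (hx : x ∈ diffPoints D) {V : X.left.Opens} (hxV : x ∈ V) :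
    ∃ O : Z.left.Opens, q x ∈ O ∧ ∀ y ∈ diffPoints D, q y ∈ O → y ∈ V := by
  obtain ⟨U, hU, hz⟩ := exists_affineOpen (q x)
  replace hz : x ∈ q ⁻¹ᵁ U := hz
  have hW := h.isAffineOpen hU
  obtain ⟨b, hb, hxb⟩ := hW.exists_basicOpen_le (V := V) ⟨x, hxV⟩ hz
  -- At a differential point `b` is nonzero exactly when one of its coordinates, which are functions
  -- on `Z`, is nonzero.
  obtain ⟨S, hS, -⟩ := (h.isConstantExtension hU).exists_coordinates b
  have h1 := hS _ (isDiffIdeal_pointIdeal hx hW hz)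
  rw [mem_pointIdeal] at h1
  have h2 : ¬ ∀ a ∈ S, q.app U a ∈ pointIdeal hz := fun h3 => h1.mpr h3 hxb
  push Not at h2
  obtain ⟨a, haS, ha⟩ := h2
  rw [app_mem_pointIdeal hz, not_not] at ha
  refine ⟨Z.left.basicOpen a, ha, fun y hy hya => hb ?_⟩
  have hyU : y ∈ q ⁻¹ᵁ U := Z.left.basicOpen_le a hya
  have h4 := hS _ (isDiffIdeal_pointIdeal hy hW hyU)
  rw [mem_pointIdeal] at h4
  by_contra h5
  exact (app_mem_pointIdeal hyU).mp (h4.mp h5 a haS) hya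

/-- By `exists_open`, the image of a differential point determines which open subsets contain it,
and schemes are T0. -/
lemma injOn : Set.InjOn q (diffPoints D) := fun x hx y hy hxy =>
  Inseparable.eq (inseparable_iff_forall_isOpen.mpr fun V hV => ⟨fun hxV => by
    obtain ⟨O, hO, h1⟩ := h.exists_open hx (V := ⟨V, hV⟩) hxV
    exact h1 y hy (hxy ▸ hO), fun hyV => by
    obtain ⟨O, hO, h1⟩ := h.exists_open hy (V := ⟨V, hV⟩) hyV
    exact h1 x hx (hxy ▸ hO)⟩)

/-- The constant functions are locally pulled back from `Z`. -/
lemma exists_section {x : X.left} (hx : x ∈ diffPoints D) {V : X.left.Opens} (hxV : x ∈ V)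
    {f : Γ(X.left, V)} (hf : D.app V f = 0) :
    ∃ (O : Z.left.Opens) (g : Γ(Z.left, O)), q x ∈ O ∧ ∀ y ∈ diffPoints D, ∀ hy : q y ∈ O,
      ∃ hyV : y ∈ V, X.left.presheaf.germ V y hyV f =
        q.stalkMap y (Z.left.presheaf.germ O (q y) hy g) := by
  obtain ⟨U, hU, hz⟩ := exists_affineOpen (q x)
  replace hz : x ∈ q ⁻¹ᵁ U := hz
  have hW := h.isAffineOpen hU
  have hext := h.isConstantExtension hU
  obtain ⟨b, hb, hxb⟩ := hW.exists_basicOpen_le (V := V) ⟨x, hxV⟩ hz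
  let r := res (X.left.basicOpen_le b)
  let F := res hb f
  let D' := D.app (X.left.basicOpen b)
  have hr (s) : D' (r s) = r (D.app _ s) := D.map_res _ s
  have hF : D' F = 0 := (D.map_res hb f).trans (by rw [hf, map_zero])
  -- The denominators of `F` form an ideal, which is differential because `F` is constant.
  let I : Ideal Γ(X.left, q ⁻¹ᵁ U) :=
    { carrier := {s | ∃ t, r s * F = r t}
      add_mem' := by
        rintro s s' ⟨t, ht⟩ ⟨t', ht'⟩
        exact ⟨t + t', by rw [map_add, add_mul, ht, ht', map_add]⟩
      zero_mem' := ⟨0, by rw [map_zero, zero_mul]⟩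
      smul_mem' := by
        rintro c s ⟨t, ht⟩
        exact ⟨c * t, by rw [smul_eq_mul, map_mul, mul_assoc, ht, map_mul]⟩ }
  have hI : IsDiffIdeal (D.app _) I := by
    rintro s ⟨t, ht⟩
    refine ⟨D.app _ t, ?_⟩
    rw [← hr, ← hr, ← ht, Derivation.leibniz, hF, smul_zero, zero_add, smul_eq_mul, mul_comm]
  have := hW.isLocalization_basicOpen b
  obtain ⟨n, g, hg⟩ := IsLocalization.Away.surj b F
  have hbI : b ^ n ∈ I := ⟨g, by
    rw [map_pow, mul_comm]
    exact hg⟩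
  -- A power of `b` is a denominator, hence so are its coordinates; one of them, a function `a` on
  -- `Z`, does not vanish at `q x`.
  obtain ⟨S, hS, -⟩ := hext.exists_coordinates (b ^ n)
  have h1 := hS _ (isDiffIdeal_pointIdeal hx hW hz)
  have h2 : b ^ n ∉ pointIdeal hz := fun h3 => by
    have h4 := Ideal.IsPrime.mem_of_pow_mem inferInstance _ h3
    rw [mem_pointIdeal] at h4
    exact h4 hxb
  rw [h1] at h2
  push Not at h2
  obtain ⟨a, haS, ha⟩ := h2
  rw [show (q.app U).hom a = q.app U a from rfl, app_mem_pointIdeal hz, not_not] at ha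
  obtain ⟨t, ht⟩ : (q.app U).hom a ∈ I := (hS I hI).mp hbI a haS
  -- The numerator `a F` is constant on `D(b)`, hence is pulled back from a function `a₁` on `Z`;
  -- the section looked for is `a₁ / a`.
  obtain ⟨a₁, ha₁⟩ := hext.exists_eq_of_const (r := r) (D' := D') hr (t := t) (by
    rw [← ht, Derivation.leibniz, hF, hr, hext.const, map_zero, smul_zero, smul_zero, add_zero])
  -- The differential points above `O` lie in `D(b)`, where `a F = a₁` holds.
  obtain ⟨O, hO, hOb⟩ := h.exists_open hx hxb
  have hua : IsUnit (res (Z.left.basicOpen_le a) a) :=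
    RingedSpace.isUnit_res_basicOpen _ a
  obtain ⟨u, hu⟩ := hua.exists_left_inv
  let g₁ := u * res (Z.left.basicOpen_le a) a₁
  have hg₁ : res (Z.left.basicOpen_le a) a * g₁ = res (Z.left.basicOpen_le a) a₁ := by
    rw [← mul_assoc, mul_comm _ u, hu, one_mul]
  refine ⟨Z.left.basicOpen a ⊓ O, res inf_le_left g₁, ⟨ha, hO⟩, fun y hy hyO => ?_⟩
  have hyb := hOb y hy hyO.2
  refine ⟨hb hyb, ?_⟩
  have hyU : q y ∈ U := Z.left.basicOpen_le a hyO.1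
  rw [germ_res inf_le_left hyO]
  have hgerm (c : Γ(Z.left, U)) : X.left.presheaf.germ _ y hyb (r (q.app U c)) =
      q.stalkMap y (Z.left.presheaf.germ U (q y) hyU c) := by
    rw [Scheme.Hom.germ_stalkMap_apply]
    exact germ_res _ _ _
  have hunit : IsUnit (q.stalkMap y (Z.left.presheaf.germ U (q y) hyU a)) :=
    ((Z.left.mem_basicOpen a (q y) hyU).mp hyO.1).map (q.stalkMap y).hom
  refine hunit.mul_left_cancel ?_
  have e1 : q.stalkMap y (Z.left.presheaf.germ U (q y) hyU a) *
      X.left.presheaf.germ V y (hb hyb) f = q.stalkMap y (Z.left.presheaf.germ U (q y) hyU a₁) := by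
    rw [← hgerm, ← hgerm, ← germ_res hb hyb f, ← map_mul]
    exact congrArg _ (ht.trans ha₁)
  have e2 : q.stalkMap y (Z.left.presheaf.germ U (q y) hyU a) *
      q.stalkMap y (Z.left.presheaf.germ _ (q y) hyO.1 g₁) =
        q.stalkMap y (Z.left.presheaf.germ U (q y) hyU a₁) := by
    rw [← map_mul, ← germ_res (Z.left.basicOpen_le a) hyO.1 a, ← map_mul, hg₁, germ_res]
  exact e1.trans e2.symm

/-- The stalk maps of `q` at the differential points are injective. -/
lemma germ_injective {x : X.left} (hx : x ∈ diffPoints D) :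
    Function.Injective (q.stalkMap x) := by
  refine (injective_iff_map_eq_zero (q.stalkMap x).hom).mpr fun t ht => ?_
  obtain ⟨V, hzV, g₀, rfl⟩ := Z.left.presheaf.exists_germ_eq t
  obtain ⟨U, hU, hz, hUV⟩ := Opens.isBasis_iff_nbhd.mp Z.left.isBasis_affineOpens hzV
  have hW := h.isAffineOpen hU
  rw [← germ_res hUV hz] at ht ⊢
  set g := res hUV g₀
  replace hz : x ∈ q ⁻¹ᵁ U := hz
  replace ht : X.left.presheaf.germ (q ⁻¹ᵁ U) x hz (q.app U g) =
      X.left.presheaf.germ (q ⁻¹ᵁ U) x hz 0 := by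
    rw [map_zero]
    exact (Scheme.Hom.germ_stalkMap_apply q U x hz g).symm.trans ht
  obtain ⟨W, hxW, i₁, i₂, hres⟩ := X.left.presheaf.germ_eq x hz hz _ _ ht
  obtain ⟨b, hb, hxb⟩ := hW.exists_basicOpen_le (V := W) ⟨x, hxW⟩ hz
  have := hW.isLocalization_basicOpen b
  have hres' : res (X.left.basicOpen_le b) (q.app U g) = res (X.left.basicOpen_le b) 0 := by
    have := congrArg (res hb) hres
    exact (res_res i₁.le hb _).symm.trans (this.trans (res_res i₂.le hb _))
  obtain ⟨n, hn⟩ := IsLocalization.Away.exists_of_eq (S := Γ(X.left, X.left.basicOpen b)) b hres'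
  rw [mul_zero] at hn
  -- `b ^ n` kills the pullback of `g`, so each of its coordinates kills `g`; one of them is
  -- invertible at `q x`.
  obtain ⟨S, hS, hS'⟩ := (h.isConstantExtension hU).exists_coordinates (b ^ n)
  have h1 := hS _ (isDiffIdeal_pointIdeal hx hW hz)
  have h2 : b ^ n ∉ pointIdeal hz := fun h3 => by
    have h4 := Ideal.IsPrime.mem_of_pow_mem inferInstance _ h3
    rw [mem_pointIdeal] at h4
    exact h4 hxb
  rw [h1] at h2
  push Not at h2
  obtain ⟨a, haS, ha⟩ := h2
  rw [show (q.app U).hom a = q.app U a from rfl, app_mem_pointIdeal hz, not_not] at ha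
  have h3 := congrArg (Z.left.presheaf.germ U (q x) hz) (hS' g hn a haS)
  rw [map_mul, map_zero] at h3
  exact ((Z.left.mem_basicOpen a (q x) hz).mp ha).mul_right_eq_zero.mp h3

end IsConstantModel

end Model

/-! ### The space of constants of an extended scheme -/

namespace IsConstantModel

variable {C K : Type u} [Field C] [Field K] [Differential K] [Algebra C K] [IsConstantField C K]
  {X : Over (Spec (.of K))} {Z : Over (Spec (.of C))} {D : SchemeDerivation X.left}
  {q : X.left ⟶ Z.left} (h : IsConstantModel D q)

include h

omit [IsConstantField C K] in
lemma app_constHom (c : C) : q.app ⊤ (constHom Z c) = constHom X (algebraMap C K c) := by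
  have h1 := congrArg (fun t => Scheme.Hom.appTop t) h.isPullback.w
  have h2 := Scheme.ΓSpecIso_inv_naturality (CommRingCat.ofHom (algebraMap C K))
  have h3 := congrArg (fun t => t.hom ((Scheme.ΓSpecIso (.of C)).inv c)) h1
  refine h3.trans ?_
  have h4 := congrArg (fun t => Scheme.Hom.appTop (X := X.left) (Y := Spec (.of K)) X.hom (t.hom c)) h2
  exact h4.symm

variable [IsAlgClosed C]

/-- The homeomorphism of the differential points with the points of `Z`. -/
noncomputable def homeomorph : diffPoints D ≃ₜ Z.left :=
  (Equiv.ofBijective (fun x : diffPoints D => q x.1)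
    ⟨fun x y hxy => Subtype.ext (h.injOn x.2 y.2 hxy), fun z => by
      obtain ⟨x, hx, hxz⟩ := h.exists_diffPoint z
      exact ⟨⟨x, hx⟩, hxz⟩⟩).toHomeomorphOfContinuousOpen
    (q.continuous.comp continuous_subtype_val) (by
      rintro _ ⟨V, hV, rfl⟩
      refine isOpen_iff_forall_mem_open.mpr ?_
      rintro _ ⟨x, hx, rfl⟩
      obtain ⟨O, hO, h1⟩ := h.exists_open x.2 (V := ⟨V, hV⟩) hx
      refine ⟨O, fun z hz => ?_, O.2, hO⟩
      obtain ⟨y, hy, rfl⟩ := h.exists_diffPoint z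
      exact ⟨⟨y, hy⟩, h1 y hy hz, rfl⟩)

/-- The homeomorphism of the space of constants with `Z`. -/
noncomputable def baseIso : constSpace D ≅ Z.left.carrier :=
  TopCat.isoOfHomeo h.homeomorph

/-- The pull-back of functions from `Z` to constant functions. -/
noncomputable def sectionHom (O : Opens Z.left) :
    Γ(Z.left, O) →+* constSections D ((Opens.map h.baseIso.hom).obj O) where
  toFun g := ⟨fun y => q.stalkMap y.1.1 (Z.left.presheaf.germ O (q y.1.1) y.2 g), fun y =>
    ⟨_, y.2, 𝟙 _, q ⁻¹ᵁ O, q.app O g, h.const O g, fun y =>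
      ⟨y.2, Scheme.Hom.germ_stalkMap_apply q O y.1.1 y.2 g⟩⟩⟩
  map_one' := Subtype.ext (funext fun y => by simp)
  map_zero' := Subtype.ext (funext fun y => by simp)
  map_mul' a b := Subtype.ext (funext fun y => by simp)
  map_add' a b := Subtype.ext (funext fun y => by simp)

lemma sectionHom_injective (O : Opens Z.left) : Function.Injective (h.sectionHom O) := by
  intro g g' hg
  refine TopCat.Presheaf.section_ext Z.left.sheaf O _ _ fun z hz => ?_
  obtain ⟨x, hx, rfl⟩ := h.exists_diffPoint z
  have h1 := congrFun (congrArg Subtype.val hg) ⟨⟨x, hx⟩, hz⟩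
  exact h.germ_injective hx h1

/-- A constant section is locally pulled back from `Z` by `exists_section`. Injectivity of the stalk
maps makes the local functions agree on overlaps, so they glue. -/
lemma sectionHom_surjective (O : Opens Z.left) : Function.Surjective (h.sectionHom O) := by
  intro s
  have key (y : diffPoints D) (hy : q y.1 ∈ O) : ∃ (V : Opens Z.left) (_ : V ≤ O) (g : Γ(Z.left, V)),
      q y.1 ∈ V ∧ ∀ (x : diffPoints D) (hx : q x.1 ∈ V) (hx' : q x.1 ∈ O),
        s.1 ⟨x, hx'⟩ = q.stalkMap x.1 (Z.left.presheaf.germ V (q x.1) hx g) := by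
    obtain ⟨V, hyV, i, U, f, hf, hs⟩ := s.2 ⟨y, hy⟩
    obtain ⟨W, g, hyW, hg⟩ := h.exists_section y.2 (hs ⟨y, hyV⟩).1 hf
    obtain ⟨V', hV', hVV'⟩ := V.2
    obtain ⟨W', hyW', hW'⟩ := h.exists_open y.2 (V := ⟨V', hV'⟩) (by
      change y ∈ Subtype.val ⁻¹' V'
      rw [hVV']
      exact hyV)
    -- Above `W'` the differential points stay in `V`, where `s` is given by `f`; above `W` the
    -- germs of `f` come from `g`.
    refine ⟨W ⊓ W' ⊓ O, inf_le_right, res (inf_le_left.trans inf_le_left) g, ⟨⟨hyW, hyW'⟩, hy⟩,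
      fun x hx hx' => ?_⟩
    have hxV : x ∈ V := by
      have : x ∈ Subtype.val ⁻¹' V' := hW' x.1 x.2 hx.1.2
      rw [hVV'] at this
      exact this
    obtain ⟨hxU, h1⟩ := hs ⟨x, hxV⟩
    obtain ⟨hxU', h2⟩ := hg x.1 x.2 hx.1.1
    rw [germ_res (inf_le_left.trans inf_le_left) hx]
    exact h1.trans h2
  choose V hV g hyV hg using key
  have hglue {V V' : Opens Z.left} {g : Γ(Z.left, V)} {g' : Γ(Z.left, V')} {x : diffPoints D}
      (hx : q x.1 ∈ V) (hx' : q x.1 ∈ V')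
      (e : q.stalkMap x.1 (Z.left.presheaf.germ V _ hx g) =
        q.stalkMap x.1 (Z.left.presheaf.germ V' _ hx' g')) :
      Z.left.presheaf.germ V _ hx g = Z.left.presheaf.germ V' _ hx' g' := h.germ_injective x.2 e
  obtain ⟨t, ht, -⟩ := TopCat.Sheaf.existsUnique_gluing' Z.left.sheaf
    (fun y : {y : diffPoints D // q y.1 ∈ O} => V y.1 y.2) O (fun y => homOfLE (hV y.1 y.2))
    (fun z hz => by
      obtain ⟨x, hx, rfl⟩ := h.exists_diffPoint z
      exact Opens.mem_iSup.mpr ⟨⟨⟨x, hx⟩, hz⟩, hyV ⟨x, hx⟩ hz⟩)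
    (fun y => g y.1 y.2) (fun y y' => by
      refine TopCat.Presheaf.section_ext Z.left.sheaf _ _ _ fun z hz => ?_
      obtain ⟨x, hx, rfl⟩ := h.exists_diffPoint z
      have h1 := hglue (x := ⟨x, hx⟩) hz.1 hz.2 ((hg y.1 y.2 ⟨x, hx⟩ hz.1 (hV _ _ hz.1)).symm.trans
        (hg y'.1 y'.2 ⟨x, hx⟩ hz.2 (hV _ _ hz.1)))
      exact (germ_res inf_le_left hz _).trans (h1.trans (germ_res inf_le_right hz _).symm))
  refine ⟨t, Subtype.ext (funext fun y => ?_)⟩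
  have hy : q y.1.1 ∈ O := y.2
  have h1 := hg y.1 hy y.1 (hyV y.1 hy) hy
  have h2 : res (hV y.1 hy) t = g y.1 hy := ht ⟨y.1, hy⟩
  have h3 := germ_res (hV y.1 hy) (hyV y.1 hy) t
  rw [h2] at h3
  exact (h1.trans (congrArg (q.stalkMap y.1.1) h3)).symm

/-- The comparison of the structure sheaf of `Z` with the sheaf of constant functions. -/
noncomputable def sheafHom :
    Z.left.presheaf ⟶ (TopCat.Presheaf.pushforward _ h.baseIso.hom).obj (constPresheaf D) :=
  NatTrans.mk (fun U : (Opens Z.left)ᵒᵖ => CommRingCat.ofHom (h.sectionHom U.unop))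
    (fun U V i => by
      refine CommRingCat.hom_ext (RingHom.ext fun g => Subtype.ext (funext fun y => ?_))
      exact congrArg (q.stalkMap y.1.1) (Z.left.presheaf.germ_res_apply i.unop _ y.2 g))

lemma isIso_sheafHom : IsIso h.sheafHom := by
  have (U : (Opens Z.left)ᵒᵖ) : IsIso (h.sheafHom.app U) :=
    (ConcreteCategory.isIso_iff_bijective _).mpr
      ⟨h.sectionHom_injective U.unop, h.sectionHom_surjective U.unop⟩
  exact NatIso.isIso_of_isIso_app _

/-- The space of constants is isomorphic to `Z`. -/
noncomputable def constIso : Const D ≅ Z.left.toSheafedSpace :=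
  SheafedSpace.isoMk (PresheafedSpace.isoOfComponents h.baseIso (haveI := h.isIso_sheafHom; (asIso h.sheafHom).symm))

theorem isAlmostConstant : IsAlmostConstant D := ⟨Z.left, ⟨h.constIso⟩⟩

theorem nonempty_constIso : ConstIso D Z := by
  refine ⟨h.constIso, fun c x => ?_⟩
  have h1 : q.stalkMap x.1 (Z.left.presheaf.germ ⊤ (q x.1) trivial (constHom Z c)) =
      X.left.presheaf.germ ⊤ x.1 trivial (constHom X (algebraMap C K c)) := by
    refine (Scheme.Hom.germ_stalkMap_apply q ⊤ x.1 trivial (constHom Z c)).trans ?_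
    rw [h.app_constHom]
    rfl
  exact h1

end IsConstantModel

/-! ### Systems with a solution -/

section Solution

variable {C K : Type u} [Field C] [Field K] [Differential K]
  [Algebra C K] [IsConstantField C K] {G M : Over (Spec (.of C))} [GrpObj G] [ModObj G M]
  {b : rightInvariant G →ₗ[C] VectorField M}

lemma isDifferential_actOver_inv
    (hb : ∀ a : rightInvariant G,
      IsDifferential (prodDer a.1 (0 : VectorField M)) (b a).1 (act G M).left)
    {A : AutomorphicField C K G} {σ : specOver C K ⟶ G}
    (hσ : IsDifferential (specDerivation (.of K) Differential.deriv) (assocDer A.toField) (kPoint σ)) :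
    IsDifferential (assocDer (b.rTensor K A)) (canonicalDer K M) (actOver M σ⁻¹).left := by
  refine (isDifferential_actOver b hb A hσ).inv ?_ ?_
  · exact congrArg CommaMorphism.left (actIso M σ).hom_inv_id
  · exact congrArg CommaMorphism.left (actIso M σ).inv_hom_id

/-- A system whose associated automorphic equation has a solution splits. -/
theorem splits_of_solution
    (hb : ∀ a : rightInvariant G,
      IsDifferential (prodDer a.1 (0 : VectorField M)) (b a).1 (act G M).left)
    {A : AutomorphicField C K G} {σ : specOver C K ⟶ G}
    (hσ : IsDifferential (specDerivation (.of K) Differential.deriv) (assocDer A.toField) (kPoint σ)) :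
    Splits C (extend K M) (assocDer (b.rTensor K A)) :=
  ⟨M, (actIso M σ).symm, isDifferential_actOver_inv hb hσ⟩

omit [Differential K] [IsConstantField C K] in
lemma isPullback_extend (M : Over (Spec (.of C))) :
    IsPullback (fst M (specOver C K)).left (extend K M).hom M.hom
      (Spec.map (CommRingCat.ofHom (algebraMap C K))) :=
  IsPullback.of_hasPullback M.hom (specOver C K).hom

/-- A system whose associated automorphic equation has a solution is an extension of scalars of its
space of constants. -/
theorem isConstantModel_of_solution (hM : IsVariety M)
    (hb : ∀ a : rightInvariant G,
      IsDifferential (prodDer a.1 (0 : VectorField M)) (b a).1 (act G M).left)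
    {A : AutomorphicField C K G} {σ : specOver C K ⟶ G}
    (hσ : IsDifferential (specDerivation (.of K) Differential.deriv) (assocDer A.toField) (kPoint σ)) :
    IsConstantModel (X := extend K M) (Z := M) (assocDer (b.rTensor K A))
      ((actIso M σ).inv.left ≫ (fst M (specOver C K)).left) where
  isPullback := (isPullback_extend M).of_iso ((Over.forget _).mapIso (actIso M σ)) (.refl _) (.refl _)
    (.refl _) (by
      change _ ≫ 𝟙 _ = (actIso M σ).hom.left ≫ (actIso M σ).inv.left ≫ _
      rw [Over.hom_left_inv_left_assoc, Category.comp_id]) (by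
      change _ ≫ 𝟙 _ = (actIso M σ).hom.left ≫ _
      rw [Over.w, Category.comp_id]) (by simp) (by simp)
  const O s := ((isDifferential_actOver_inv hb hσ).comp
    (prodDer_fst (0 : VectorField M) (baseDer C K)) O s).trans (map_zero _)
  deriv := assocDer_const _
  locallyOfFiniteType := hM.locallyOfFiniteType

/-- Left translation by `g` sends the identity to `g`. -/
lemma isFaithful_regular : let := ModObj.regular G; IsFaithful G G := by
  intro _ g hg
  have h := hg η[G]
  change lift g η[G] ≫ μ[G] = η[G] at h
  rw [← h]
  have := mul_one g
  rw [Hom.mul_def, Hom.one_def] at this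
  simpa using this.symm

omit [Differential K] [IsConstantField C K] in
/-- The linear extension of `A ↦ A^M` maps an automorphic field to the associated
Lie–Vessiot field. -/
lemma toField_toLieVessiot (A : AutomorphicField C K G) :
    (AutomorphicField.toLieVessiot C K G M A).toField = (fundamentalField G M).rTensor K A := by
  change (fundamentalFields G M).subtype.rTensor K ((fundamentalField G M).rangeRestrict.rTensor K A) = _
  exact (LinearMap.rTensor_comp_apply K (LinearMap.range (fundamentalField G M)).subtype
    (fundamentalField G M).rangeRestrict A).symm

omit [Differential K] [IsConstantField C K] in
lemma toField_zero : (0 : AutomorphicField C K G).toField = 0 := map_zero _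

/-- The fundamental fields of the action of `G` on itself by left translations are the right
invariant fields. -/
lemma isDifferential_act_regular [IsAlgClosed C] (hG : IsVariety G) (a : rightInvariant G) :
    let := ModObj.regular G
    IsDifferential (prodDer a.1 (0 : VectorField G)) ((rightInvariant G).subtype a).1
      (act G G).left :=
  isDifferential_mul hG a.2

variable [IsAlgClosed C] {A : AutomorphicField C K G} {σ : specOver C K ⟶ G}

/-- Left translation by `σ` carries the canonical derivation to `∂_A`, so the gauge transformation
is that of `σ⁻¹`. -/
theorem exists_gauge_of_solution (hG : IsVariety G)
    (hσ : IsDifferential (specDerivation (.of K) Differential.deriv) (assocDer A.toField)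
      (kPoint σ)) :
    ∃ τ : specOver C K ⟶ G, IsDifferential (assocDer A.toField) (canonicalDer K G)
      (gauge τ).left :=
  let := ModObj.regular G
  ⟨σ⁻¹, isDifferential_actOver_inv (b := (rightInvariant G).subtype)
    (isDifferential_act_regular hG) hσ⟩

omit [IsAlgClosed C] in
-- Left translation is the isomorphism `actIso` of the regular action, so `G` itself serves as the
-- `C`-scheme.
theorem splits_of_gauge
    (h : IsDifferential (assocDer A.toField) (canonicalDer K G) (gauge σ).left) :
    Splits C (extend K G) (assocDer A.toField) :=
  let := ModObj.regular G
  ⟨G, actIso G σ, h⟩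

/-- The automorphic system is the system of the regular action, which is faithful, so the argument
for `M` applies to `G`. -/
theorem exists_solution_of_splits [CharZero C] (hG : IsVariety G)
    (h : Splits C (extend K G) (assocDer A.toField)) :
    ∃ σ : specOver C K ⟶ G, IsDifferential (specDerivation (.of K) Differential.deriv)
      (assocDer A.toField) (kPoint σ) :=
  let := ModObj.regular G
  exists_differential_kPoint hG hG isFaithful_regular (rightInvariant G).subtype
    (isDifferential_act_regular hG) A h

theorem isConstantModel_regular_of_solution (hG : IsVariety G)
    (hσ : IsDifferential (specDerivation (.of K) Differential.deriv) (assocDer A.toField)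
      (kPoint σ)) :
    ∃ q : (extend K G).left ⟶ G.left,
      IsConstantModel (X := extend K G) (Z := G) (assocDer A.toField) q :=
  let := ModObj.regular G
  ⟨_, isConstantModel_of_solution hG (b := (rightInvariant G).subtype)
    (isDifferential_act_regular hG) hσ⟩

end Solution

end LieVessiot

/-! ### The equivalences -/

theorem theorem4p17 {C K : Type u} [Field C] [IsAlgClosed C] [CharZero C] [Field K] [Differential K]
    [Algebra C K] [LieVessiot.IsConstantField C K]
    (G M : Over (Spec (CommRingCat.of C))) [GrpObj G] [ModObj G M]
    (hG : LieVessiot.IsVariety G) (hM : LieVessiot.IsVariety M)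
    (hhom : LieVessiot.IsHomogeneous G M) (hfaith : LieVessiot.IsFaithful G M)
    (X : LieVessiot.LieVessiotField C K G M) (A : LieVessiot.AutomorphicField C K G)
    (hA : LieVessiot.AutomorphicField.toLieVessiot C K G M A = X) :
    [ -- the automorphic equation has a solution in `G(K)`
      ∃ σ : LieVessiot.specOver C K ⟶ G, LieVessiot.IsAutomorphicSolution A.toField σ,
      -- the automorphic system splits
      LieVessiot.Splits C (LieVessiot.extend K G) (LieVessiot.assocDer A.toField),
      -- a gauge transformation sends `A` to `0`
      ∃ σ : LieVessiot.specOver C K ⟶ G,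
        LieVessiot.IsDifferential (LieVessiot.assocDer A.toField)
          (LieVessiot.assocDer (0 : LieVessiot.AutomorphicField C K G).toField)
          (LieVessiot.gauge σ).left,
      -- the Lie-Vessiot system splits
      LieVessiot.Splits C (LieVessiot.extend K M) (LieVessiot.assocDer X.toField),
      -- the automorphic system splits, is almost-constant, with space of constants `G`
      LieVessiot.Splits C (LieVessiot.extend K G) (LieVessiot.assocDer A.toField) ∧
        LieVessiot.IsAlmostConstant (LieVessiot.assocDer A.toField) ∧
        LieVessiot.ConstIso (LieVessiot.assocDer A.toField) G,
      -- the Lie-Vessiot system splits, is almost-constant, with space of constants `M`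
      LieVessiot.Splits C (LieVessiot.extend K M) (LieVessiot.assocDer X.toField) ∧
        LieVessiot.IsAlmostConstant (LieVessiot.assocDer X.toField) ∧
        LieVessiot.ConstIso (LieVessiot.assocDer X.toField) M ].TFAE := by
  subst hA
  rw [LieVessiot.toField_toLieVessiot, LieVessiot.toField_zero, LieVessiot.assocDer_zero]
  -- The first statement becomes the existence of a differential `K`-point of `(G_K, ∂_A)`, to which
  -- all the others are linked.
  simp only [LieVessiot.isAutomorphicSolution_iff hG A]
  have hb := LieVessiot.isDifferential_act (M := M) hG
  tfae_have 1 → 3 := fun ⟨σ, hσ⟩ => LieVessiot.exists_gauge_of_solution hG hσ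
  tfae_have 3 → 2 := fun ⟨σ, hσ⟩ => LieVessiot.splits_of_gauge hσ
  tfae_have 2 → 1 := LieVessiot.exists_solution_of_splits hG
  tfae_have 1 → 4 := fun ⟨σ, hσ⟩ => LieVessiot.splits_of_solution hb hσ
  tfae_have 4 → 1 := LieVessiot.exists_differential_kPoint hG hM hfaith _ hb A
  tfae_have 1 → 5 := fun ⟨σ, hσ⟩ => by
    obtain ⟨q, hq⟩ := LieVessiot.isConstantModel_regular_of_solution hG hσ
    obtain ⟨τ, hτ⟩ := LieVessiot.exists_gauge_of_solution hG hσ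
    exact ⟨LieVessiot.splits_of_gauge hτ, hq.isAlmostConstant, hq.nonempty_constIso⟩
  tfae_have 5 → 2 := fun h => h.1
  tfae_have 1 → 6 := fun ⟨σ, hσ⟩ =>
    have h := LieVessiot.isConstantModel_of_solution hM hb hσ
    ⟨LieVessiot.splits_of_solution hb hσ, h.isAlmostConstant, h.nonempty_constIso⟩
  tfae_have 6 → 4 := fun h => h.1
  tfae_finish
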